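/- Let $M$ be a (Hausdorff, finite-dimensional, smooth) manifold, $\pi:A\to M$ a smooth real vector bundle of finite rank $n>0$, and $A^*$ its dual. For $a\in\Gamma(A^*)$ let $\iota_a:A\to\mathbb R$ be the corresponding fibrewise linear function. A Jacobi structure on a manifold is a pair $(\Lambda,E)$ of a bivector field and a vector field with $[\Lambda,\Lambda]=-2E\wedge\Lambda$ and $[E,\Lambda]=0$ for the Schouten bracket (with the signs that make it a graded Lie bracket with $[X,f]=X(f)$ and $[P,Q\wedge R]=[P,Q]\wedge R+(-1)^{(p-1)q}Q\wedge[P,R]$ for $P,Q$ of degrees $p,q$); its Jacobi bracket is $\{f,g\}=\Lambda(df,dg)+fE(g)-gE(f)$, and the hamiltonian vector field of $f$ is $X_f=\Lambda(df,\cdot)+fE$. A Jacobi structure on $A$ is strongly-affine if for all smooth fibrewise affine functions $\varphi,\psi$ on $A$ both $\{\varphi,\psi\}$ and $X_\varphi(\psi)$ are fibrewise affine. A Jacobi algebroid structure $((⟦\cdot,\cdot⟧_*,\rho_*),X_0)$ on $A^*$ is a Lie algebroid structure $(⟦\cdot,\cdot⟧_*,\rho_*)$ on $A^*$ with differential $d_*$,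 together with a section $X_0\in\Gamma(A)=\Gamma((A^*)^*)$ such that $d_*X_0=0$. For a section $X$ of $A$, or a skew-symmetric $C^\infty(M)$-bilinear map $P:\Gamma(A^*)\times\Gamma(A^*)\to C^\infty(M)$ (that is, a section of $\wedge^2A$), the vertical lift to $A$ is denoted by $X^v$, $P^v$; $\Delta_A$ is the Liouville vector field of $A$. For every Lie algebroid structure on $A^*$ there is a unique linear Poisson structure $\bar\Lambda_A^*$ on $A$ with $\bar\Lambda_A^*(d\iota_a,d\iota_b)=\iota_{⟦a,b⟧_*}$ for all $a,b\in\Gamma(A^*)$, and every $P$ as above has a unique vertical lift. There is a one-to-one correspondence between - pairs consisting of a Jacobi algebroid structure $((⟦\cdot,\cdot⟧_*,\rho_*),X_0)$ on $A^*$ and a skew-symmetric $C^\infty(M)$-bilinear map $P_0:\Gamma(A^*)\times\Gamma(A^*)\to C^\infty(M)$ with $d_*P_0=-X_0\wedge P_0$, and - strongly-affine Jacobi structures $(\Lambda_A,E_A)$ on $A$, given by $$\Lambda_A=\bar\Lambda_A^*-P_0^v+\Delta_A\wedge X_0^v,\qquad E_A=-X_0^v .$$ Equivalently, for all $a,b\in\Gamma(A^*)$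 and $f,g\in C^\infty(M)$, the Jacobi bracket of affine functions is $$\{\iota_a+f\circ\pi,\ \iota_b+g\circ\pi\}=\iota_{⟦a,b⟧_*}+\bigl(-P_0(a,b)-f\,X_0(b)+g\,X_0(a)-\rho_*(b)(f)+\rho_*(a)(g)\bigr)\circ\pi .$$ -/

import Mathlib

open Bundle Manifold
open scoped ContDiff

noncomputable section

namespace JacobiBundle

/-! ### Multivector calculus on a smooth manifold -/

section Calculus

variable {E : Type*} [NormedAddCommGroup E] [NormedSpace ℝ E]
  {H : Type*} [TopologicalSpace H]

/-- The cotangent space at a point. -/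
abbrev Cotangent (J : ModelWithCorners ℝ E H) {N : Type*} [TopologicalSpace N] [ChartedSpace H N]
    (x : N) : Type _ :=
  TangentSpace J x →L[ℝ] ℝ

/-- Smooth vector fields: smooth sections of the tangent bundle. -/
abbrev VectorField (J : ModelWithCorners ℝ E H) (N : Type*) [TopologicalSpace N]
    [ChartedSpace H N] [IsManifold J ∞ N] : Type _ :=
  Cₛ^∞⟮J; E, fun x : N => TangentSpace J x⟯

/-- A smooth bivector field: an alternating bilinear form on each cotangent space, depending
smoothly on the point. Smoothness is tested on differentials of smooth functions, which on a
Hausdorff finite-dimensional manifold is the same as smoothness of the components in charts. -/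
@[ext]
structure BivectorField (J : ModelWithCorners ℝ E H) (N : Type*) [TopologicalSpace N]
    [ChartedSpace H N] where
  form : ∀ x : N, Cotangent J x →ₗ[ℝ] Cotangent J x →ₗ[ℝ] ℝ
  alternating : ∀ (x : N) (α : Cotangent J x), form x α α = 0
  smooth : ∀ f g : N → ℝ, ContMDiff J 𝓘(ℝ, ℝ) ∞ f → ContMDiff J 𝓘(ℝ, ℝ) ∞ g →
    ContMDiff J 𝓘(ℝ, ℝ) ∞ fun x => form x (mvfderiv J f x) (mvfderiv J g x)

variable {J : ModelWithCorners ℝ E H} {N : Type*} [TopologicalSpace N] [ChartedSpace H N]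
  [IsManifold J ∞ N]

/-- The function `X(f)`. -/
def VectorField.act (X : VectorField J N) (f : N → ℝ) : N → ℝ :=
  fun x => mvfderiv J f x (X x)

/-- The function `Λ(df, dg)`. -/
def BivectorField.onFun (Λ : BivectorField J N) (f g : N → ℝ) : N → ℝ :=
  fun x => Λ.form x (mvfderiv J f x) (mvfderiv J g x)

/-- The Schouten bracket `[Λ, Λ]`, evaluated on `df, dg, dh`. The sign convention is the one for
which `[X, f] = X(f)`, the bracket of vector fields is the commutator, the bracket is a graded Lie
bracket, and `[P, Q ∧ R] = [P, Q] ∧ R + (-1)^((p-1)q) Q ∧ [P, R]`. -/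
def BivectorField.schoutenSelf (Λ : BivectorField J N) (f g h : N → ℝ) : N → ℝ :=
  fun x => -2 * (Λ.onFun (Λ.onFun f g) h x + Λ.onFun (Λ.onFun g h) f x
    + Λ.onFun (Λ.onFun h f) g x)

/-- The Schouten bracket `[X, Λ]`, i.e. the Lie derivative of `Λ` along `X`, evaluated on
`df, dg`. -/
def VectorField.schouten (X : VectorField J N) (Λ : BivectorField J N) (f g : N → ℝ) : N → ℝ :=
  fun x => X.act (Λ.onFun f g) x - Λ.onFun (X.act f) g x - Λ.onFun f (X.act g) x

/-- The trivector field `X ∧ Λ`, evaluated on `df, dg, dh`. -/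
def VectorField.wedge (X : VectorField J N) (Λ : BivectorField J N) (f g h : N → ℝ) : N → ℝ :=
  fun x => X.act f x * Λ.onFun g h x + X.act g x * Λ.onFun h f x + X.act h x * Λ.onFun f g x

variable (J N) in
/-- A Jacobi structure: `[Λ, Λ] = -2 E ∧ Λ` and `[E, Λ] = 0`. -/
@[ext]
structure JacobiStructure where
  Λ : BivectorField J N
  E : VectorField J N
  schouten_self : ∀ f g h : N → ℝ, ContMDiff J 𝓘(ℝ, ℝ) ∞ f → ContMDiff J 𝓘(ℝ, ℝ) ∞ g →
    ContMDiff J 𝓘(ℝ, ℝ) ∞ h → ∀ x, Λ.schoutenSelf f g h x = -2 * VectorField.wedge E Λ f g h x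
  schouten_mixed : ∀ f g : N → ℝ, ContMDiff J 𝓘(ℝ, ℝ) ∞ f → ContMDiff J 𝓘(ℝ, ℝ) ∞ g →
    ∀ x, VectorField.schouten E Λ f g x = 0

/-- The Jacobi bracket `{f, g} = Λ(df, dg) + f E(g) - g E(f)`. -/
def JacobiStructure.bracket (S : JacobiStructure J N) (f g : N → ℝ) : N → ℝ :=
  fun x => S.Λ.onFun f g x + f x * VectorField.act S.E g x - g x * VectorField.act S.E f x

/-- The function `X_f(g)`, where `X_f = #_Λ(df) + f E` is the hamiltonian vector field of `f`. -/
def JacobiStructure.hamiltonianAct (S : JacobiStructure J N) (f g : N → ℝ) : N → ℝ :=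
  fun x => S.Λ.onFun f g x + f x * VectorField.act S.E g x

/-- A Poisson structure: `[Λ, Λ] = 0`. -/
def BivectorField.IsPoisson (Λ : BivectorField J N) : Prop :=
  ∀ f g h : N → ℝ, ContMDiff J 𝓘(ℝ, ℝ) ∞ f → ContMDiff J 𝓘(ℝ, ℝ) ∞ g →
    ContMDiff J 𝓘(ℝ, ℝ) ∞ h → ∀ x, Λ.schoutenSelf f g h x = 0

end Calculus

/-! ### Lie algebroids -/

section Algebroid

variable {E : Type*} [NormedAddCommGroup E] [NormedSpace ℝ E]
  {H : Type*} [TopologicalSpace H] {I : ModelWithCorners ℝ E H}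
  {M : Type*} [TopologicalSpace M] [ChartedSpace H M]
  {G : Type*} [NormedAddCommGroup G] [NormedSpace ℝ G]
  {W : M → Type*} [TopologicalSpace (TotalSpace G W)]
  [∀ x, AddCommGroup (W x)] [∀ x, Module ℝ (W x)] [∀ x, TopologicalSpace (W x)]
  [FiberBundle G W] [VectorBundle ℝ G W]

/-- The product of a smooth function and a smooth section. -/
def smulSection (f : C^∞⟮I, M; ℝ⟯) (s : Cₛ^∞⟮I; G, W⟯) : Cₛ^∞⟮I; G, W⟯ :=
  ⟨fun x => f x • s x, f.contMDiff.smul_section s.contMDiff⟩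

variable [∀ x, IsTopologicalAddGroup (W x)] [∀ x, ContinuousSMul ℝ (W x)] [IsManifold I ∞ M]

variable (I G W) in
/-- A Lie algebroid structure on the vector bundle `W → M`: a real Lie algebra structure on the
smooth sections, and an anchor (a smooth vector bundle morphism `W → TM` over the identity)
satisfying the Leibniz rule. -/
@[ext]
structure LieAlgebroid where
  bracket : Cₛ^∞⟮I; G, W⟯ → Cₛ^∞⟮I; G, W⟯ → Cₛ^∞⟮I; G, W⟯
  anchor : Cₛ^∞⟮I; G →L[ℝ] E, fun x : M => W x →L[ℝ] TangentSpace I x⟯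
  bracket_add : ∀ a b c, bracket a (b + c) = bracket a b + bracket a c
  bracket_smul : ∀ (r : ℝ) a b, bracket a (r • b) = r • bracket a b
  bracket_skew : ∀ a b, bracket a b = -bracket b a
  jacobi : ∀ a b c,
    bracket (bracket a b) c + bracket (bracket b c) a + bracket (bracket c a) b = 0
  leibniz : ∀ a (f : C^∞⟮I, M; ℝ⟯) b (x : M),
    bracket a (smulSection f b) x
      = f x • bracket a b x + (mvfderiv I f x (anchor x (a x)) : ℝ) • b x

/-- The function `ρ(a)(f)`. -/
def LieAlgebroid.rho (L : LieAlgebroid I G W) (a : Cₛ^∞⟮I; G, W⟯) (f : M → ℝ) : M → ℝ :=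
  fun x => mvfderiv I f x (L.anchor x (a x))

/-- The Lie algebroid differential of a 1-form, given as a map on sections. -/
def LieAlgebroid.d₁ (L : LieAlgebroid I G W) (φ : Cₛ^∞⟮I; G, W⟯ → M → ℝ)
    (a b : Cₛ^∞⟮I; G, W⟯) : M → ℝ :=
  fun x => L.rho a (φ b) x - L.rho b (φ a) x - φ (L.bracket a b) x

/-- The Lie algebroid differential of a 2-form, given as a map on pairs of sections. -/
def LieAlgebroid.d₂ (L : LieAlgebroid I G W) (P : Cₛ^∞⟮I; G, W⟯ → Cₛ^∞⟮I; G, W⟯ → M → ℝ)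
    (a b c : Cₛ^∞⟮I; G, W⟯) : M → ℝ :=
  fun x => L.rho a (P b c) x - L.rho b (P a c) x + L.rho c (P a b) x
    - P (L.bracket a b) c x + P (L.bracket a c) b x - P (L.bracket b c) a x

/-- The wedge product of a 1-form and a 2-form. -/
def wedge₁₂ (φ : Cₛ^∞⟮I; G, W⟯ → M → ℝ) (P : Cₛ^∞⟮I; G, W⟯ → Cₛ^∞⟮I; G, W⟯ → M → ℝ)
    (a b c : Cₛ^∞⟮I; G, W⟯) : M → ℝ :=
  fun x => φ a x * P b c x - φ b x * P a c x + φ c x * P a b x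

variable (I G W) in
/-- A skew-symmetric `C^∞(M)`-bilinear map `Γ(W) × Γ(W) → C^∞(M)`. -/
@[ext]
structure SkewBilinear where
  toFun : Cₛ^∞⟮I; G, W⟯ → Cₛ^∞⟮I; G, W⟯ → C^∞⟮I, M; ℝ⟯
  skew : ∀ a b, toFun a b = -toFun b a
  map_add : ∀ a b c, toFun a (b + c) = toFun a b + toFun a c
  map_smul : ∀ a (f : C^∞⟮I, M; ℝ⟯) b, toFun a (smulSection f b) = f * toFun a b

end Algebroid

/-! ### Structures on the total space of a vector bundle `A = TotalSpace F V → M` -/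

section TotalSpace

variable {E : Type*} [NormedAddCommGroup E] [NormedSpace ℝ E]
  {H : Type*} [TopologicalSpace H] {I : ModelWithCorners ℝ E H}
  {M : Type*} [TopologicalSpace M] [ChartedSpace H M] [IsManifold I ∞ M]
  {F : Type*} [NormedAddCommGroup F] [NormedSpace ℝ F]
  {V : M → Type*} [TopologicalSpace (TotalSpace F V)]
  [∀ x, AddCommGroup (V x)] [∀ x, Module ℝ (V x)] [∀ x, TopologicalSpace (V x)]
  [∀ x, IsTopologicalAddGroup (V x)] [∀ x, ContinuousSMul ℝ (V x)]
  [FiberBundle F V] [VectorBundle ℝ F V] [ContMDiffVectorBundle ∞ F V I]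

/-- The fibres of the dual bundle `A^*`. -/
abbrev DualFiber (V : M → Type*) [∀ x, AddCommGroup (V x)] [∀ x, Module ℝ (V x)]
    [∀ x, TopologicalSpace (V x)] (x : M) : Type _ :=
  V x →L[ℝ] Bundle.Trivial M ℝ x

variable (I F V) in
/-- Smooth sections of the dual bundle `A^*`. -/
abbrev DualSection : Type _ := Cₛ^∞⟮I; F →L[ℝ] ℝ, DualFiber V⟯

/-- The function `⟨a, X⟩` on `M`, for a section `X` of `A` and a section `a` of `A^*`. -/
def pairing (X : Cₛ^∞⟮I; F, V⟯) (a : DualSection I F V) : M → ℝ := fun x => a x (X x)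

/-- The fibrewise linear function `ι_a` on `A` given by a section `a` of `A^*`. -/
def linFun (a : DualSection I F V) : TotalSpace F V → ℝ := fun v => a v.proj v.snd

variable (I) in
/-- Smooth functions on `A` that are affine on each fibre. -/
def IsAffineFun (a : TotalSpace F V → ℝ) : Prop :=
  ContMDiff (I.prod 𝓘(ℝ, F)) 𝓘(ℝ, ℝ) ∞ a ∧
    ∀ x : M, ∃ (φ : V x →ₗ[ℝ] ℝ) (c : ℝ), ∀ w : V x, a ⟨x, w⟩ = φ w + c

variable (I) in
/-- Smooth functions on `A` that are linear on each fibre. -/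
def IsLinearFun (a : TotalSpace F V → ℝ) : Prop :=
  ContMDiff (I.prod 𝓘(ℝ, F)) 𝓘(ℝ, ℝ) ∞ a ∧
    ∀ x : M, ∃ φ : V x →ₗ[ℝ] ℝ, ∀ w : V x, a ⟨x, w⟩ = φ w

variable (I F) in
/-- The vertical lift of `w` to the point `v` of the same fibre: the velocity at `t = 0` of the
curve `t ↦ v + t w`. -/
def verticalLift (v : TotalSpace F V) (w : V v.proj) : TangentSpace (I.prod 𝓘(ℝ, F)) v :=
  mfderiv 𝓘(ℝ, ℝ) (I.prod 𝓘(ℝ, F))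
    (fun t : ℝ => (⟨v.proj, v.snd + t • w⟩ : TotalSpace F V)) 0 (1 : ℝ)

variable (I) in
/-- The Liouville vector field, whose value at `v` is the vertical lift of `v` itself. -/
def liouville (v : TotalSpace F V) : TangentSpace (I.prod 𝓘(ℝ, F)) v :=
  verticalLift I F v v.snd

/-- The vertical lift `X^v` of a section `X` of `A`. -/
def sectionLift (X : Cₛ^∞⟮I; F, V⟯) (v : TotalSpace F V) : TangentSpace (I.prod 𝓘(ℝ, F)) v :=
  verticalLift I F v (X v.proj)

/-- `B` is the vertical lift `P^v` of the 2-section `P` of `A`. -/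
def SkewBilinear.IsVerticalLift (P : SkewBilinear I (F →L[ℝ] ℝ) (DualFiber V))
    (B : BivectorField (I.prod 𝓘(ℝ, F)) (TotalSpace F V)) : Prop :=
  (∀ (a b : DualSection I F V) (v : TotalSpace F V),
    B.onFun (linFun a) (linFun b) v = P.toFun a b v.proj) ∧
  ∀ (f : C^∞⟮I, M; ℝ⟯) (g : TotalSpace F V → ℝ),
    ContMDiff (I.prod 𝓘(ℝ, F)) 𝓘(ℝ, ℝ) ∞ g →
    ∀ v : TotalSpace F V, B.onFun (fun u => f u.proj) g v = 0

/-- `B` is the linear Poisson structure on `A` induced by a Lie algebroid structure on `A^*`. -/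
def LieAlgebroid.IsInducedPoisson (L : LieAlgebroid I (F →L[ℝ] ℝ) (DualFiber V))
    (B : BivectorField (I.prod 𝓘(ℝ, F)) (TotalSpace F V)) : Prop :=
  B.IsPoisson ∧
  (∀ f g : TotalSpace F V → ℝ, IsLinearFun I f → IsLinearFun I g →
    IsLinearFun I (B.onFun f g)) ∧
  ∀ (a b : DualSection I F V) (v : TotalSpace F V),
    B.onFun (linFun a) (linFun b) v = linFun (L.bracket a b) v

variable (I F V) in
/-- A strongly-affine Jacobi structure on `A`: the Jacobi bracket of two affine functions is
affine, and the hamiltonian vector field of an affine function is affine, i.e. it maps affine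
functions to affine functions. -/
@[ext]
structure StronglyAffineJacobi extends JacobiStructure (I.prod 𝓘(ℝ, F)) (TotalSpace F V) where
  affine : ∀ a b : TotalSpace F V → ℝ, IsAffineFun I a → IsAffineFun I b →
    IsAffineFun I (toJacobiStructure.bracket a b)
  hamiltonian_affine : ∀ a b : TotalSpace F V → ℝ, IsAffineFun I a → IsAffineFun I b →
    IsAffineFun I (toJacobiStructure.hamiltonianAct a b)

variable (I F V) in
/-- A Jacobi algebroid structure on `A^*`: a Lie algebroid structure together with a 1-cocycle,
which is a section of `(A^*)^* = A`. -/
@[ext]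
structure DualJacobiAlgebroid extends LieAlgebroid I (F →L[ℝ] ℝ) (DualFiber V) where
  X₀ : Cₛ^∞⟮I; F, V⟯
  cocycle : ∀ a b x, toLieAlgebroid.d₁ (pairing X₀) a b x = 0

variable (I F V) in
/-- A Jacobi algebroid structure on `A^*` together with a skew-symmetric `C^∞(M)`-bilinear map
`P₀` such that `d_* P₀ = -X₀ ∧ P₀`. -/
@[ext]
structure TwistedJacobiAlgebroid extends DualJacobiAlgebroid I F V where
  P₀ : SkewBilinear I (F →L[ℝ] ℝ) (DualFiber V)
  twist : ∀ a b c x, toLieAlgebroid.d₂ (fun s t => P₀.toFun s t) a b c x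
    = -wedge₁₂ (pairing X₀) (fun s t => P₀.toFun s t) a b c x

end TotalSpace

end JacobiBundle

end

/-! Everything is decided on fibrewise affine functions. Around each point of `A` there are
coordinates whose components are globally defined affine functions (`exists_affine_chart`), so
differentials of affine functions exhaust every cotangent space (`dAff_surjective`), and bivector
and vector fields on `A` are determined by their values on affine functions. Conversely, an
alternating form on affine functions with smooth values, depending at each point only on
differentials there, comes from a bivector field (`exists_bivector_of_affine`).

From algebroids to Jacobi structures: `affForm` is such a form. If the differential of ι_a + f∘π
vanishes at v, then a vanishes at π(v), dι_a agrees at v with d(G∘π) for some function G on the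
base, and the Leibniz rule turns ι_⟦b,a⟧ into ρ(b)(G) at that point. The bracket and anchor terms
then add up to ρ(b)(G + f) = 0 (`exists_linearization`, `affForm_eq_zero`). The Jacobiator of the
resulting bracket is -½[Λ,Λ] - X∧Λ minus the cyclic sum of f[X,Λ](dg,dh) (`pairBracket_jacobiator`).
On affine functions its linear component vanishes by the Jacobi identity of the algebroid, and its
basic component by the cocycle condition, the twist condition and the fact that the anchor is a
morphism (`basicPart_jacobi`). Since the constant 1 is affine, [X,Λ] and the defect vanish
separately on affine functions. Both are tensorial, because two derivations commute at a critical
point by symmetry of the Hessian, so they vanish on all functions.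

Back from Jacobi structures: strong affinity bounds the degree along fibres. As X_φ(ψ) - {φ,ψ} =
ψE(φ), both E(φ) and ι_a E(φ) are affine, which forces E(φ) to be constant on fibres; the derivation
rule for fι_a then gives E(f∘π) = 0. Similarly Λ(dι_a, d(f∘π)) is basic and Λ vanishes on two basic
functions. Hence {ι_a, ι_b} splits into a linear part, the algebroid bracket, and a basic part, -P₀,
while -E(ι_a) defines X₀ and Λ(dι_a, d(f∘π)) the anchor. The axioms are components of the Leibniz
and Jacobi identities on affine functions (`linPart_smulSection_and`, `linPart_jacobi_and`). The
reconstruction is a right inverse of the first construction, and the first construction is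
injective. -/

noncomputable section

namespace JacobiBundle

open Filter Topology

set_option linter.unusedSectionVars false

/-! ### Differentials in charts, and derivations at a critical point -/

section LocalCalculus

variable {E₁ : Type*} [NormedAddCommGroup E₁] [NormedSpace ℝ E₁]
  {H₁ : Type*} [TopologicalSpace H₁] {J : ModelWithCorners ℝ E₁ H₁}
  {N : Type*} [TopologicalSpace N] [ChartedSpace H₁ N]

/-- The derivative of a function read in the chart at `x₀`. -/
def coordDeriv (J : ModelWithCorners ℝ E₁ H₁) (x₀ : N) (f : N → ℝ) (y : N) : E₁ →L[ℝ] ℝ :=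
  fderiv ℝ (f ∘ (extChartAt J x₀).symm) (extChartAt J x₀ y)

theorem mvfderiv_congr {G : Type*} [NormedAddCommGroup G] [NormedSpace ℝ G] {f g : N → G} {x : N}
    (h : f =ᶠ[𝓝 x] g) : mvfderiv J f x = mvfderiv J g x := by
  ext v
  simp only [mvfderiv, h.mfderiv_eq]
  rfl

theorem contMDiff_real_mdiff {f : N → ℝ} (hf : ContMDiff J 𝓘(ℝ, ℝ) ∞ f) (x : N) :
    MDifferentiableAt J 𝓘(ℝ, ℝ) f x :=
  (hf x).mdifferentiableAt (by simp)

theorem mvfderiv_differentiable_comp {g : E₁ → ℝ} {Ψ : N → E₁} {y : N}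
    (hg : DifferentiableAt ℝ g (Ψ y)) (hΨ : MDifferentiableAt J 𝓘(ℝ, E₁) Ψ y) :
    mvfderiv J (fun u => g (Ψ u)) y = (fderiv ℝ g (Ψ y)).comp (mvfderiv J Ψ y) := by
  refine (mvfderiv_comp (I := 𝓘(ℝ, E₁)) (I' := J) y (g := g) (f := Ψ)
      hg.mdifferentiableAt hΨ).trans ?_
  ext w
  simp [mvfderiv, mfderiv_eq_fderiv]
  rfl

theorem mvfderiv_clm_comp (c : E₁ →L[ℝ] ℝ) {Ψ : N → E₁} {y : N}
    (hΨ : MDifferentiableAt J 𝓘(ℝ, E₁) Ψ y) :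
    mvfderiv J (fun u => c (Ψ u)) y = c.comp (mvfderiv J Ψ y) := by
  rw [mvfderiv_differentiable_comp c.differentiableAt hΨ, c.fderiv]

/-- Links smoothness of vector fields, which is read in the trivialization, with the differential of
the chart, in which coordinate formulas are written. -/
theorem tangent_trivializationAt_apply [IsManifold J ∞ N] {x₀ x : N}
    (hx : x ∈ (chartAt H₁ x₀).source) (w : TangentSpace J x) :
    (trivializationAt E₁ (TangentSpace J) x₀ ⟨x, w⟩).2 = mvfderiv J (extChartAt J x₀) x w := by
  have h := congrArg (fun L => L w) (TangentBundle.continuousLinearMapAt_trivializationAt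
    (I := J) hx)
  refine Eq.trans ?_ h
  rw [Trivialization.continuousLinearMapAt_apply, Trivialization.linearMapAt_apply,
    if_pos (by simpa using hx)]

theorem mvfderiv_extChartAt_self_apply [IsManifold J ∞ N] (x : N) (w : TangentSpace J x) :
    mvfderiv J (extChartAt J x) x w = w := by
  simp only [mvfderiv, mfderiv_extChartAt_self]
  rfl

/-- A vector field is smooth if it maps smooth functions to smooth functions, provided that charts
extend to globally smooth functions. -/
theorem contMDiff_vectorField_of_act [FiniteDimensional ℝ E₁] [IsManifold J ∞ N]
    {Y : ∀ x : N, TangentSpace J x}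
    (hY : ∀ f : N → ℝ, ContMDiff J 𝓘(ℝ, ℝ) ∞ f →
      ContMDiff J 𝓘(ℝ, ℝ) ∞ fun x => mvfderiv J f x (Y x))
    (hΨ : ∀ x₀ : N, ∃ Ψ : N → E₁, ContMDiff J 𝓘(ℝ, E₁) ∞ Ψ ∧ Ψ =ᶠ[𝓝 x₀] extChartAt J x₀) :
    ContMDiff J (J.prod 𝓘(ℝ, E₁)) ∞ fun x => TotalSpace.mk' E₁ x (Y x) := by
  intro x₀
  obtain ⟨Ψ, hΨ, hΨe⟩ := hΨ x₀
  rw [contMDiffAt_section]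
  have b := Module.finBasis ℝ E₁
  have h1 : ∀ᶠ x in 𝓝 x₀, (trivializationAt E₁ (TangentSpace J) x₀ ⟨x, Y x⟩).2 =
      ∑ i, (mvfderiv J (fun u => (b.coord i).toContinuousLinearMap (Ψ u)) x (Y x)) • b i := by
    filter_upwards [hΨe.eventuallyEq_nhds, (chartAt H₁ x₀).open_source.mem_nhds
      (mem_chart_source H₁ x₀)] with x hx hxs
    simp only [mvfderiv_clm_comp _ ((hΨ x).mdifferentiableAt (by simp))]
    rw [mvfderiv_congr hx, tangent_trivializationAt_apply hxs]
    exact (b.sum_repr _).symm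
  refine ContMDiffAt.congr_of_eventuallyEq ?_ h1
  refine contMDiffAt_finsetSum fun i _ => ?_
  exact ((hY _ (((b.coord i).toContinuousLinearMap.contDiff.contMDiff).comp hΨ)) x₀).smul
    contMDiffAt_const

variable [J.Boundaryless] [IsManifold J ∞ N]

/-- Without boundary the chart target is open, so smoothness on the target is smoothness at each of
its points and `fderiv` may be used there. -/
theorem contDiffAt_comp_symm {f : N → ℝ} (hf : ContMDiff J 𝓘(ℝ, ℝ) ∞ f) (x₀ : N) {z : E₁}
    (hz : z ∈ (extChartAt J x₀).target) :
    ContDiffAt ℝ ∞ (f ∘ (extChartAt J x₀).symm) z := by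
  have h := (hf.contMDiffOn (s := Set.univ)).comp (contMDiffOn_extChartAt_symm (n := ∞) x₀)
    (fun _ _ => Set.mem_univ _)
  exact (contMDiffOn_iff_contDiffOn.1 h).contDiffAt ((isOpen_extChartAt_target x₀).mem_nhds hz)

theorem contMDiffAt_coordDeriv {f : N → ℝ} (hf : ContMDiff J 𝓘(ℝ, ℝ) ∞ f) (x₀ : N) {y : N}
    (hy : y ∈ (chartAt H₁ x₀).source) :
    ContMDiffAt J 𝓘(ℝ, E₁ →L[ℝ] ℝ) ∞ (coordDeriv J x₀ f) y := by
  have hy' : y ∈ (extChartAt J x₀).source := by rwa [extChartAt_source]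
  have h1 : ContDiffAt ℝ ∞ (fderiv ℝ (f ∘ (extChartAt J x₀).symm)) (extChartAt J x₀ y) :=
    (contDiffAt_comp_symm hf x₀ ((extChartAt J x₀).map_source hy')).fderiv_right (by simp)
  exact h1.contMDiffAt.comp y (contMDiffAt_extChartAt' hy)

theorem mvfderiv_eq_coordDeriv {f : N → ℝ} (hf : ContMDiff J 𝓘(ℝ, ℝ) ∞ f) (x₀ : N) {y : N}
    (hy : y ∈ (chartAt H₁ x₀).source) :
    mvfderiv J f y = (coordDeriv J x₀ f y).comp (mvfderiv J (extChartAt J x₀) y) := by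
  have hy' : y ∈ (extChartAt J x₀).source := by rwa [extChartAt_source]
  have hd := (contDiffAt_comp_symm hf x₀ ((extChartAt J x₀).map_source hy')).differentiableAt
    (by simp)
  have hev : f =ᶠ[𝓝 y] fun u => (f ∘ (extChartAt J x₀).symm) (extChartAt J x₀ u) := by
    filter_upwards [(isOpen_extChartAt_source x₀).mem_nhds hy'] with u hu
    exact congrArg f ((extChartAt J x₀).left_inv hu).symm
  rw [mvfderiv_congr hev, mvfderiv_differentiable_comp hd (mdifferentiableAt_extChartAt hy)]
  rfl

theorem mvfderiv_self_eq_coordDeriv {f : N → ℝ} (hf : ContMDiff J 𝓘(ℝ, ℝ) ∞ f) (x : N) :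
    mvfderiv J f x = coordDeriv J x f x := by
  rw [mvfderiv_eq_coordDeriv hf x (mem_chart_source H₁ x)]
  ext w
  exact congrArg (coordDeriv J x f x) (mvfderiv_extChartAt_self_apply x w)

/-- The expansion df = Σ ∂ᵢf dxⁱ, with the coordinates replaced by globally smooth functions. The
replacement matters because smoothness of a bivector field is tested on global functions only. -/
theorem mvfderiv_eq_sum_coord {ι : Type*} [Fintype ι] [FiniteDimensional ℝ E₁]
    (b : Module.Basis ι ℝ E₁)
    {f : N → ℝ} (hf : ContMDiff J 𝓘(ℝ, ℝ) ∞ f) {x₀ : N} {Ψ : N → E₁}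
    (hΨ : ContMDiff J 𝓘(ℝ, E₁) ∞ Ψ) (hΨe : Ψ =ᶠ[𝓝 x₀] extChartAt J x₀) :
    ∀ᶠ y in 𝓝 x₀, mvfderiv J f y = ∑ i, coordDeriv J x₀ f y (b i) •
      mvfderiv J (fun u => (b.coord i).toContinuousLinearMap (Ψ u)) y := by
  filter_upwards [hΨe.eventuallyEq_nhds, (chartAt H₁ x₀).open_source.mem_nhds
    (mem_chart_source H₁ x₀)] with y hy hys
  rw [mvfderiv_eq_coordDeriv hf x₀ hys, ← mvfderiv_congr hy]
  simp only [mvfderiv_clm_comp _ ((hΨ y).mdifferentiableAt (by simp))]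
  ext w
  rw [ContinuousLinearMap.comp_apply, sum_apply]
  set u : E₁ := mvfderiv J Ψ y w
  conv_lhs => rw [← b.sum_repr u]
  rw [map_sum]
  refine Finset.sum_congr rfl fun i _ => ?_
  rw [map_smul, smul_eq_mul, mul_comm]
  rfl

/-- Brings the Hessian of `f` in the chart into view, so that its symmetry can be used. -/
theorem mvfderiv_coordDeriv_apply [FiniteDimensional ℝ E₁] {ι : Type*} [Fintype ι]
    (b : Module.Basis ι ℝ E₁)
    {f : N → ℝ} (hf : ContMDiff J 𝓘(ℝ, ℝ) ∞ f) {v : N} {Ψ : N → E₁}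
    (hΨ : ContMDiff J 𝓘(ℝ, E₁) ∞ Ψ) (hΨe : Ψ =ᶠ[𝓝 v] extChartAt J v) (w : E₁) :
    mvfderiv J (fun y => coordDeriv J v f y w) v =
      ∑ j, fderiv ℝ (fderiv ℝ (f ∘ (extChartAt J v).symm)) (extChartAt J v v) (b j) w •
      mvfderiv J (fun u => (b.coord j).toContinuousLinearMap (Ψ u)) v := by
  have hg := contDiffAt_comp_symm hf v (mem_extChartAt_target (I := J) v)
  have hd : DifferentiableAt ℝ (fderiv ℝ (f ∘ (extChartAt J v).symm)) (extChartAt J v v) :=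
    (hg.fderiv_right (m := 1) (by norm_cast)).differentiableAt (by simp)
  have h1 : mvfderiv J (fun y => coordDeriv J v f y w) v =
      (fderiv ℝ (fun z => fderiv ℝ (f ∘ (extChartAt J v).symm) z w) (extChartAt J v v)).comp
        (mvfderiv J (extChartAt J v) v) :=
    mvfderiv_differentiable_comp (Ψ := extChartAt J v)
      (g := fun z => fderiv ℝ (f ∘ (extChartAt J v).symm) z w)
      (hd.clm_apply (differentiableAt_const w))
      (mdifferentiableAt_extChartAt (mem_chart_source H₁ v))
  rw [h1, ← mvfderiv_congr hΨe]
  simp only [mvfderiv_clm_comp _ ((hΨ v).mdifferentiableAt (by simp))]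
  ext t
  rw [ContinuousLinearMap.comp_apply, sum_apply]
  set u : E₁ := mvfderiv J Ψ v t
  conv_lhs => rw [← b.sum_repr u]
  rw [map_sum]
  refine Finset.sum_congr rfl fun i _ => ?_
  rw [map_smul, smul_eq_mul, mul_comm]
  rw [fderiv_clm_apply hd (differentiableAt_const w)]
  simp
  left
  rfl

/-- Near `v` one has Y(f) = Σ ∂ᵢf · Y(xⁱ). The factors ∂ᵢf vanish at the critical point, so the
terms of the product rule that differentiate Y(xⁱ) drop out. -/
theorem mvfderiv_derivation_of_mvfderiv_eq_zero [FiniteDimensional ℝ E₁] {ι : Type*} [Fintype ι]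
    (b : Module.Basis ι ℝ E₁)
    {Y : ∀ x : N, Cotangent J x →ₗ[ℝ] ℝ}
    (hY : ∀ f : N → ℝ, ContMDiff J 𝓘(ℝ, ℝ) ∞ f →
      ContMDiff J 𝓘(ℝ, ℝ) ∞ fun x => Y x (mvfderiv J f x))
    {f : N → ℝ} (hf : ContMDiff J 𝓘(ℝ, ℝ) ∞ f) {v : N} (hdf : mvfderiv J f v = 0) {Ψ : N → E₁}
    (hΨ : ContMDiff J 𝓘(ℝ, E₁) ∞ Ψ) (hΨe : Ψ =ᶠ[𝓝 v] extChartAt J v) :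
    mvfderiv J (fun y => Y y (mvfderiv J f y)) v =
      ∑ i, Y v (mvfderiv J (fun u => (b.coord i).toContinuousLinearMap (Ψ u)) v) •
        mvfderiv J (fun y => coordDeriv J v f y (b i)) v := by
  have hψ : ∀ i, ContMDiff J 𝓘(ℝ, ℝ) ∞ (fun u => (b.coord i).toContinuousLinearMap (Ψ u)) :=
    fun i => ((b.coord i).toContinuousLinearMap.contDiff.contMDiff).comp hΨ
  have hev : (fun y => Y y (mvfderiv J f y)) =ᶠ[𝓝 v] fun y => ∑ i, coordDeriv J v f y (b i) *
      Y y (mvfderiv J (fun u => (b.coord i).toContinuousLinearMap (Ψ u)) y) := by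
    filter_upwards [mvfderiv_eq_sum_coord b hf hΨ hΨe] with y hy
    rw [hy, map_sum]
    simp
  have hc : ∀ i, MDifferentiableAt J 𝓘(ℝ, ℝ) (fun y => coordDeriv J v f y (b i)) v := fun i =>
    ((contMDiffAt_coordDeriv hf v (mem_chart_source H₁ v)).clm_apply
      contMDiffAt_const).mdifferentiableAt (by simp)
  have h0 : ∀ i, coordDeriv J v f v (b i) = 0 := fun i => by
    have := mvfderiv_self_eq_coordDeriv hf v
    rw [← this, hdf]; rfl
  rw [mvfderiv_congr hev]
  have hsum : ∀ s : Finset ι, MDifferentiableAt J 𝓘(ℝ, ℝ) (fun y => ∑ i ∈ s, coordDeriv J v f y (b i) *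
      Y y (mvfderiv J (fun u => (b.coord i).toContinuousLinearMap (Ψ u)) y)) v ∧
      mvfderiv J (fun y => ∑ i ∈ s, coordDeriv J v f y (b i) *
      Y y (mvfderiv J (fun u => (b.coord i).toContinuousLinearMap (Ψ u)) y)) v =
      ∑ i ∈ s, Y v (mvfderiv J (fun u => (b.coord i).toContinuousLinearMap (Ψ u)) v) •
        mvfderiv J (fun y => coordDeriv J v f y (b i)) v := by
    classical
    intro s
    induction s using Finset.induction_on with
    | empty => simpa using ⟨mdifferentiableAt_const, mvfderiv_const (0 : ℝ)⟩
    | insert i s hi ih =>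
      simp only [Finset.sum_insert hi]
      have hm : MDifferentiableAt J 𝓘(ℝ, ℝ) (fun y => coordDeriv J v f y (b i) *
          Y y (mvfderiv J (fun u => (b.coord i).toContinuousLinearMap (Ψ u)) y)) v :=
        (hc i).mul (contMDiff_real_mdiff (hY _ (hψ i)) v)
      refine ⟨hm.add ih.1, ?_⟩
      rw [mvfderiv_fun_add hm ih.1, ih.2,
        mvfderiv_fun_mul (hc i) (contMDiff_real_mdiff (hY _ (hψ i)) v), h0]
      simp
  exact (hsum Finset.univ).2

/-- Two derivations commute at a critical point. -/
theorem derivation_comm_of_mvfderiv_eq_zero [FiniteDimensional ℝ E₁]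
    {X Y : ∀ x : N, Cotangent J x →ₗ[ℝ] ℝ}
    (hX : ∀ f : N → ℝ, ContMDiff J 𝓘(ℝ, ℝ) ∞ f →
      ContMDiff J 𝓘(ℝ, ℝ) ∞ fun x => X x (mvfderiv J f x))
    (hY : ∀ f : N → ℝ, ContMDiff J 𝓘(ℝ, ℝ) ∞ f →
      ContMDiff J 𝓘(ℝ, ℝ) ∞ fun x => Y x (mvfderiv J f x))
    {f : N → ℝ} (hf : ContMDiff J 𝓘(ℝ, ℝ) ∞ f) {v : N} (hdf : mvfderiv J f v = 0) {Ψ : N → E₁}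
    (hΨ : ContMDiff J 𝓘(ℝ, E₁) ∞ Ψ) (hΨe : Ψ =ᶠ[𝓝 v] extChartAt J v) :
    X v (mvfderiv J (fun y => Y y (mvfderiv J f y)) v) =
      Y v (mvfderiv J (fun y => X y (mvfderiv J f y)) v) := by
  have b := Module.finBasis ℝ E₁
  have hs : IsSymmSndFDerivAt ℝ (f ∘ (extChartAt J v).symm) (extChartAt J v v) :=
    (contDiffAt_comp_symm hf v (mem_extChartAt_target (I := J) v)).isSymmSndFDerivAt (by simp; norm_cast)
  rw [mvfderiv_derivation_of_mvfderiv_eq_zero b hX hf hdf hΨ hΨe,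
    mvfderiv_derivation_of_mvfderiv_eq_zero b hY hf hdf hΨ hΨe]
  simp only [mvfderiv_coordDeriv_apply b hf hΨ hΨe, map_sum, map_smul, smul_eq_mul, Finset.mul_sum]
  -- Both sides are double sums of X(xⁱ)Y(xʲ) against second derivatives of `f`; after the exchange
  -- only the symmetry of the Hessian is needed.
  rw [Finset.sum_comm]
  refine Finset.sum_congr rfl fun i _ => Finset.sum_congr rfl fun j _ => ?_
  rw [hs (b i) (b j)]
  ring

end LocalCalculus

/-! ### Bump functions and global extensions -/

section Cutoff

/-- In finite dimension `L` is the sum of the dual basis vectors tensored with its columns `L (b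
i)`, so smooth columns suffice. -/
theorem contMDiffAt_clm_of_apply {E₂ : Type*} [NormedAddCommGroup E₂] [NormedSpace ℝ E₂]
    {H₂ : Type*} [TopologicalSpace H₂] {J₂ : ModelWithCorners ℝ E₂ H₂}
    {N₂ : Type*} [TopologicalSpace N₂] [ChartedSpace H₂ N₂]
    {G G' : Type*} [NormedAddCommGroup G] [NormedSpace ℝ G] [FiniteDimensional ℝ G]
    [NormedAddCommGroup G'] [NormedSpace ℝ G'] {L : N₂ → G →L[ℝ] G'} {x : N₂}
    (h : ∀ w, ContMDiffAt J₂ 𝓘(ℝ, G') ∞ (fun y => L y w) x) :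
    ContMDiffAt J₂ 𝓘(ℝ, G →L[ℝ] G') ∞ L x := by
  have b := Module.finBasis ℝ G
  have hL : L = fun y => ∑ i, ContinuousLinearMap.smulRightL ℝ G G'
      ((b.coord i).toContinuousLinearMap) (L y (b i)) := by
    funext y
    ext w
    simp only [sum_apply, ContinuousLinearMap.smulRightL_apply_apply]
    conv_lhs => rw [← b.sum_repr w, map_sum]
    simp
  rw [hL]
  refine contMDiffAt_finsetSum fun i _ => ?_
  exact (ContinuousLinearMap.contMDiff _).contMDiffAt.comp x (h (b i))

variable {E : Type*} [NormedAddCommGroup E] [NormedSpace ℝ E] [FiniteDimensional ℝ E]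
  {M : Type*} [TopologicalSpace M] [T2Space M] [ChartedSpace E M] [IsManifold 𝓘(ℝ, E) ∞ M]

theorem exists_cutoff (x₀ : M) {U : Set M} (hU : U ∈ 𝓝 x₀) :
    ∃ χ : C^∞⟮𝓘(ℝ, E), M; ℝ⟯, tsupport χ ⊆ U ∧ (χ : M → ℝ) =ᶠ[𝓝 x₀] 1 := by
  obtain ⟨χ, -, hχ⟩ := (SmoothBumpFunction.nhds_basis_tsupport (I := 𝓘(ℝ, E)) x₀).mem_iff.1 hU
  exact ⟨⟨χ, χ.contMDiff⟩, hχ, χ.eventuallyEq_one⟩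

/-- A bump function times the chart. Hypotheses about global smooth functions thereby apply to
coordinates. -/
theorem exists_chart_extension (x₀ : M) : ∃ Ψ : M → E, ContMDiff 𝓘(ℝ, E) 𝓘(ℝ, E) ∞ Ψ ∧
    Ψ =ᶠ[𝓝 x₀] extChartAt 𝓘(ℝ, E) x₀ := by
  obtain ⟨χ⟩ : Nonempty (SmoothBumpFunction 𝓘(ℝ, E) x₀) := inferInstance
  refine ⟨_, χ.contMDiff_smul (contMDiffOn_extChartAt (n := ∞)), ?_⟩
  filter_upwards [χ.eventuallyEq_one] with y hy
  simp [hy]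

/-- Cutting off by the pullback of a function supported in `U`. -/
theorem contMDiff_smul_of_tsupport {E₂ : Type*} [NormedAddCommGroup E₂] [NormedSpace ℝ E₂]
    {H₂ : Type*} [TopologicalSpace H₂] {J₂ : ModelWithCorners ℝ E₂ H₂}
    {N₂ : Type*} [TopologicalSpace N₂] [ChartedSpace H₂ N₂]
    {G : Type*} [NormedAddCommGroup G] [NormedSpace ℝ G]
    {p : N₂ → M} (hp : ContMDiff J₂ 𝓘(ℝ, E) ∞ p) (χ : C^∞⟮𝓘(ℝ, E), M; ℝ⟯) {U : Set M}
    (hχ : tsupport χ ⊆ U) {g : N₂ → G} (hg : ∀ v, p v ∈ U → ContMDiffAt J₂ 𝓘(ℝ, G) ∞ g v) :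
    ContMDiff J₂ 𝓘(ℝ, G) ∞ fun v => χ (p v) • g v := by
  intro v
  by_cases hv : p v ∈ U
  · exact ((χ.contMDiff.comp hp) v).smul (hg v hv)
  · have h0 : (fun u => χ (p u) • g u) =ᶠ[𝓝 v] fun _ => 0 := by
      have : (tsupport χ)ᶜ ∈ 𝓝 (p v) :=
        (isClosed_tsupport _).isOpen_compl.mem_nhds fun h => hv (hχ h)
      filter_upwards [hp.continuous.continuousAt this] with u hu
      rw [image_eq_zero_of_notMem_tsupport hu, zero_smul]
    exact contMDiffAt_const.congr_of_eventuallyEq h0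

end Cutoff

/-! ### Smoothness in hom bundles -/

section HomBundle

variable {E : Type*} [NormedAddCommGroup E] [NormedSpace ℝ E]
  {M : Type*} [TopologicalSpace M] [ChartedSpace E M]
  {G : Type*} [NormedAddCommGroup G] [NormedSpace ℝ G] [FiniteDimensional ℝ G]
  {W : M → Type*} [TopologicalSpace (TotalSpace G W)]
  [∀ x, AddCommGroup (W x)] [∀ x, Module ℝ (W x)] [∀ x, TopologicalSpace (W x)]
  [FiberBundle G W] [VectorBundle ℝ G W]
  {G' : Type*} [NormedAddCommGroup G'] [NormedSpace ℝ G']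
  {W' : M → Type*} [TopologicalSpace (TotalSpace G' W')]
  [∀ x, AddCommGroup (W' x)] [∀ x, Module ℝ (W' x)] [∀ x, TopologicalSpace (W' x)]
  [FiberBundle G' W'] [VectorBundle ℝ G' W']
  [∀ x, IsTopologicalAddGroup (W' x)] [∀ x, ContinuousSMul ℝ (W' x)]

/-- The columns of `φ` in trivializations are the images of the sections that are constant in the
trivialization of the source. -/
theorem contMDiffAt_hom_of_apply {φ : ∀ x, W x →L[ℝ] W' x} {x₀ : M}
    (h : ∀ w : G, ContMDiffAt 𝓘(ℝ, E) (𝓘(ℝ, E).prod 𝓘(ℝ, G')) ∞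
      (fun x => TotalSpace.mk' G' x (φ x ((trivializationAt G W x₀).symm x w))) x₀) :
    ContMDiffAt 𝓘(ℝ, E) (𝓘(ℝ, E).prod 𝓘(ℝ, G →L[ℝ] G')) ∞
      (fun x => TotalSpace.mk' (G →L[ℝ] G') (E := fun x => W x →L[ℝ] W' x) x (φ x)) x₀ := by
  rw [contMDiffAt_hom_bundle]
  refine ⟨contMDiffAt_id, contMDiffAt_clm_of_apply fun w => ?_⟩
  have h1 := (contMDiffAt_section x₀).1 (h w)
  refine h1.congr_of_eventuallyEq ?_
  filter_upwards [(trivializationAt G W x₀).open_baseSet.mem_nhds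
    (FiberBundle.mem_baseSet_trivializationAt' x₀),
    (trivializationAt G' W' x₀).open_baseSet.mem_nhds
    (FiberBundle.mem_baseSet_trivializationAt' x₀)] with x hx hx'
  simp only [ContinuousLinearMap.inCoordinates, ContinuousLinearMap.comp_apply]
  rw [Trivialization.continuousLinearMapAt_apply, Trivialization.linearMapAt_apply,
    if_pos hx', Trivialization.symmL_apply _ hx]

end HomBundle

/-! ### Sections of the dual bundle and fibrewise affine functions -/

section Sections

variable {E : Type*} [NormedAddCommGroup E] [NormedSpace ℝ E] [FiniteDimensional ℝ E]
  {M : Type*} [TopologicalSpace M] [T2Space M] [ChartedSpace E M] [IsManifold 𝓘(ℝ, E) ∞ M]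
  {F : Type*} [NormedAddCommGroup F] [NormedSpace ℝ F] [FiniteDimensional ℝ F]
  {V : M → Type*} [TopologicalSpace (TotalSpace F V)]
  [∀ x, AddCommGroup (V x)] [∀ x, Module ℝ (V x)] [∀ x, TopologicalSpace (V x)]
  [∀ x, IsTopologicalAddGroup (V x)] [∀ x, ContinuousSMul ℝ (V x)]
  [FiberBundle F V] [VectorBundle ℝ F V] [ContMDiffVectorBundle ∞ F V 𝓘(ℝ, E)]

/-- ι_a is the pullback of `a` along the projection, evaluated on the tautological section `u ↦
u.snd`. -/
theorem contMDiff_linFun (a : DualSection 𝓘(ℝ, E) F V) :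
    ContMDiff (𝓘(ℝ, E).prod 𝓘(ℝ, F)) 𝓘(ℝ, ℝ) ∞ (linFun a) := by
  intro v
  have h := ContMDiffAt.clm_apply_of_inCoordinates (n := ∞) (IM := 𝓘(ℝ, E).prod 𝓘(ℝ, F))
    (IB₁ := 𝓘(ℝ, E)) (IB₂ := 𝓘(ℝ, E))
    (E₁ := V) (E₂ := Bundle.Trivial M ℝ) (F₁ := F) (F₂ := ℝ) (m₀ := v)
    (b₁ := fun u : TotalSpace F V => u.proj) (b₂ := fun u : TotalSpace F V => u.proj)
    (ϕ := fun u => a u.proj) (v := fun u => u.snd)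
    (((contMDiffAt_hom_bundle _).1 (a.contMDiff v.proj)).2.comp v (contMDiffAt_proj V))
    contMDiffAt_id (contMDiffAt_proj V)
  exact (contMDiffAt_totalSpace.1 h).2

theorem isLinearFun_linFun (a : DualSection 𝓘(ℝ, E) F V) : IsLinearFun 𝓘(ℝ, E) (linFun a) :=
  ⟨contMDiff_linFun a, fun x => ⟨(a x : V x →L[ℝ] ℝ).toLinearMap, fun _ => rfl⟩⟩

/-- A column of `a` in a trivialization is the given function composed with a local section of `V`
constant in that trivialization. -/
theorem contMDiff_dualSection {a : ∀ x, DualFiber V x}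
    (h : ContMDiff (𝓘(ℝ, E).prod 𝓘(ℝ, F)) 𝓘(ℝ, ℝ) ∞
      fun v : TotalSpace F V => (a v.proj v.snd : ℝ)) :
    ContMDiff 𝓘(ℝ, E) (𝓘(ℝ, E).prod 𝓘(ℝ, F →L[ℝ] ℝ)) ∞
      fun x => TotalSpace.mk' (F →L[ℝ] ℝ) (E := DualFiber V) x (a x) := by
  intro x₀
  refine contMDiffAt_hom_of_apply (W' := Bundle.Trivial M ℝ) fun w => ?_
  rw [contMDiffAt_section]
  have hs : ContMDiffAt 𝓘(ℝ, E) (𝓘(ℝ, E).prod 𝓘(ℝ, F)) ∞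
      (fun x => TotalSpace.mk' F x ((trivializationAt F V x₀).symm x w)) x₀ := by
    rw [contMDiffAt_section]
    refine (contMDiffAt_const (c := w)).congr_of_eventuallyEq ?_
    filter_upwards [(trivializationAt F V x₀).open_baseSet.mem_nhds
      (FiberBundle.mem_baseSet_trivializationAt' x₀)] with x hx
    exact congrArg Prod.snd ((trivializationAt F V x₀).apply_mk_symm hx w)
  exact (h _).comp x₀ hs

theorem exists_linFun_eq {f : TotalSpace F V → ℝ} (hf : IsLinearFun 𝓘(ℝ, E) f) :
    ∃ a : DualSection 𝓘(ℝ, E) F V, linFun a = f := by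
  choose φ hφ using hf.2
  -- Passing through the trivialization makes the fibre functional a linear map on the
  -- finite-dimensional `F`, where continuity is automatic.
  let a : ∀ x, DualFiber V x := fun x =>
    ((φ x).comp ((trivializationAt F V x).symmL ℝ x).toLinearMap).toContinuousLinearMap.comp
      ((trivializationAt F V x).continuousLinearMapAt ℝ x)
  have ha : ∀ x w, a x w = φ x w := fun x w => by
    have := (trivializationAt F V x).symmL_continuousLinearMapAt (R := ℝ)
      (FiberBundle.mem_baseSet_trivializationAt' x) w
    exact congrArg (φ x) this
  have hfa : (fun v : TotalSpace F V => (a v.proj v.snd : ℝ)) = f := by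
    funext v
    exact (ha _ _).trans (hφ _ _).symm
  exact ⟨⟨a, contMDiff_dualSection (hfa ▸ hf.1)⟩, hfa⟩

theorem linFun_injective {a b : DualSection 𝓘(ℝ, E) F V} (h : linFun a = linFun b) : a = b := by
  ext x w
  exact congrFun h ⟨x, w⟩

/-- The fibrewise affine function `ι_a + f ∘ π`. -/
def affFun (a : DualSection 𝓘(ℝ, E) F V) (f : C^∞⟮𝓘(ℝ, E), M; ℝ⟯) : TotalSpace F V → ℝ :=
  fun u => linFun a u + f u.proj

theorem contMDiff_comp_proj (f : C^∞⟮𝓘(ℝ, E), M; ℝ⟯) :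
    ContMDiff (𝓘(ℝ, E).prod 𝓘(ℝ, F)) 𝓘(ℝ, ℝ) ∞ fun u : TotalSpace F V => f u.proj :=
  f.contMDiff.comp (contMDiff_proj V)

theorem contMDiff_affFun (a : DualSection 𝓘(ℝ, E) F V) (f : C^∞⟮𝓘(ℝ, E), M; ℝ⟯) :
    ContMDiff (𝓘(ℝ, E).prod 𝓘(ℝ, F)) 𝓘(ℝ, ℝ) ∞ (affFun a f) :=
  (contMDiff_linFun a).add (contMDiff_comp_proj f)

theorem isAffineFun_affFun (a : DualSection 𝓘(ℝ, E) F V) (f : C^∞⟮𝓘(ℝ, E), M; ℝ⟯) :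
    IsAffineFun 𝓘(ℝ, E) (affFun a f) :=
  ⟨contMDiff_affFun a f, fun x => ⟨(a x : V x →L[ℝ] ℝ).toLinearMap, f x, fun _ => rfl⟩⟩

/-- The base function has to be the restriction to the zero section; what remains is linear on
fibres. -/
theorem exists_affFun_eq {g : TotalSpace F V → ℝ} (hg : IsAffineFun 𝓘(ℝ, E) g) :
    ∃ (a : DualSection 𝓘(ℝ, E) F V) (f : C^∞⟮𝓘(ℝ, E), M; ℝ⟯), affFun a f = g := by
  have hz : ContMDiff 𝓘(ℝ, E) 𝓘(ℝ, ℝ) ∞ fun x => g ⟨x, 0⟩ :=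
    hg.1.comp (contMDiff_zeroSection ℝ V)
  let f : C^∞⟮𝓘(ℝ, E), M; ℝ⟯ := ⟨_, hz⟩
  have hl : IsLinearFun 𝓘(ℝ, E) fun u : TotalSpace F V => g u - f u.proj := by
    refine ⟨hg.1.sub (contMDiff_comp_proj f), fun x => ?_⟩
    obtain ⟨φ, c, h⟩ := hg.2 x
    refine ⟨φ, fun w => ?_⟩
    change g ⟨x, w⟩ - g ⟨x, 0⟩ = φ w
    rw [h, h, map_zero]
    ring
  obtain ⟨a, ha⟩ := exists_linFun_eq hl
  refine ⟨a, f, funext fun u => ?_⟩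
  rw [affFun, ha]
  ring

/-- A constant section of the dual bundle in the trivialization at `x₀`, cut off by `χ`. -/
def dualFrame (x₀ : M) (χ : C^∞⟮𝓘(ℝ, E), M; ℝ⟯)
    (hχ : tsupport χ ⊆ (trivializationAt F V x₀).baseSet) (c : F →L[ℝ] ℝ) :
    DualSection 𝓘(ℝ, E) F V :=
  ⟨fun x => (χ x • c).comp ((trivializationAt F V x₀).continuousLinearMapAt ℝ x),
    contMDiff_dualSection (by
      refine contMDiff_smul_of_tsupport (contMDiff_proj V) χ hχ
        (g := fun v : TotalSpace F V =>
          c ((trivializationAt F V x₀).continuousLinearMapAt ℝ v.proj v.snd)) fun v hv => ?_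
      refine c.contMDiff.contMDiffAt.comp v ?_
      have h1 := ((trivializationAt F V x₀).contMDiffOn (n := ∞) (IB := 𝓘(ℝ, E))).contMDiffAt
        ((trivializationAt F V x₀).open_source.mem_nhds
          ((trivializationAt F V x₀).mem_source.2 hv))
      refine h1.snd.congr_of_eventuallyEq ?_
      filter_upwards [(trivializationAt F V x₀).open_source.mem_nhds
          ((trivializationAt F V x₀).mem_source.2 hv)] with u hu
      rw [Trivialization.continuousLinearMapAt_apply, Trivialization.linearMapAt_apply,
        if_pos ((trivializationAt F V x₀).mem_source.1 hu)])⟩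

theorem dualFrame_apply {x₀ : M} {χ : C^∞⟮𝓘(ℝ, E), M; ℝ⟯}
    (hχ : tsupport χ ⊆ (trivializationAt F V x₀).baseSet) (c : F →L[ℝ] ℝ) (x : M) (w : V x) :
    dualFrame x₀ χ hχ c x w =
      χ x * c ((trivializationAt F V x₀).continuousLinearMapAt ℝ x w) := rfl

theorem dualFrame_apply_of_mem {x₀ : M} {χ : C^∞⟮𝓘(ℝ, E), M; ℝ⟯}
    (hχ : tsupport χ ⊆ (trivializationAt F V x₀).baseSet) (c : F →L[ℝ] ℝ) {x : M}
    (hx : x ∈ (trivializationAt F V x₀).baseSet) (w : V x) :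
    dualFrame x₀ χ hχ c x w = χ x * c (trivializationAt F V x₀ ⟨x, w⟩).2 := by
  rw [dualFrame_apply, Trivialization.continuousLinearMapAt_apply, Trivialization.linearMapAt_apply,
        if_pos hx]

theorem exists_dualSection_apply_eq (x : M) (c : DualFiber V x) :
    ∃ a : DualSection 𝓘(ℝ, E) F V, a x = c := by
  obtain ⟨χ, hχ, h1⟩ := exists_cutoff (E := E) x ((trivializationAt F V x).open_baseSet.mem_nhds
      (FiberBundle.mem_baseSet_trivializationAt' x))
  refine ⟨dualFrame x χ hχ
    (ContinuousLinearMap.comp (c : V x →L[ℝ] ℝ) ((trivializationAt F V x).symmL ℝ x)), ?_⟩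
  ext w
  rw [dualFrame_apply, h1.eq_of_nhds]
  have := (trivializationAt F V x).symmL_continuousLinearMapAt (R := ℝ)
      (FiberBundle.mem_baseSet_trivializationAt' x) w
  have h2 : (1 : ℝ) * (c : V x →L[ℝ] ℝ) ((trivializationAt F V x).symmL ℝ x
      ((trivializationAt F V x).continuousLinearMapAt ℝ x w)) = c w := by
    rw [this, one_mul]
  exact h2

theorem eq_of_forall_dual_apply_eq {x : M} {w w' : V x}
    (h : ∀ a : DualSection 𝓘(ℝ, E) F V, a x w = a x w') : w = w' := by
  have he := FiberBundle.mem_baseSet_trivializationAt' (F := F) (E := V) x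
  have h1 : (trivializationAt F V x).continuousLinearMapAt ℝ x w =
      (trivializationAt F V x).continuousLinearMapAt ℝ x w' := by
    refine (SeparatingDual.eq_iff_forall_dual_eq (R := ℝ)).2 fun g => ?_
    obtain ⟨a, ha⟩ := exists_dualSection_apply_eq (E := E) (F := F) x
      (g.comp ((trivializationAt F V x).continuousLinearMapAt ℝ x))
    have := h a
    rw [ha] at this
    exact this
  have h2 := congrArg ((trivializationAt F V x).symmL ℝ x) h1
  rwa [Trivialization.symmL_continuousLinearMapAt _ he,
    Trivialization.symmL_continuousLinearMapAt _ he] at h2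

/-- A section of `A` is smooth if all its pairings with sections of the dual are. -/
theorem contMDiff_section_of_pairing {X : ∀ x, V x}
    (h : ∀ a : DualSection 𝓘(ℝ, E) F V, ContMDiff 𝓘(ℝ, E) 𝓘(ℝ, ℝ) ∞ fun x => (a x (X x) : ℝ)) :
    ContMDiff 𝓘(ℝ, E) (𝓘(ℝ, E).prod 𝓘(ℝ, F)) ∞ fun x => TotalSpace.mk' F x (X x) := by
  intro x₀
  rw [contMDiffAt_section]
  have hb := (trivializationAt F V x₀).open_baseSet.mem_nhds
      (FiberBundle.mem_baseSet_trivializationAt' x₀)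
  obtain ⟨χ, hχ, h1⟩ := exists_cutoff (E := E) x₀ hb
  have b := Module.finBasis ℝ F
  have hs : ContMDiffAt 𝓘(ℝ, E) 𝓘(ℝ, F) ∞ (fun x => ∑ i,
      (dualFrame x₀ χ hχ (b.coord i).toContinuousLinearMap x (X x) : ℝ) • b i) x₀ :=
    contMDiffAt_finsetSum fun i _ => (h _ x₀).smul contMDiffAt_const
  refine hs.congr_of_eventuallyEq ?_
  filter_upwards [hb, h1] with x hx hx1
  simp only [dualFrame_apply_of_mem hχ _ hx, hx1]
  simp only [Pi.one_apply, one_mul]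
  exact (b.sum_repr _).symm

/-- Every section of the dual is, up to a cutoff, a finite combination of global sections. -/
theorem exists_decomposition (x₀ : M) (a : DualSection 𝓘(ℝ, E) F V) :
    ∃ (n : ℕ) (h : C^∞⟮𝓘(ℝ, E), M; ℝ⟯) (c : Fin n → C^∞⟮𝓘(ℝ, E), M; ℝ⟯)
      (s : Fin n → DualSection 𝓘(ℝ, E) F V),
      h x₀ = 1 ∧ smulSection h a = ∑ i, smulSection (c i) (s i) ∧
      (a x₀ = 0 → ∀ i, c i x₀ = 0) := by
  have hb := (trivializationAt F V x₀).open_baseSet.mem_nhds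
      (FiberBundle.mem_baseSet_trivializationAt' x₀)
  obtain ⟨χ, hχ, h1⟩ := exists_cutoff (E := E) x₀ hb
  have b := Module.finBasis ℝ F
  have hc : ∀ i, ContMDiff 𝓘(ℝ, E) 𝓘(ℝ, ℝ) ∞ fun x =>
      χ x • (a x ((trivializationAt F V x₀).symm x (b i)) : ℝ) := by
    intro i
    refine contMDiff_smul_of_tsupport contMDiff_id χ hχ fun x (hx : x ∈ _) => ?_
    have hs : ContMDiffAt 𝓘(ℝ, E) (𝓘(ℝ, E).prod 𝓘(ℝ, F)) ∞
        (fun x => TotalSpace.mk' F x ((trivializationAt F V x₀).symm x (b i))) x := by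
      rw [Trivialization.contMDiffAt_section_iff (e := trivializationAt F V x₀) hx]
      refine (contMDiffAt_const (c := b i)).congr_of_eventuallyEq ?_
      filter_upwards [(trivializationAt F V x₀).open_baseSet.mem_nhds hx] with y hy
      exact congrArg Prod.snd ((trivializationAt F V x₀).apply_mk_symm hy (b i))
    exact (contMDiff_linFun a _).comp x hs
  -- One factor `χ` globalizes the coefficients and the other the frame, hence the square in the
  -- multiplier.
  refine ⟨Module.finrank ℝ F, χ * χ, fun i => ⟨_, hc i⟩,
    fun i => dualFrame x₀ χ hχ (b.coord i).toContinuousLinearMap, ?_, ?_, ?_⟩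
  · simp [h1.eq_of_nhds]
  · ext x w
    rw [show (⇑(∑ i, smulSection (⟨_, hc i⟩ : C^∞⟮𝓘(ℝ, E), M; ℝ⟯)
      (dualFrame x₀ χ hχ (b.coord i).toContinuousLinearMap)) : ∀ x, DualFiber V x) = _ from
      map_sum (ContMDiffSection.coeAddHom _ _ _ _) _ _, Finset.sum_apply, sum_apply]
    by_cases hx : x ∈ (trivializationAt F V x₀).baseSet
    · have hw : w = ∑ i, b.coord i (trivializationAt F V x₀ ⟨x, w⟩).2 •
          (trivializationAt F V x₀).symm x (b i) := by
        have h2 := congrArg ((trivializationAt F V x₀).symmL ℝ x)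
          (b.sum_repr (trivializationAt F V x₀ ⟨x, w⟩).2)
        rw [map_sum, Trivialization.symmL_apply _ hx, Trivialization.symm_apply_apply_mk _ hx] at h2
        refine h2.symm.trans ?_
        refine Finset.sum_congr rfl fun i _ => ?_
        rw [map_smul, Trivialization.symmL_apply _ hx]
        rfl
      change χ x * χ x * a x w = ∑ i, (χ x * a x ((trivializationAt F V x₀).symm x (b i))) *
        dualFrame x₀ χ hχ (b.coord i).toContinuousLinearMap x w
      simp only [dualFrame_apply_of_mem hχ _ hx]
      conv_lhs => rw [hw, map_sum, Finset.mul_sum]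
      refine Finset.sum_congr rfl fun i _ => ?_
      rw [map_smul, smul_eq_mul]
      simp only [LinearMap.coe_toContinuousLinearMap']
      ring
    · have h0 : χ x = 0 := image_eq_zero_of_notMem_tsupport fun h => hx (hχ h)
      change χ x * χ x * a x w = ∑ i, (χ x * a x ((trivializationAt F V x₀).symm x (b i))) *
        dualFrame x₀ χ hχ (b.coord i).toContinuousLinearMap x w
      simp [h0]
  · intro h0 i
    change χ x₀ * a x₀ _ = 0
    rw [h0]
    simp

end Sections

/-! ### Action of vector fields on functions -/

section VectorFieldAct

variable {E₁ : Type*} [NormedAddCommGroup E₁] [NormedSpace ℝ E₁]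
  {H₁ : Type*} [TopologicalSpace H₁] {J : ModelWithCorners ℝ E₁ H₁}
  {N : Type*} [TopologicalSpace N] [ChartedSpace H₁ N] [J.Boundaryless] [IsManifold J ∞ N]

theorem contMDiff_mvfderiv_apply {Y : ∀ x : N, TangentSpace J x}
    (hY : ContMDiff J (J.prod 𝓘(ℝ, E₁)) ∞ fun x => TotalSpace.mk' E₁ x (Y x)) {f : N → ℝ}
    (hf : ContMDiff J 𝓘(ℝ, ℝ) ∞ f) : ContMDiff J 𝓘(ℝ, ℝ) ∞ fun x => mvfderiv J f x (Y x) := by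
  intro x₀
  have h1 := (contMDiffAt_coordDeriv hf x₀ (mem_chart_source H₁ x₀)).clm_apply
    ((contMDiffAt_section x₀).1 (hY x₀))
  refine h1.congr_of_eventuallyEq ?_
  filter_upwards [(chartAt H₁ x₀).open_source.mem_nhds (mem_chart_source H₁ x₀)] with x hx
  rw [tangent_trivializationAt_apply hx, mvfderiv_eq_coordDeriv hf x₀ hx]
  rfl

theorem VectorField.contMDiff_act (X : VectorField J N) {f : N → ℝ}
    (hf : ContMDiff J 𝓘(ℝ, ℝ) ∞ f) : ContMDiff J 𝓘(ℝ, ℝ) ∞ (X.act f) :=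
  contMDiff_mvfderiv_apply X.contMDiff hf

end VectorFieldAct

/-! ### Affine coordinates on the total space and differentials of affine functions -/

section AffineFunctions

variable {E : Type*} [NormedAddCommGroup E] [NormedSpace ℝ E] [FiniteDimensional ℝ E]
  {M : Type*} [TopologicalSpace M] [T2Space M] [ChartedSpace E M] [IsManifold 𝓘(ℝ, E) ∞ M]
  {F : Type*} [NormedAddCommGroup F] [NormedSpace ℝ F] [FiniteDimensional ℝ F]
  {V : M → Type*} [TopologicalSpace (TotalSpace F V)]
  [∀ x, AddCommGroup (V x)] [∀ x, Module ℝ (V x)] [∀ x, TopologicalSpace (V x)]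
  [∀ x, IsTopologicalAddGroup (V x)] [∀ x, ContinuousSMul ℝ (V x)]
  [FiberBundle F V] [VectorBundle ℝ F V] [ContMDiffVectorBundle ∞ F V 𝓘(ℝ, E)]

/-- Near every point of `A` there is a globally defined chart with fibrewise affine components. -/
theorem exists_affine_chart (v₀ : TotalSpace F V) : ∃ Ψ : TotalSpace F V → E × F,
    ContMDiff (𝓘(ℝ, E).prod 𝓘(ℝ, F)) 𝓘(ℝ, E × F) ∞ Ψ ∧
    Ψ =ᶠ[𝓝 v₀] extChartAt (𝓘(ℝ, E).prod 𝓘(ℝ, F)) v₀ ∧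
    ∀ c : E × F →L[ℝ] ℝ, ∃ (a : DualSection 𝓘(ℝ, E) F V) (f : C^∞⟮𝓘(ℝ, E), M; ℝ⟯),
      (fun u => c (Ψ u)) = affFun a f := by
  obtain ⟨ψ, hψ, hψe⟩ := exists_chart_extension (E := E) v₀.proj
  have hb := (trivializationAt F V v₀.proj).open_baseSet.mem_nhds
      (FiberBundle.mem_baseSet_trivializationAt' v₀.proj)
  obtain ⟨χ, hχ, h1⟩ := exists_cutoff (E := E) v₀.proj hb
  have hproj : Tendsto (fun u : TotalSpace F V => u.proj) (𝓝 v₀) (𝓝 v₀.proj) :=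
    (FiberBundle.continuous_proj F V).continuousAt
  -- The fibre coordinate is cut off by a function of the base point only, so it stays linear on
  -- fibres and its components come from `dualFrame`.
  set φ : TotalSpace F V → F := fun u =>
    χ u.proj • (trivializationAt F V v₀.proj).continuousLinearMapAt ℝ u.proj u.snd with hφ
  have hdual : ∀ c : F →L[ℝ] ℝ, (fun u => c (φ u)) = linFun (dualFrame v₀.proj χ hχ c) := by
    intro c
    funext u
    simp only [hφ, map_smul, smul_eq_mul]
    rfl
  have hφs : ContMDiff (𝓘(ℝ, E).prod 𝓘(ℝ, F)) 𝓘(ℝ, F) ∞ φ := by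
    have b := Module.finBasis ℝ F
    have : φ = fun u => ∑ i, (b.coord i).toContinuousLinearMap (φ u) • b i := by
      funext u
      exact (b.sum_repr _).symm
    rw [this]
    refine contMDiff_finsetSum fun i _ => ?_
    have hi : ContMDiff (𝓘(ℝ, E).prod 𝓘(ℝ, F)) 𝓘(ℝ, ℝ) ∞
        fun u => (b.coord i).toContinuousLinearMap (φ u) := by
      rw [hdual]
      exact contMDiff_linFun _
    exact hi.smul contMDiff_const
  refine ⟨fun u => (ψ u.proj, φ u), (hψ.comp (contMDiff_proj V)).prodMk_space hφs, ?_, ?_⟩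
  · filter_upwards [hproj hψe, hproj h1, hproj hb] with u hu hu1 hub
    rw [FiberBundle.extChartAt]
    refine Prod.ext ?_ ?_
    · refine Eq.trans hu ?_
      simp [(trivializationAt F V v₀.proj).coe_fst' hub]
    · simp only [hφ]
      rw [show χ u.proj = 1 from hu1, one_smul, Trivialization.continuousLinearMapAt_apply,
        Trivialization.linearMapAt_apply, if_pos (show u.proj ∈ _ from hub)]
      rfl
  -- The restriction of `c` to the factor `F` gives the linear part, its restriction to `E` the
  -- basic part.
  · intro c
    refine ⟨dualFrame v₀.proj χ hχ (c.comp (ContinuousLinearMap.inr ℝ E F)),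
      ⟨fun x => c (ψ x, 0), (c.comp (ContinuousLinearMap.inl ℝ E F)).contMDiff.comp hψ⟩, ?_⟩
    funext u
    refine Eq.trans ?_ (congrArg (· + c (ψ u.proj, 0)) (congrFun (hdual _) u))
    change c (ψ u.proj, φ u) = c (0, φ u) + c (ψ u.proj, 0)
    rw [← map_add]
    simp

theorem affFun_add (a b : DualSection 𝓘(ℝ, E) F V) (f g : C^∞⟮𝓘(ℝ, E), M; ℝ⟯) :
    affFun (a + b) (f + g) = fun u => affFun a f u + affFun b g u := by
  funext u
  change (a u.proj u.snd + b u.proj u.snd : ℝ) + (f u.proj + g u.proj) =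
    (a u.proj u.snd + f u.proj) + (b u.proj u.snd + g u.proj)
  ring

theorem affFun_smul (r : ℝ) (a : DualSection 𝓘(ℝ, E) F V) (f : C^∞⟮𝓘(ℝ, E), M; ℝ⟯) :
    affFun (r • a) (r • f) = fun u => r * affFun a f u := by
  funext u
  change (r * a u.proj u.snd : ℝ) + (r * f u.proj) = r * (a u.proj u.snd + f u.proj)
  ring

/-- The differential at `v` of the affine function given by a pair `(a, f)`. -/
def dAff (v : TotalSpace F V) : DualSection 𝓘(ℝ, E) F V × C^∞⟮𝓘(ℝ, E), M; ℝ⟯ →ₗ[ℝ]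
    Cotangent (𝓘(ℝ, E).prod 𝓘(ℝ, F)) v where
  toFun p := mvfderiv (𝓘(ℝ, E).prod 𝓘(ℝ, F)) (affFun p.1 p.2) v
  map_add' p q := by
    rw [Prod.fst_add, Prod.snd_add, affFun_add, mvfderiv_fun_add
      (contMDiff_real_mdiff (contMDiff_affFun _ _) v)
      (contMDiff_real_mdiff (contMDiff_affFun _ _) v)]
  map_smul' r p := by
    rw [Prod.smul_fst, Prod.smul_snd, affFun_smul, mvfderiv_fun_mul mdifferentiableAt_const
      (contMDiff_real_mdiff (contMDiff_affFun _ _) v), mvfderiv_const]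
    simp

/-- A covector at `v` is a functional `α` on the model space, and `α ∘ Ψ` for an affine chart `Ψ`
has it as differential. Tensor identities on the total space can therefore be tested on affine
functions. -/
theorem dAff_surjective (v : TotalSpace F V) :
    Function.Surjective (dAff (E := E) v) := by
  intro α
  obtain ⟨Ψ, hΨ, hΨe, hc⟩ := exists_affine_chart (E := E) v
  obtain ⟨a, f, h⟩ := hc α
  refine ⟨(a, f), ?_⟩
  have h1 := mvfderiv_clm_comp (J := 𝓘(ℝ, E).prod 𝓘(ℝ, F)) (α : E × F →L[ℝ] ℝ)
    ((hΨ v).mdifferentiableAt (by simp))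
  rw [h, mvfderiv_congr hΨe] at h1
  refine h1.trans ?_
  ext w
  exact congrArg α (mvfderiv_extChartAt_self_apply v w)

theorem contMDiff_fiberLine (v : TotalSpace F V) (w : V v.proj) :
    ContMDiff 𝓘(ℝ, ℝ) (𝓘(ℝ, E).prod 𝓘(ℝ, F)) ∞
      fun t : ℝ => (⟨v.proj, v.snd + t • w⟩ : TotalSpace F V) := by
  intro t
  rw [contMDiffAt_totalSpace]
  refine ⟨contMDiffAt_const, ?_⟩
  have hb := FiberBundle.mem_baseSet_trivializationAt' (F := F) (E := V) v.proj
  have : (fun t : ℝ => (trivializationAt F V v.proj ⟨v.proj, v.snd + t • w⟩).2) = fun t =>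
      (trivializationAt F V v.proj).continuousLinearMapAt ℝ v.proj v.snd +
      t • (trivializationAt F V v.proj).continuousLinearMapAt ℝ v.proj w := by
    funext t
    rw [← map_smul, ← map_add, Trivialization.continuousLinearMapAt_apply,
      Trivialization.linearMapAt_apply, if_pos hb]
  simp only [this]
  exact contMDiffAt_const.add (contMDiffAt_id.smul contMDiffAt_const)

theorem mvfderiv_verticalLift {g : TotalSpace F V → ℝ} {v : TotalSpace F V}
    (hg : MDifferentiableAt (𝓘(ℝ, E).prod 𝓘(ℝ, F)) 𝓘(ℝ, ℝ) g v) (w : V v.proj) :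
    mvfderiv (𝓘(ℝ, E).prod 𝓘(ℝ, F)) g v (verticalLift 𝓘(ℝ, E) F v w) =
      deriv (fun t : ℝ => g ⟨v.proj, v.snd + t • w⟩) 0 := by
  have h0 : (⟨v.proj, v.snd + (0 : ℝ) • w⟩ : TotalSpace F V) = v := by simp
  have h := mvfderiv_comp_apply_of_eq (I := 𝓘(ℝ, E).prod 𝓘(ℝ, F)) (I' := 𝓘(ℝ, ℝ)) (0 : ℝ) hg
    ((contMDiff_fiberLine (E := E) v w 0).mdifferentiableAt (by simp)) h0 (1 : ℝ)
  refine h.symm.trans ?_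
  rw [mvfderiv, mfderiv_eq_fderiv]
  rfl

theorem mvfderiv_affFun_verticalLift (a : DualSection 𝓘(ℝ, E) F V) (f : C^∞⟮𝓘(ℝ, E), M; ℝ⟯)
    (v : TotalSpace F V) (w : V v.proj) :
    mvfderiv (𝓘(ℝ, E).prod 𝓘(ℝ, F)) (affFun a f) v (verticalLift 𝓘(ℝ, E) F v w) = a v.proj w := by
  rw [mvfderiv_verticalLift (contMDiff_real_mdiff (contMDiff_affFun a f) v)]
  have : (fun t : ℝ => affFun a f ⟨v.proj, v.snd + t • w⟩) = fun t =>
      (a v.proj v.snd + t * a v.proj w) + f v.proj := by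
    funext t
    change (a v.proj (v.snd + t • w) : ℝ) + f v.proj = _
    rw [map_add, map_smul]
    rfl
  rw [this]
  have h1 : HasDerivAt (fun t : ℝ => (a v.proj v.snd + t * a v.proj w : ℝ) + f v.proj)
      (1 * a v.proj w : ℝ) 0 :=
    (((hasDerivAt_id (0 : ℝ)).mul_const (a v.proj w : ℝ)).const_add (a v.proj v.snd : ℝ)).add_const
      (f v.proj)
  rw [h1.deriv, one_mul]

/-- Pairing the differential with vertical lifts returns the values of the section. -/
theorem apply_eq_zero_of_dAff_eq_zero {v : TotalSpace F V}
    {p : DualSection 𝓘(ℝ, E) F V × C^∞⟮𝓘(ℝ, E), M; ℝ⟯} (h : dAff v p = 0) :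
    p.1 v.proj = 0 := by
  ext w
  have h1 := mvfderiv_affFun_verticalLift p.1 p.2 v w
  rw [show mvfderiv (𝓘(ℝ, E).prod 𝓘(ℝ, F)) (affFun p.1 p.2) v = 0 from h] at h1
  exact h1.symm

theorem mvfderiv_eq_zero_of_comp_proj {f : C^∞⟮𝓘(ℝ, E), M; ℝ⟯} {v : TotalSpace F V}
    (h : mvfderiv (𝓘(ℝ, E).prod 𝓘(ℝ, F)) (fun u : TotalSpace F V => f u.proj) v = 0) :
    mvfderiv 𝓘(ℝ, E) f v.proj = 0 := by
  set e := trivializationAt F V v.proj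
  have hb : v.proj ∈ e.baseSet := FiberBundle.mem_baseSet_trivializationAt' (F := F) (E := V) v.proj
  -- A local section through `v`, constant in the trivialization; composing with it undoes the
  -- projection.
  set s : M → TotalSpace F V := fun y => ⟨y, e.symm y (e v).2⟩ with hs
  have hs0 : s v.proj = v := by
    simp only [hs]
    rw [e.symm_apply_apply_mk hb v.snd]
  have hsm : ContMDiffAt 𝓘(ℝ, E) (𝓘(ℝ, E).prod 𝓘(ℝ, F)) ∞ s v.proj := by
    rw [contMDiffAt_section]
    refine (contMDiffAt_const (c := (e v).2)).congr_of_eventuallyEq ?_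
    filter_upwards [e.open_baseSet.mem_nhds hb] with x hx
    have := congrArg Prod.snd (e.apply_mk_symm hx (e v).2)
    exact this
  ext w
  have h1 := mvfderiv_comp_apply_of_eq (I := 𝓘(ℝ, E).prod 𝓘(ℝ, F)) (I' := 𝓘(ℝ, E)) (f := s) v.proj
    (contMDiff_real_mdiff (contMDiff_comp_proj f) v) (hsm.mdifferentiableAt (by simp)) hs0 w
  rw [h] at h1
  exact h1

end AffineFunctions

/-! ### Bivector fields from their values on affine functions -/

section AffineBivector

variable {E : Type*} [NormedAddCommGroup E] [NormedSpace ℝ E] [FiniteDimensional ℝ E]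
  {M : Type*} [TopologicalSpace M] [T2Space M] [ChartedSpace E M] [IsManifold 𝓘(ℝ, E) ∞ M]
  {F : Type*} [NormedAddCommGroup F] [NormedSpace ℝ F] [FiniteDimensional ℝ F]
  {V : M → Type*} [TopologicalSpace (TotalSpace F V)]
  [∀ x, AddCommGroup (V x)] [∀ x, Module ℝ (V x)] [∀ x, TopologicalSpace (V x)]
  [∀ x, IsTopologicalAddGroup (V x)] [∀ x, ContinuousSMul ℝ (V x)]
  [FiberBundle F V] [VectorBundle ℝ F V] [ContMDiffVectorBundle ∞ F V 𝓘(ℝ, E)]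

/-- A family of alternating bilinear forms on affine functions which at each point depends only on
differentials comes from a bivector field. -/
theorem exists_bivector_of_affine
    (Ω : ∀ _ : TotalSpace F V, (DualSection 𝓘(ℝ, E) F V × C^∞⟮𝓘(ℝ, E), M; ℝ⟯) →ₗ[ℝ]
      (DualSection 𝓘(ℝ, E) F V × C^∞⟮𝓘(ℝ, E), M; ℝ⟯) →ₗ[ℝ] ℝ)
    (hΩ : ∀ v p, Ω v p p = 0)
    (hker : ∀ v p q, dAff v q = 0 → Ω v p q = 0)
    (hsm : ∀ p q, ContMDiff (𝓘(ℝ, E).prod 𝓘(ℝ, F)) 𝓘(ℝ, ℝ) ∞ fun v => Ω v p q) :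
    ∃ B : BivectorField (𝓘(ℝ, E).prod 𝓘(ℝ, F)) (TotalSpace F V),
      ∀ v p q, B.form v (dAff v p) (dAff v q) = Ω v p q := by
  -- Linear right inverses are chosen point by point, with no smoothness in `v`: by `hker` the
  -- resulting form does not depend on them.
  have hinv : ∀ v : TotalSpace F V, ∃ s, (dAff (E := E) v).comp s = LinearMap.id := fun v =>
    (dAff v).exists_rightInverse_of_surjective (LinearMap.range_eq_top.2 (dAff_surjective v))
  choose s hs using hinv
  have hs' : ∀ v α, dAff v (s v α) = α := fun v α => LinearMap.congr_fun (hs v) α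
  have hskew : ∀ v p q, Ω v p q = -Ω v q p := fun v p q => by
    have := hΩ v (p + q)
    simp only [map_add, LinearMap.add_apply, hΩ] at this
    linarith
  have hform : ∀ v p q, Ω v (s v (dAff v p)) (s v (dAff v q)) = Ω v p q := fun v p q => by
    have h1 : ∀ r, Ω v r (s v (dAff v q)) = Ω v r q := fun r => by
      have := hker v r (s v (dAff v q) - q) (by rw [map_sub, hs', sub_self])
      rw [map_sub] at this
      linarith
    have h2 : Ω v q (s v (dAff v p)) = Ω v q p := by
      have := hker v q (s v (dAff v p) - p) (by rw [map_sub, hs', sub_self])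
      rw [map_sub] at this
      linarith
    rw [h1, hskew, h2, ← hskew]
  refine ⟨⟨fun v => (Ω v).compl₁₂ (s v) (s v), fun v α => hΩ v _, ?_⟩, hform⟩
  intro f g hf hg v₀
  obtain ⟨Ψ, hΨ, hΨe, hc⟩ := exists_affine_chart (E := E) v₀
  have b := Module.finBasis ℝ (E × F)
  choose a c hac using fun i => hc (b.coord i).toContinuousLinearMap
  have hd : ∀ i u, mvfderiv (𝓘(ℝ, E).prod 𝓘(ℝ, F))
      (fun u => (b.coord i).toContinuousLinearMap (Ψ u)) u = dAff u (a i, c i) := fun i u => by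
    rw [hac]; rfl
  have hcd : ∀ h : TotalSpace F V → ℝ, ContMDiff (𝓘(ℝ, E).prod 𝓘(ℝ, F)) 𝓘(ℝ, ℝ) ∞ h →
      ∀ i, ContMDiffAt (𝓘(ℝ, E).prod 𝓘(ℝ, F)) 𝓘(ℝ, ℝ) ∞
        (fun u => coordDeriv (𝓘(ℝ, E).prod 𝓘(ℝ, F)) v₀ h u (b i)) v₀ := fun h hh i =>
    (contMDiffAt_coordDeriv hh v₀ (mem_chart_source _ v₀)).clm_apply contMDiffAt_const
  -- In an affine chart the components of the bivector are values of `Ω` on fixed pairs, which are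
  -- smooth by `hsm`.
  have hs2 : ContMDiffAt (𝓘(ℝ, E).prod 𝓘(ℝ, F)) 𝓘(ℝ, ℝ) ∞ (fun u => ∑ i, ∑ j,
      coordDeriv (𝓘(ℝ, E).prod 𝓘(ℝ, F)) v₀ f u (b i) *
      (coordDeriv (𝓘(ℝ, E).prod 𝓘(ℝ, F)) v₀ g u (b j) * Ω u (a i, c i) (a j, c j))) v₀ :=
    contMDiffAt_finsetSum fun i _ => contMDiffAt_finsetSum fun j _ =>
      (hcd f hf i).mul ((hcd g hg j).mul (hsm _ _ v₀))
  refine hs2.congr_of_eventuallyEq ?_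
  filter_upwards [mvfderiv_eq_sum_coord b hf hΨ hΨe, mvfderiv_eq_sum_coord b hg hΨ hΨe] with u h1 h2
  rw [h1, h2]
  simp only [hd, map_sum, map_smul, LinearMap.sum_apply, LinearMap.smul_apply, smul_eq_mul,
    LinearMap.compl₁₂_apply, hform]
  rw [Finset.sum_comm]
  simp only [Finset.mul_sum]
  refine Finset.sum_congr rfl fun i _ => Finset.sum_congr rfl fun j _ => ?_
  ring

theorem BivectorField.ext_of_affine {B C : BivectorField (𝓘(ℝ, E).prod 𝓘(ℝ, F)) (TotalSpace F V)}
    (h : ∀ (p q : DualSection 𝓘(ℝ, E) F V × C^∞⟮𝓘(ℝ, E), M; ℝ⟯) v,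
      B.form v (dAff v p) (dAff v q) = C.form v (dAff v p) (dAff v q)) : B = C := by
  ext v α β
  obtain ⟨p, rfl⟩ := dAff_surjective (E := E) v α
  obtain ⟨q, rfl⟩ := dAff_surjective (E := E) v β
  exact h p q v

end AffineBivector

/-! ### Rules for anchors, brackets and skew bilinear maps -/

section AlgebroidCalculus

variable {E : Type*} [NormedAddCommGroup E] [NormedSpace ℝ E] [FiniteDimensional ℝ E]
  {M : Type*} [TopologicalSpace M] [T2Space M] [ChartedSpace E M] [IsManifold 𝓘(ℝ, E) ∞ M]
  {F : Type*} [NormedAddCommGroup F] [NormedSpace ℝ F] [FiniteDimensional ℝ F]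
  {V : M → Type*} [TopologicalSpace (TotalSpace F V)]
  [∀ x, AddCommGroup (V x)] [∀ x, Module ℝ (V x)] [∀ x, TopologicalSpace (V x)]
  [∀ x, IsTopologicalAddGroup (V x)] [∀ x, ContinuousSMul ℝ (V x)]
  [FiberBundle F V] [VectorBundle ℝ F V] [ContMDiffVectorBundle ∞ F V 𝓘(ℝ, E)]

namespace LieAlgebroid

variable (L : LieAlgebroid 𝓘(ℝ, E) (F →L[ℝ] ℝ) (DualFiber V))

theorem contMDiff_rho (a : DualSection 𝓘(ℝ, E) F V) {f : M → ℝ}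
    (hf : ContMDiff 𝓘(ℝ, E) 𝓘(ℝ, ℝ) ∞ f) : ContMDiff 𝓘(ℝ, E) 𝓘(ℝ, ℝ) ∞ (L.rho a f) :=
  contMDiff_mvfderiv_apply
    (ContMDiff.clm_bundle_apply (IM := 𝓘(ℝ, E)) (F₁ := F →L[ℝ] ℝ) (F₂ := E) (b := id)
      (E₁ := DualFiber V) (E₂ := fun x : M => TangentSpace 𝓘(ℝ, E) x)
      (ϕ := L.anchor) (v := a) L.anchor.contMDiff a.contMDiff) hf

theorem rho_add_fun (a : DualSection 𝓘(ℝ, E) F V) {f g : M → ℝ}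
    (hf : ContMDiff 𝓘(ℝ, E) 𝓘(ℝ, ℝ) ∞ f) (hg : ContMDiff 𝓘(ℝ, E) 𝓘(ℝ, ℝ) ∞ g) (x : M) :
    L.rho a (fun y => f y + g y) x = L.rho a f x + L.rho a g x := by
  simp only [rho]
  rw [mvfderiv_fun_add (contMDiff_real_mdiff hf x) (contMDiff_real_mdiff hg x)]
  rfl

theorem rho_neg_fun (a : DualSection 𝓘(ℝ, E) F V) (f : M → ℝ) (x : M) :
    L.rho a (fun y => -f y) x = -L.rho a f x := by
  simp only [rho]
  rw [mvfderiv_fun_neg]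
  rfl

theorem rho_mul_fun (a : DualSection 𝓘(ℝ, E) F V) {f g : M → ℝ}
    (hf : ContMDiff 𝓘(ℝ, E) 𝓘(ℝ, ℝ) ∞ f) (hg : ContMDiff 𝓘(ℝ, E) 𝓘(ℝ, ℝ) ∞ g) (x : M) :
    L.rho a (fun y => f y * g y) x = f x * L.rho a g x + g x * L.rho a f x := by
  simp only [rho]
  rw [mvfderiv_fun_mul (contMDiff_real_mdiff hf x) (contMDiff_real_mdiff hg x)]
  rfl

theorem rho_const (a : DualSection 𝓘(ℝ, E) F V) (c : ℝ) (x : M) :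
    L.rho a (fun _ => c) x = 0 := by
  simp only [rho]
  rw [mvfderiv_const]
  rfl

theorem rho_add_section (a b : DualSection 𝓘(ℝ, E) F V) (f : M → ℝ) (x : M) :
    L.rho (a + b) f x = L.rho a f x + L.rho b f x := by
  simp only [rho]
  rw [ContMDiffSection.coe_add, Pi.add_apply, map_add, map_add]

theorem rho_smul_section (r : ℝ) (a : DualSection 𝓘(ℝ, E) F V) (f : M → ℝ) (x : M) :
    L.rho (r • a) f x = r * L.rho a f x := by
  simp only [rho]
  rw [ContMDiffSection.coe_smul, Pi.smul_apply, map_smul, map_smul]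
  rfl

theorem rho_smulSection (h : C^∞⟮𝓘(ℝ, E), M; ℝ⟯) (a : DualSection 𝓘(ℝ, E) F V) (f : M → ℝ) (x : M) :
    L.rho (smulSection h a) f x = h x * L.rho a f x := by
  simp only [rho]
  rw [show smulSection h a x = h x • a x from rfl, map_smul, map_smul]
  rfl

theorem rho_eq_zero {a : DualSection 𝓘(ℝ, E) F V} {x : M} (h : a x = 0) (f : M → ℝ) :
    L.rho a f x = 0 := by
  simp only [rho]
  rw [h, map_zero, map_zero]

theorem bracket_sum {ι : Type*} (s : Finset ι) (a : DualSection 𝓘(ℝ, E) F V)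
    (b : ι → DualSection 𝓘(ℝ, E) F V) :
    L.bracket a (∑ i ∈ s, b i) = ∑ i ∈ s, L.bracket a (b i) :=
  map_sum (AddMonoidHom.mk' (L.bracket a) (L.bracket_add a)) _ _

end LieAlgebroid

theorem sum_section_apply {ι : Type*} (s : Finset ι) (b : ι → DualSection 𝓘(ℝ, E) F V) (x : M)
    (w : V x) : ((∑ i ∈ s, b i) x w : ℝ) = ∑ i ∈ s, (b i x w : ℝ) := by
  have h : (⇑(∑ i ∈ s, b i) : ∀ x, DualFiber V x) = ∑ i ∈ s, ⇑(b i) :=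
    map_sum (ContMDiffSection.coeAddHom _ _ _ _) _ _
  rw [h, Finset.sum_apply, sum_apply]

namespace SkewBilinear

variable (P : SkewBilinear 𝓘(ℝ, E) (F →L[ℝ] ℝ) (DualFiber V))

theorem map_sum {ι : Type*} (s : Finset ι) (a : DualSection 𝓘(ℝ, E) F V)
    (b : ι → DualSection 𝓘(ℝ, E) F V) :
    P.toFun a (∑ i ∈ s, b i) = ∑ i ∈ s, P.toFun a (b i) :=
  _root_.map_sum (AddMonoidHom.mk' (P.toFun a) (P.map_add a)) _ _

theorem map_const_smul (r : ℝ) (a b : DualSection 𝓘(ℝ, E) F V) (x : M) :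
    P.toFun a (r • b) x = r * P.toFun a b x := by
  have h := P.map_smul a (ContMDiffMap.const r) b
  have h1 : smulSection (ContMDiffMap.const r : C^∞⟮𝓘(ℝ, E), M; ℝ⟯) b = r • b := by
    ext y; rfl
  rw [h1] at h
  rw [h]
  rfl

/-- Function-linearity gives dependence on point values: some `k • b` with k(x) = 1 is a combination
of global sections whose coefficients vanish at `x`. -/
theorem apply_eq_zero {b : DualSection 𝓘(ℝ, E) F V} {x : M} (h : b x = 0)
    (a : DualSection 𝓘(ℝ, E) F V) : P.toFun a b x = 0 := by
  obtain ⟨n, k, c, s, hk, hdec, hc⟩ := exists_decomposition x b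
  have h1 : P.toFun a (smulSection k b) x = ∑ i, P.toFun a (smulSection (c i) (s i)) x := by
    rw [hdec, P.map_sum, show (⇑(∑ i, P.toFun a (smulSection (c i) (s i))) : M → ℝ) = _ from
      _root_.map_sum (ContMDiffMap.coeFnAddMonoidHom) _ _, Finset.sum_apply]
    rfl
  simp only [P.map_smul] at h1
  simpa [hk, hc h] using h1

end SkewBilinear

end AlgebroidCalculus

/-! ### The bivector field and vector field attached to algebroid data -/

section TwistedBivector

variable {E : Type*} [NormedAddCommGroup E] [NormedSpace ℝ E] [FiniteDimensional ℝ E]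
  {M : Type*} [TopologicalSpace M] [T2Space M] [ChartedSpace E M] [IsManifold 𝓘(ℝ, E) ∞ M]
  {F : Type*} [NormedAddCommGroup F] [NormedSpace ℝ F] [FiniteDimensional ℝ F]
  {V : M → Type*} [TopologicalSpace (TotalSpace F V)]
  [∀ x, AddCommGroup (V x)] [∀ x, Module ℝ (V x)] [∀ x, TopologicalSpace (V x)]
  [∀ x, IsTopologicalAddGroup (V x)] [∀ x, ContinuousSMul ℝ (V x)]
  [FiberBundle F V] [VectorBundle ℝ F V] [ContMDiffVectorBundle ∞ F V 𝓘(ℝ, E)]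

theorem contMDiff_pairing (X : Cₛ^∞⟮𝓘(ℝ, E); F, V⟯) (a : DualSection 𝓘(ℝ, E) F V) :
    ContMDiff 𝓘(ℝ, E) 𝓘(ℝ, ℝ) ∞ (pairing X a) :=
  (contMDiff_linFun a).comp X.contMDiff

/-- The bilinear form on affine functions defined by a Lie algebroid, a skew bilinear map and a
section. -/
def affForm (L : LieAlgebroid 𝓘(ℝ, E) (F →L[ℝ] ℝ) (DualFiber V))
    (P : SkewBilinear 𝓘(ℝ, E) (F →L[ℝ] ℝ) (DualFiber V)) (X : Cₛ^∞⟮𝓘(ℝ, E); F, V⟯)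
    (p q : DualSection 𝓘(ℝ, E) F V × C^∞⟮𝓘(ℝ, E), M; ℝ⟯) (v : TotalSpace F V) : ℝ :=
  linFun (L.bracket p.1 q.1) v - P.toFun p.1 q.1 v.proj
    + (linFun p.1 v * pairing X q.1 v.proj - linFun q.1 v * pairing X p.1 v.proj)
    + (L.rho p.1 q.2 v.proj - L.rho q.1 p.2 v.proj)

section

variable (L : LieAlgebroid 𝓘(ℝ, E) (F →L[ℝ] ℝ) (DualFiber V))
    (P : SkewBilinear 𝓘(ℝ, E) (F →L[ℝ] ℝ) (DualFiber V)) (X : Cₛ^∞⟮𝓘(ℝ, E); F, V⟯)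

theorem affForm_skew (p q : DualSection 𝓘(ℝ, E) F V × C^∞⟮𝓘(ℝ, E), M; ℝ⟯) (v : TotalSpace F V) :
    affForm L P X p q v = -affForm L P X q p v := by
  have h1 : linFun (L.bracket p.1 q.1) v = -linFun (L.bracket q.1 p.1) v := by
    rw [L.bracket_skew]; rfl
  have h2 : P.toFun p.1 q.1 v.proj = -P.toFun q.1 p.1 v.proj := by
    rw [P.skew]; rfl
  simp only [affForm, h1, h2]
  ring

theorem affForm_add (p q r : DualSection 𝓘(ℝ, E) F V × C^∞⟮𝓘(ℝ, E), M; ℝ⟯)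
    (v : TotalSpace F V) :
    affForm L P X p (q + r) v = affForm L P X p q v + affForm L P X p r v := by
  have h1 : linFun (L.bracket p.1 (q.1 + r.1)) v =
      linFun (L.bracket p.1 q.1) v + linFun (L.bracket p.1 r.1) v := by
    rw [L.bracket_add]; rfl
  have h2 : P.toFun p.1 (q.1 + r.1) v.proj =
      P.toFun p.1 q.1 v.proj + P.toFun p.1 r.1 v.proj := by
    rw [P.map_add]; rfl
  have h3 : pairing X (q.1 + r.1) v.proj = pairing X q.1 v.proj + pairing X r.1 v.proj := rfl
  have h4 : linFun (q.1 + r.1) v = linFun q.1 v + linFun r.1 v := rfl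
  have h5 : L.rho p.1 (q.2 + r.2 : C^∞⟮𝓘(ℝ, E), M; ℝ⟯) v.proj = _ :=
    L.rho_add_fun p.1 q.2.contMDiff r.2.contMDiff v.proj
  simp only [affForm, Prod.fst_add, Prod.snd_add, h1, h2, h3, h4, h5, L.rho_add_section]
  ring

theorem affForm_smul (c : ℝ) (p q : DualSection 𝓘(ℝ, E) F V × C^∞⟮𝓘(ℝ, E), M; ℝ⟯)
    (v : TotalSpace F V) :
    affForm L P X p (c • q) v = c * affForm L P X p q v := by
  have h1 : linFun (L.bracket p.1 (c • q.1)) v = c * linFun (L.bracket p.1 q.1) v := by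
    rw [L.bracket_smul]; rfl
  have h2 : P.toFun p.1 (c • q.1) v.proj = c * P.toFun p.1 q.1 v.proj := P.map_const_smul _ _ _ _
  have h3 : pairing X (c • q.1) v.proj = c * pairing X q.1 v.proj := rfl
  have h4 : linFun (c • q.1) v = c * linFun q.1 v := rfl
  have h5 : L.rho p.1 (c • q.2 : C^∞⟮𝓘(ℝ, E), M; ℝ⟯) v.proj = _ :=
    L.rho_mul_fun p.1 (f := fun _ => c) contMDiff_const q.2.contMDiff v.proj
  rw [L.rho_const] at h5
  simp only [affForm, Prod.smul_fst, Prod.smul_snd, h1, h2, h3, h4, h5, L.rho_smul_section]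
  ring

theorem contMDiff_affForm (p q : DualSection 𝓘(ℝ, E) F V × C^∞⟮𝓘(ℝ, E), M; ℝ⟯) :
    ContMDiff (𝓘(ℝ, E).prod 𝓘(ℝ, F)) 𝓘(ℝ, ℝ) ∞ (affForm L P X p q) := by
  have hp : ∀ {f : M → ℝ}, ContMDiff 𝓘(ℝ, E) 𝓘(ℝ, ℝ) ∞ f →
      ContMDiff (𝓘(ℝ, E).prod 𝓘(ℝ, F)) 𝓘(ℝ, ℝ) ∞ fun v : TotalSpace F V => f v.proj :=
    fun hf => hf.comp (contMDiff_proj V)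
  exact (((contMDiff_linFun _).sub (hp (P.toFun _ _).contMDiff)).add
    (((contMDiff_linFun _).mul (hp (contMDiff_pairing X _))).sub
      ((contMDiff_linFun _).mul (hp (contMDiff_pairing X _))))).add
    ((hp (L.contMDiff_rho _ q.2.contMDiff)).sub (hp (L.contMDiff_rho _ p.2.contMDiff)))

theorem rho_sum_const_mul (b : DualSection 𝓘(ℝ, E) F V) {n : ℕ}
    (c : Fin n → C^∞⟮𝓘(ℝ, E), M; ℝ⟯) (r : Fin n → ℝ) (x : M) (s : Finset (Fin n)) :
    L.rho b (∑ i ∈ s, r i • c i : C^∞⟮𝓘(ℝ, E), M; ℝ⟯) x = ∑ i ∈ s, r i * L.rho b (c i) x := by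
  classical
  induction s using Finset.induction_on with
  | empty =>
    rw [Finset.sum_empty, Finset.sum_empty]
    exact L.rho_const b 0 x
  | insert i s hi ih =>
    rw [Finset.sum_insert hi, Finset.sum_insert hi, ← ih]
    have h5 : L.rho b (r i • c i : C^∞⟮𝓘(ℝ, E), M; ℝ⟯) x = _ :=
      L.rho_mul_fun b (f := fun _ => r i) contMDiff_const (c i).contMDiff x
    rw [L.rho_const, mul_zero, add_zero] at h5
    rw [← h5]
    exact L.rho_add_fun b (r i • c i : C^∞⟮𝓘(ℝ, E), M; ℝ⟯).contMDiff
      (∑ i ∈ s, r i • c i : C^∞⟮𝓘(ℝ, E), M; ℝ⟯).contMDiff x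

theorem mvfderiv_sum_const_smul_proj {n : ℕ}
    (c : Fin n → C^∞⟮𝓘(ℝ, E), M; ℝ⟯) (r : Fin n → ℝ) (v : TotalSpace F V) (s : Finset (Fin n)) :
    mvfderiv (𝓘(ℝ, E).prod 𝓘(ℝ, F)) (fun u : TotalSpace F V =>
      (∑ i ∈ s, r i • c i : C^∞⟮𝓘(ℝ, E), M; ℝ⟯) u.proj) v =
    ∑ i ∈ s, r i • mvfderiv (𝓘(ℝ, E).prod 𝓘(ℝ, F)) (fun u : TotalSpace F V => c i u.proj) v := by
  have h : ∀ f : C^∞⟮𝓘(ℝ, E), M; ℝ⟯, mvfderiv (𝓘(ℝ, E).prod 𝓘(ℝ, F))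
      (fun u : TotalSpace F V => f u.proj) v = dAff v ((0 : DualSection 𝓘(ℝ, E) F V), f) := by
    intro f
    change _ = mvfderiv _ _ _
    congr 1
    funext u
    exact (zero_add _).symm
  simp only [h, ← map_smul, ← map_sum]
  congr 1
  ext1
  · rw [Prod.fst_sum]
    refine (Finset.sum_eq_zero fun i _ => ?_).symm
    ext x w
    exact mul_zero (r i)
  · simp [Prod.snd_sum]

/-- A section of the dual vanishing at a point acts there through its linearization. -/
theorem exists_linearization {a : DualSection 𝓘(ℝ, E) F V} {v : TotalSpace F V}
    (ha : a v.proj = 0) : ∃ G : C^∞⟮𝓘(ℝ, E), M; ℝ⟯,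
      mvfderiv (𝓘(ℝ, E).prod 𝓘(ℝ, F)) (linFun a) v =
        mvfderiv (𝓘(ℝ, E).prod 𝓘(ℝ, F)) (fun u : TotalSpace F V => G u.proj) v ∧
      ∀ (L : LieAlgebroid 𝓘(ℝ, E) (F →L[ℝ] ℝ) (DualFiber V)) (b : DualSection 𝓘(ℝ, E) F V),
        linFun (L.bracket b a) v = L.rho b G v.proj := by
  obtain ⟨n, k, c, s, hk, hdec, hc⟩ := exists_decomposition v.proj a
  -- With k·a = Σ cᵢsᵢ and all cᵢ zero at the base point, the product rule gives dι_a = Σ ι_{sᵢ}(v)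
  -- dcᵢ at `v`, and the Leibniz rule gives ⟦b, a⟧ = Σ ρ(b)(cᵢ) sᵢ there. Both see only this
  -- combination of the cᵢ.
  refine ⟨∑ i, (linFun (s i) v) • c i, ?_, fun L b => ?_⟩
  · have h1 : mvfderiv (𝓘(ℝ, E).prod 𝓘(ℝ, F)) (fun u : TotalSpace F V => k u.proj * linFun a u) v =
        mvfderiv (𝓘(ℝ, E).prod 𝓘(ℝ, F)) (linFun a) v := by
      rw [mvfderiv_fun_mul (contMDiff_real_mdiff (contMDiff_comp_proj k) v)
        (contMDiff_real_mdiff (contMDiff_linFun a) v), hk]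
      have : linFun a v = 0 := by
        change a v.proj v.snd = (0 : ℝ)
        rw [ha]; rfl
      rw [this]
      simp
    have h2 : (fun u : TotalSpace F V => k u.proj * linFun a u) = fun u =>
        linFun (∑ i, smulSection (c i) (s i)) u := by
      rw [← hdec]; rfl
    have h3 : ∀ t : Finset (Fin n), mvfderiv (𝓘(ℝ, E).prod 𝓘(ℝ, F))
        (linFun (∑ i ∈ t, smulSection (c i) (s i))) v = ∑ i ∈ t, (linFun (s i) v) •
          mvfderiv (𝓘(ℝ, E).prod 𝓘(ℝ, F)) (fun u : TotalSpace F V => c i u.proj) v := by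
      classical
      intro t
      induction t using Finset.induction_on with
      | empty =>
        rw [Finset.sum_empty, Finset.sum_empty]
        exact mvfderiv_const (0 : ℝ)
      | insert i t hi ih =>
        rw [Finset.sum_insert hi, Finset.sum_insert hi, ← ih]
        have e1 : linFun (smulSection (c i) (s i) + ∑ i ∈ t, smulSection (c i) (s i)) =
            fun u : TotalSpace F V => c i u.proj * linFun (s i) u +
              linFun (∑ i ∈ t, smulSection (c i) (s i)) u := rfl
        have hm : MDifferentiableAt (𝓘(ℝ, E).prod 𝓘(ℝ, F)) 𝓘(ℝ, ℝ)
            (fun u : TotalSpace F V => c i u.proj * linFun (s i) u) v :=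
          contMDiff_real_mdiff ((contMDiff_comp_proj _).mul (contMDiff_linFun _)) v
        rw [e1, mvfderiv_fun_add hm (contMDiff_real_mdiff (contMDiff_linFun _) v),
          mvfderiv_fun_mul (contMDiff_real_mdiff (contMDiff_comp_proj _) v)
          (contMDiff_real_mdiff (contMDiff_linFun _) v), hc ha]
        simp
    rw [← h1, h2, mvfderiv_sum_const_smul_proj]
    exact h3 _
  · rw [rho_sum_const_mul]
    have h1 : linFun (L.bracket b (smulSection k a)) v = linFun (L.bracket b a) v := by
      simp only [linFun]
      rw [L.leibniz, ha, hk, smul_zero, add_zero, one_smul]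
    rw [← h1, hdec, L.bracket_sum]
    simp only [linFun]
    rw [sum_section_apply]
    refine Finset.sum_congr rfl fun i _ => ?_
    rw [L.leibniz, hc ha, zero_smul, zero_add]
    exact mul_comm _ _

/-- The section `q.1` vanishes at the base point, which removes every term except the bracket and
the anchor on `q.2`. With the linearization `G` of `q.1` these add up to the anchor applied to `G +
q.2`, whose differential is zero there. -/
theorem affForm_eq_zero {p q : DualSection 𝓘(ℝ, E) F V × C^∞⟮𝓘(ℝ, E), M; ℝ⟯} {v : TotalSpace F V}
    (h : dAff v q = 0) : affForm L P X p q v = 0 := by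
  have ha := apply_eq_zero_of_dAff_eq_zero h
  obtain ⟨G, hG, hL⟩ := exists_linearization ha
  have h1 : mvfderiv (𝓘(ℝ, E).prod 𝓘(ℝ, F)) (fun u : TotalSpace F V => (G + q.2) u.proj) v = 0 := by
    rw [← h]
    change mvfderiv _ (fun u : TotalSpace F V => G u.proj + q.2 u.proj) v =
      mvfderiv _ (fun u : TotalSpace F V => linFun q.1 u + q.2 u.proj) v
    rw [mvfderiv_fun_add (contMDiff_real_mdiff (contMDiff_comp_proj _) v)
      (contMDiff_real_mdiff (contMDiff_comp_proj _) v),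
      mvfderiv_fun_add (contMDiff_real_mdiff (contMDiff_linFun _) v)
      (contMDiff_real_mdiff (contMDiff_comp_proj _) v), hG]
  have h2 : L.rho p.1 (G + q.2 : C^∞⟮𝓘(ℝ, E), M; ℝ⟯) v.proj = 0 := by
    rw [LieAlgebroid.rho, mvfderiv_eq_zero_of_comp_proj h1]
    rfl
  have h3 : L.rho p.1 (G + q.2 : C^∞⟮𝓘(ℝ, E), M; ℝ⟯) v.proj = _ :=
    L.rho_add_fun p.1 G.contMDiff q.2.contMDiff v.proj
  have h4 : linFun q.1 v = 0 := by
    change q.1 v.proj v.snd = (0 : ℝ)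
    rw [ha]; rfl
  have h5 : pairing X q.1 v.proj = 0 := by
    rw [pairing, ha]; rfl
  rw [affForm, hL, P.apply_eq_zero ha, h4, h5, L.rho_eq_zero ha]
  linarith

/-- Used three times: with all the data for Λ_A, with `P` and `X` zero for the linear Poisson
structure, and with the trivial algebroid and `X` zero for the vertical lift. -/
theorem exists_affForm_bivector :
    ∃ B : BivectorField (𝓘(ℝ, E).prod 𝓘(ℝ, F)) (TotalSpace F V), ∀ a f b g v,
      B.onFun (affFun a f) (affFun b g) v = affForm L P X (a, f) (b, g) v := by
  obtain ⟨B, hB⟩ := exists_bivector_of_affine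
    (fun v => LinearMap.mk₂ ℝ (fun p q => affForm L P X p q v)
      (fun p q r => by
        rw [affForm_skew, affForm_add, affForm_skew L P X r p, affForm_skew L P X r q]; ring)
      (fun c p q => by
        rw [affForm_skew, affForm_smul, affForm_skew L P X q p, smul_eq_mul]; ring)
      (fun p q r => affForm_add L P X p q r v)
      (fun c p q => affForm_smul L P X c p q v))
    (fun v p => by
      have := affForm_skew L P X p p v
      change affForm L P X p p v = 0
      linarith)
    (fun v p q h => affForm_eq_zero L P X h)
    (fun p q => contMDiff_affForm L P X p q)
  exact ⟨B, fun a f b g v => hB v (a, f) (b, g)⟩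

end

/-- A vector field on `A` is smooth if it maps affine functions to smooth functions. -/
theorem contMDiff_of_act_affFun {Y : ∀ v : TotalSpace F V, TangentSpace (𝓘(ℝ, E).prod 𝓘(ℝ, F)) v}
    (hY : ∀ (a : DualSection 𝓘(ℝ, E) F V) (f : C^∞⟮𝓘(ℝ, E), M; ℝ⟯),
      ContMDiff (𝓘(ℝ, E).prod 𝓘(ℝ, F)) 𝓘(ℝ, ℝ) ∞
        fun v => mvfderiv (𝓘(ℝ, E).prod 𝓘(ℝ, F)) (affFun a f) v (Y v)) :
    ContMDiff (𝓘(ℝ, E).prod 𝓘(ℝ, F)) ((𝓘(ℝ, E).prod 𝓘(ℝ, F)).prod 𝓘(ℝ, E × F)) ∞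
      fun v => TotalSpace.mk' (E × F) v (Y v) := by
  refine contMDiff_vectorField_of_act (fun f hf v₀ => ?_) fun v₀ => ?_
  · obtain ⟨Ψ, hΨ, hΨe, hc⟩ := exists_affine_chart (E := E) v₀
    have b := Module.finBasis ℝ (E × F)
    have hi : ∀ i, ContMDiffAt (𝓘(ℝ, E).prod 𝓘(ℝ, F)) 𝓘(ℝ, ℝ) ∞ (fun v =>
        mvfderiv (𝓘(ℝ, E).prod 𝓘(ℝ, F)) (fun u => (b.coord i).toContinuousLinearMap (Ψ u)) v
          (Y v)) v₀ := fun i => by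
      obtain ⟨a, f, h⟩ := hc (b.coord i).toContinuousLinearMap
      rw [h]
      exact hY a f v₀
    have hs : ContMDiffAt (𝓘(ℝ, E).prod 𝓘(ℝ, F)) 𝓘(ℝ, ℝ) ∞ (fun v => ∑ i,
        coordDeriv (𝓘(ℝ, E).prod 𝓘(ℝ, F)) v₀ f v (b i) *
        mvfderiv (𝓘(ℝ, E).prod 𝓘(ℝ, F)) (fun u => (b.coord i).toContinuousLinearMap (Ψ u)) v
          (Y v)) v₀ :=
      contMDiffAt_finsetSum fun i _ => ((contMDiffAt_coordDeriv hf v₀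
        (mem_chart_source _ v₀)).clm_apply contMDiffAt_const).mul (hi i)
    refine hs.congr_of_eventuallyEq ?_
    filter_upwards [mvfderiv_eq_sum_coord b hf hΨ hΨe] with v hv
    rw [hv, sum_apply]
    rfl
  · obtain ⟨Ψ, hΨ, hΨe, -⟩ := exists_affine_chart (E := E) v₀
    exact ⟨Ψ, hΨ, hΨe⟩

/-- The vector field `-X^v`. -/
def negLift (X : Cₛ^∞⟮𝓘(ℝ, E); F, V⟯) :
    VectorField (𝓘(ℝ, E).prod 𝓘(ℝ, F)) (TotalSpace F V) :=
  ⟨fun v => -sectionLift X v, contMDiff_of_act_affFun fun a f => by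
    have h : (fun v : TotalSpace F V => mvfderiv (𝓘(ℝ, E).prod 𝓘(ℝ, F)) (affFun a f) v
        (-sectionLift X v)) = fun v => -pairing X a v.proj := by
      funext v
      rw [map_neg, sectionLift, mvfderiv_affFun_verticalLift]
      rfl
    rw [h]
    exact ((contMDiff_pairing X a).comp (contMDiff_proj V)).neg⟩

theorem negLift_act_affFun (X : Cₛ^∞⟮𝓘(ℝ, E); F, V⟯) (a : DualSection 𝓘(ℝ, E) F V)
    (f : C^∞⟮𝓘(ℝ, E), M; ℝ⟯) (v : TotalSpace F V) :
    (negLift X).act (affFun a f) v = -pairing X a v.proj := by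
  change mvfderiv (𝓘(ℝ, E).prod 𝓘(ℝ, F)) (affFun a f) v (-sectionLift X v) = _
  rw [map_neg, sectionLift, mvfderiv_affFun_verticalLift]
  rfl

end TwistedBivector

/-! ### The Jacobiator and tensoriality of the Jacobi conditions -/

section JacobiCalculus

variable {E₁ : Type*} [NormedAddCommGroup E₁] [NormedSpace ℝ E₁]
  {H₁ : Type*} [TopologicalSpace H₁] {J : ModelWithCorners ℝ E₁ H₁}
  {N : Type*} [TopologicalSpace N] [ChartedSpace H₁ N] [J.Boundaryless] [IsManifold J ∞ N]

namespace VectorField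

variable (X : VectorField J N)

theorem act_add {f g : N → ℝ} (hf : ContMDiff J 𝓘(ℝ, ℝ) ∞ f) (hg : ContMDiff J 𝓘(ℝ, ℝ) ∞ g)
    (x : N) : X.act (fun y => f y + g y) x = X.act f x + X.act g x := by
  simp only [act]
  rw [mvfderiv_fun_add (contMDiff_real_mdiff hf x) (contMDiff_real_mdiff hg x)]
  rfl

theorem act_sub {f g : N → ℝ} (hf : ContMDiff J 𝓘(ℝ, ℝ) ∞ f) (hg : ContMDiff J 𝓘(ℝ, ℝ) ∞ g)
    (x : N) : X.act (fun y => f y - g y) x = X.act f x - X.act g x := by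
  simp only [act]
  rw [mvfderiv_fun_sub (contMDiff_real_mdiff hf x) (contMDiff_real_mdiff hg x)]
  rfl

theorem act_mul {f g : N → ℝ} (hf : ContMDiff J 𝓘(ℝ, ℝ) ∞ f) (hg : ContMDiff J 𝓘(ℝ, ℝ) ∞ g)
    (x : N) : X.act (fun y => f y * g y) x = f x * X.act g x + g x * X.act f x := by
  simp only [act]
  rw [mvfderiv_fun_mul (contMDiff_real_mdiff hf x) (contMDiff_real_mdiff hg x)]
  rfl

theorem act_const (c : ℝ) (x : N) : X.act (fun _ => c) x = 0 := by
  simp only [act, mvfderiv_const]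
  rfl

end VectorField

namespace BivectorField

variable (Λ : BivectorField J N)

theorem form_skew (x : N) (α β : Cotangent J x) : Λ.form x α β = -Λ.form x β α := by
  have h := Λ.alternating x (α + β)
  simp only [map_add, LinearMap.add_apply, Λ.alternating] at h
  linarith

theorem onFun_skew (f g : N → ℝ) (x : N) : Λ.onFun f g x = -Λ.onFun g f x :=
  Λ.form_skew _ _ _

theorem contMDiff_onFun {f g : N → ℝ} (hf : ContMDiff J 𝓘(ℝ, ℝ) ∞ f)
    (hg : ContMDiff J 𝓘(ℝ, ℝ) ∞ g) : ContMDiff J 𝓘(ℝ, ℝ) ∞ (Λ.onFun f g) :=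
  Λ.smooth f g hf hg

theorem onFun_add {g h : N → ℝ} (f : N → ℝ) (hg : ContMDiff J 𝓘(ℝ, ℝ) ∞ g)
    (hh : ContMDiff J 𝓘(ℝ, ℝ) ∞ h) (x : N) :
    Λ.onFun f (fun y => g y + h y) x = Λ.onFun f g x + Λ.onFun f h x := by
  simp only [onFun]
  rw [mvfderiv_fun_add (contMDiff_real_mdiff hg x) (contMDiff_real_mdiff hh x), map_add]

theorem add_onFun {g h : N → ℝ} (f : N → ℝ) (hg : ContMDiff J 𝓘(ℝ, ℝ) ∞ g)
    (hh : ContMDiff J 𝓘(ℝ, ℝ) ∞ h) (x : N) :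
    Λ.onFun (fun y => g y + h y) f x = Λ.onFun g f x + Λ.onFun h f x := by
  rw [onFun_skew, onFun_add Λ f hg hh, onFun_skew Λ g, onFun_skew Λ h]
  ring

theorem sub_onFun {g h : N → ℝ} (f : N → ℝ) (hg : ContMDiff J 𝓘(ℝ, ℝ) ∞ g)
    (hh : ContMDiff J 𝓘(ℝ, ℝ) ∞ h) (x : N) :
    Λ.onFun (fun y => g y - h y) f x = Λ.onFun g f x - Λ.onFun h f x := by
  simp only [onFun]
  rw [mvfderiv_fun_sub (contMDiff_real_mdiff hg x) (contMDiff_real_mdiff hh x), map_sub]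
  rfl

theorem onFun_mul {g h : N → ℝ} (f : N → ℝ) (hg : ContMDiff J 𝓘(ℝ, ℝ) ∞ g)
    (hh : ContMDiff J 𝓘(ℝ, ℝ) ∞ h) (x : N) :
    Λ.onFun f (fun y => g y * h y) x = g x * Λ.onFun f h x + h x * Λ.onFun f g x := by
  simp only [onFun]
  rw [mvfderiv_fun_mul (contMDiff_real_mdiff hg x) (contMDiff_real_mdiff hh x), map_add, map_smul,
    map_smul]
  rfl

theorem mul_onFun {g h : N → ℝ} (f : N → ℝ) (hg : ContMDiff J 𝓘(ℝ, ℝ) ∞ g)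
    (hh : ContMDiff J 𝓘(ℝ, ℝ) ∞ h) (x : N) :
    Λ.onFun (fun y => g y * h y) f x = g x * Λ.onFun h f x + h x * Λ.onFun g f x := by
  rw [onFun_skew, onFun_mul Λ f hg hh, onFun_skew Λ g, onFun_skew Λ h]
  ring

theorem onFun_const (f : N → ℝ) (c : ℝ) (x : N) : Λ.onFun f (fun _ => c) x = 0 := by
  simp only [onFun, mvfderiv_const, map_zero]

theorem const_onFun (f : N → ℝ) (c : ℝ) (x : N) : Λ.onFun (fun _ => c) f x = 0 := by
  rw [onFun_skew, onFun_const, neg_zero]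

end BivectorField

section

variable (Λ : BivectorField J N) (X : VectorField J N)

/-- The bracket `{f, g} = Λ(df, dg) + f X(g) - g X(f)`. -/
def pairBracket (f g : N → ℝ) : N → ℝ :=
  fun x => Λ.onFun f g x + f x * X.act g x - g x * X.act f x

/-- The trivector field `-½[Λ, Λ] - X ∧ Λ` on `df, dg, dh`. -/
def jacobiDefect (f g h : N → ℝ) (x : N) : ℝ :=
  Λ.onFun (Λ.onFun f g) h x + Λ.onFun (Λ.onFun g h) f x + Λ.onFun (Λ.onFun h f) g x
    - VectorField.wedge X Λ f g h x

theorem pairBracket_onFun {f g : N → ℝ} (h : N → ℝ) (hf : ContMDiff J 𝓘(ℝ, ℝ) ∞ f)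
    (hg : ContMDiff J 𝓘(ℝ, ℝ) ∞ g) (x : N) :
    Λ.onFun (pairBracket Λ X f g) h x = Λ.onFun (Λ.onFun f g) h x
      + (f x * Λ.onFun (X.act g) h x + X.act g x * Λ.onFun f h x)
      - (g x * Λ.onFun (X.act f) h x + X.act f x * Λ.onFun g h x) := by
  have h1 : ContMDiff J 𝓘(ℝ, ℝ) ∞ (fun y => f y * X.act g y) := hf.mul (X.contMDiff_act hg)
  have h2 : ContMDiff J 𝓘(ℝ, ℝ) ∞ (fun y => g y * X.act f y) := hg.mul (X.contMDiff_act hf)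
  have h3 : ContMDiff J 𝓘(ℝ, ℝ) ∞ (fun y => Λ.onFun f g y + f y * X.act g y) :=
    (Λ.contMDiff_onFun hf hg).add h1
  unfold pairBracket
  rw [Λ.sub_onFun h h3 h2, Λ.add_onFun h (Λ.contMDiff_onFun hf hg) h1,
    Λ.mul_onFun h hf (X.contMDiff_act hg), Λ.mul_onFun h hg (X.contMDiff_act hf)]

theorem act_pairBracket {f g : N → ℝ} (hf : ContMDiff J 𝓘(ℝ, ℝ) ∞ f)
    (hg : ContMDiff J 𝓘(ℝ, ℝ) ∞ g) (x : N) :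
    X.act (pairBracket Λ X f g) x = X.act (Λ.onFun f g) x
      + f x * X.act (X.act g) x - g x * X.act (X.act f) x := by
  have h1 : ContMDiff J 𝓘(ℝ, ℝ) ∞ (fun y => f y * X.act g y) := hf.mul (X.contMDiff_act hg)
  have h2 : ContMDiff J 𝓘(ℝ, ℝ) ∞ (fun y => g y * X.act f y) := hg.mul (X.contMDiff_act hf)
  have h3 : ContMDiff J 𝓘(ℝ, ℝ) ∞ (fun y => Λ.onFun f g y + f y * X.act g y) :=
    (Λ.contMDiff_onFun hf hg).add h1
  unfold pairBracket
  rw [X.act_sub h3 h2, X.act_add (Λ.contMDiff_onFun hf hg) h1,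
    X.act_mul hf (X.contMDiff_act hg), X.act_mul hg (X.contMDiff_act hf)]
  ring

/-- In the expansion by the product rule the terms with X(X(f)) and with fX(g)X(h) cancel
cyclically; the surviving terms with an undifferentiated factor form [X, Λ], and the rest form the
defect. -/
theorem pairBracket_jacobiator {f g h : N → ℝ} (hf : ContMDiff J 𝓘(ℝ, ℝ) ∞ f)
    (hg : ContMDiff J 𝓘(ℝ, ℝ) ∞ g) (hh : ContMDiff J 𝓘(ℝ, ℝ) ∞ h) (x : N) :
    pairBracket Λ X (pairBracket Λ X f g) h x + pairBracket Λ X (pairBracket Λ X g h) f x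
      + pairBracket Λ X (pairBracket Λ X h f) g x
    = jacobiDefect Λ X f g h x - f x * X.schouten Λ g h x - g x * X.schouten Λ h f x
      - h x * X.schouten Λ f g x := by
  have e : ∀ u v w : N → ℝ, ContMDiff J 𝓘(ℝ, ℝ) ∞ u → ContMDiff J 𝓘(ℝ, ℝ) ∞ v →
      pairBracket Λ X (pairBracket Λ X u v) w x = Λ.onFun (Λ.onFun u v) w x
      + (u x * Λ.onFun (X.act v) w x + X.act v x * Λ.onFun u w x)
      - (v x * Λ.onFun (X.act u) w x + X.act u x * Λ.onFun v w x)
      + (Λ.onFun u v x + u x * X.act v x - v x * X.act u x) * X.act w x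
      - w x * (X.act (Λ.onFun u v) x + u x * X.act (X.act v) x - v x * X.act (X.act u) x) := by
    intro u v w hu hv
    rw [← pairBracket_onFun Λ X w hu hv, ← act_pairBracket Λ X hu hv]
    rfl
  rw [e f g h hf hg, e g h f hg hh, e h f g hh hf]
  simp only [jacobiDefect, VectorField.wedge, VectorField.schouten]
  rw [Λ.onFun_skew g f, Λ.onFun_skew h g, Λ.onFun_skew f h, Λ.onFun_skew g (X.act h),
    Λ.onFun_skew h (X.act f), Λ.onFun_skew f (X.act g)]
  ring

/-- Putting 1 in the third slot kills the defect and every other [X, Λ] term. Since 1 is affine,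
this extracts [X, Λ] = 0 from the Jacobi identity on affine functions. -/
theorem schouten_eq_jacobiator_one {f g : N → ℝ} (hf : ContMDiff J 𝓘(ℝ, ℝ) ∞ f)
    (hg : ContMDiff J 𝓘(ℝ, ℝ) ∞ g) (x : N) :
    X.schouten Λ f g x = -(pairBracket Λ X (pairBracket Λ X f g) (fun _ => 1) x
      + pairBracket Λ X (pairBracket Λ X g (fun _ => 1)) f x
      + pairBracket Λ X (pairBracket Λ X (fun _ => 1) f) g x) := by
  have z1 : ∀ u : N → ℝ, Λ.onFun u (fun _ => 1) = fun _ => 0 := fun u => funext (Λ.onFun_const u 1)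
  have z2 : ∀ u : N → ℝ, Λ.onFun (fun _ => 1) u = fun _ => 0 := fun u => funext (Λ.const_onFun u 1)
  have z3 : X.act (fun _ => 1) = fun _ => 0 := funext (X.act_const 1)
  rw [pairBracket_jacobiator Λ X hf hg contMDiff_const]
  simp only [jacobiDefect, VectorField.wedge, VectorField.schouten, z1, z2, z3, Λ.onFun_const,
    Λ.const_onFun, X.act_const]
  ring

theorem JacobiStructure.bracket_jacobi (S : JacobiStructure J N) {f g h : N → ℝ}
    (hf : ContMDiff J 𝓘(ℝ, ℝ) ∞ f) (hg : ContMDiff J 𝓘(ℝ, ℝ) ∞ g) (hh : ContMDiff J 𝓘(ℝ, ℝ) ∞ h)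
    (x : N) :
    S.bracket (S.bracket f g) h x + S.bracket (S.bracket g h) f x
      + S.bracket (S.bracket h f) g x = 0 := by
  refine (pairBracket_jacobiator S.Λ S.E hf hg hh x).trans ?_
  rw [S.schouten_mixed _ _ hf hg, S.schouten_mixed _ _ hg hh, S.schouten_mixed _ _ hh hf]
  have := S.schouten_self f g h hf hg hh x
  simp only [BivectorField.schoutenSelf] at this
  simp only [jacobiDefect]
  linarith

/-- The derivation `Λ(·, dg)`. -/
def contract (g : N → ℝ) (x : N) : Cotangent J x →ₗ[ℝ] ℝ :=
  (Λ.form x).flip (mvfderiv J g x)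

/-- The derivation given by a vector field. -/
def evalField (x : N) : Cotangent J x →ₗ[ℝ] ℝ where
  toFun α := α (X x)
  map_add' _ _ := rfl
  map_smul' _ _ := rfl

variable [FiniteDimensional ℝ E₁]
  (hΨ : ∀ x₀ : N, ∃ Ψ : N → E₁, ContMDiff J 𝓘(ℝ, E₁) ∞ Ψ ∧ Ψ =ᶠ[𝓝 x₀] extChartAt J x₀)

include hΨ in
-- Tensoriality of the defect. The two terms with second derivatives of `f` cancel because the
-- derivations Λ(·, dg) and Λ(·, dh) commute on `f` at a critical point; every other term contains
-- df.
theorem jacobiDefect_eq_zero_of_mvfderiv {f g h : N → ℝ} (hf : ContMDiff J 𝓘(ℝ, ℝ) ∞ f)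
    (hg : ContMDiff J 𝓘(ℝ, ℝ) ∞ g) (hh : ContMDiff J 𝓘(ℝ, ℝ) ∞ h) {x : N}
    (hdf : mvfderiv J f x = 0) : jacobiDefect Λ X f g h x = 0 := by
  obtain ⟨Ψ, h1, h2⟩ := hΨ x
  have h3 := derivation_comm_of_mvfderiv_eq_zero (X := contract Λ h) (Y := contract Λ g)
    (fun u hu => Λ.contMDiff_onFun hu hh) (fun u hu => Λ.contMDiff_onFun hu hg) hf hdf h1 h2
  have h4 : Λ.onFun (Λ.onFun f g) h x = Λ.onFun (Λ.onFun f h) g x := h3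
  have h5 : Λ.onFun h f = fun y => -Λ.onFun f h y := funext fun y => Λ.onFun_skew h f y
  have h6 : ∀ u, Λ.onFun u f x = 0 := fun u => by
    simp only [BivectorField.onFun, hdf, map_zero]
  have h7 : X.act f x = 0 := by
    simp only [VectorField.act, hdf]; rfl
  have h8 : Λ.onFun (fun y => -Λ.onFun f h y) g x = -Λ.onFun (Λ.onFun f h) g x := by
    have := Λ.sub_onFun (g := fun _ => 0) g contMDiff_const (Λ.contMDiff_onFun hf hh) x
    rw [Λ.const_onFun] at this
    simpa using this
  simp only [jacobiDefect, VectorField.wedge]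
  rw [h5, h8, h4, h6, ← h5, h6, h7, Λ.onFun_skew f g, h6]
  ring

include hΨ in
-- Here the derivations that commute at the critical point are X and Λ(·, dg).
theorem schouten_eq_zero_of_mvfderiv {f g : N → ℝ} (hf : ContMDiff J 𝓘(ℝ, ℝ) ∞ f)
    (hg : ContMDiff J 𝓘(ℝ, ℝ) ∞ g) {x : N} (hdf : mvfderiv J f x = 0) :
    X.schouten Λ f g x = 0 := by
  obtain ⟨Ψ, h1, h2⟩ := hΨ x
  have h3 := derivation_comm_of_mvfderiv_eq_zero (X := evalField X) (Y := contract Λ g)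
    (fun u hu => X.contMDiff_act hu) (fun u hu => Λ.contMDiff_onFun hu hg) hf hdf h1 h2
  have h4 : X.act (Λ.onFun f g) x = Λ.onFun (X.act f) g x := h3
  have h6 : ∀ u, Λ.onFun u f x = 0 := fun u => by
    simp only [BivectorField.onFun, hdf, map_zero]
  simp only [VectorField.schouten]
  rw [h4, Λ.onFun_skew f, h6]
  ring

theorem jacobiDefect_cyclic (f g h : N → ℝ) (x : N) :
    jacobiDefect Λ X f g h x = jacobiDefect Λ X g h f x := by
  simp only [jacobiDefect, VectorField.wedge]
  ring

theorem jacobiDefect_add {f f' g h : N → ℝ} (hf : ContMDiff J 𝓘(ℝ, ℝ) ∞ f)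
    (hf' : ContMDiff J 𝓘(ℝ, ℝ) ∞ f')
    (hg : ContMDiff J 𝓘(ℝ, ℝ) ∞ g) (hh : ContMDiff J 𝓘(ℝ, ℝ) ∞ h) (x : N) :
    jacobiDefect Λ X (fun y => f y + f' y) g h x =
      jacobiDefect Λ X f g h x + jacobiDefect Λ X f' g h x := by
  have h1 : Λ.onFun (fun y => f y + f' y) g = fun y => Λ.onFun f g y + Λ.onFun f' g y :=
    funext (Λ.add_onFun g hf hf')
  have h2 : Λ.onFun h (fun y => f y + f' y) = fun y => Λ.onFun h f y + Λ.onFun h f' y :=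
    funext (Λ.onFun_add h hf hf')
  simp only [jacobiDefect, VectorField.wedge, h1, h2]
  rw [Λ.add_onFun h (Λ.contMDiff_onFun hf hg) (Λ.contMDiff_onFun hf' hg),
    Λ.add_onFun g (Λ.contMDiff_onFun hh hf) (Λ.contMDiff_onFun hh hf'),
    Λ.onFun_add _ hf hf', X.act_add hf hf']
  ring

theorem schouten_skew {f g : N → ℝ} (hf : ContMDiff J 𝓘(ℝ, ℝ) ∞ f)
    (hg : ContMDiff J 𝓘(ℝ, ℝ) ∞ g) (x : N) : X.schouten Λ f g x = -X.schouten Λ g f x := by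
  have h1 : Λ.onFun f g = fun y => (fun _ => (0 : ℝ)) y - Λ.onFun g f y := funext fun y => by
    rw [Λ.onFun_skew]; simp
  simp only [VectorField.schouten]
  rw [h1, X.act_sub contMDiff_const (Λ.contMDiff_onFun hg hf), X.act_const, Λ.onFun_skew f,
    Λ.onFun_skew (X.act f)]
  ring

theorem schouten_add {f f' g : N → ℝ} (hf : ContMDiff J 𝓘(ℝ, ℝ) ∞ f)
    (hf' : ContMDiff J 𝓘(ℝ, ℝ) ∞ f') (hg : ContMDiff J 𝓘(ℝ, ℝ) ∞ g) (x : N) :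
    X.schouten Λ (fun y => f y + f' y) g x = X.schouten Λ f g x + X.schouten Λ f' g x := by
  have h1 : Λ.onFun (fun y => f y + f' y) g = fun y => Λ.onFun f g y + Λ.onFun f' g y :=
    funext (Λ.add_onFun g hf hf')
  have h2 : X.act (fun y => f y + f' y) = fun y => X.act f y + X.act f' y :=
    funext (X.act_add hf hf')
  simp only [VectorField.schouten, h1, h2]
  rw [X.act_add (Λ.contMDiff_onFun hf hg) (Λ.contMDiff_onFun hf' hg),
    Λ.add_onFun g (X.contMDiff_act hf) (X.contMDiff_act hf'),
    Λ.add_onFun _ hf hf']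
  ring

variable {𝒜 : Set (N → ℝ)} (h𝒜 : ∀ f ∈ 𝒜, ContMDiff J 𝓘(ℝ, ℝ) ∞ f)
  (hspan : ∀ (x : N) (α : Cotangent J x), ∃ f ∈ 𝒜, mvfderiv J f x = α)

include hΨ h𝒜 hspan in
-- Each argument is replaced by a member of `𝒜` with the same differential at `x`; the difference is
-- critical there and contributes nothing. Cyclic symmetry brings each argument in turn to the first
-- slot.
theorem jacobiDefect_eq_zero_of_span
    (h0 : ∀ f ∈ 𝒜, ∀ g ∈ 𝒜, ∀ h ∈ 𝒜, ∀ x, jacobiDefect Λ X f g h x = 0)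
    {f g h : N → ℝ} (hf : ContMDiff J 𝓘(ℝ, ℝ) ∞ f)
    (hg : ContMDiff J 𝓘(ℝ, ℝ) ∞ g) (hh : ContMDiff J 𝓘(ℝ, ℝ) ∞ h) (x : N) :
    jacobiDefect Λ X f g h x = 0 := by
  have key : ∀ u v w : N → ℝ, ContMDiff J 𝓘(ℝ, ℝ) ∞ u → ContMDiff J 𝓘(ℝ, ℝ) ∞ v →
      ContMDiff J 𝓘(ℝ, ℝ) ∞ w → (∀ f ∈ 𝒜, jacobiDefect Λ X f v w x = 0) →
      jacobiDefect Λ X u v w x = 0 := by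
    intro u v w hu hv hw h1
    obtain ⟨φ, hφ, hd⟩ := hspan x (mvfderiv J u x)
    have hs := h𝒜 φ hφ
    have e : u = fun y => φ y + (fun z => u z - φ z) y := by
      funext y; simp
    rw [e, jacobiDefect_add Λ X hs (hu.sub hs) hv hw, h1 φ hφ,
      jacobiDefect_eq_zero_of_mvfderiv Λ X hΨ (hu.sub hs) hv hw, add_zero]
    rw [mvfderiv_fun_sub (contMDiff_real_mdiff hu x) (contMDiff_real_mdiff hs x), hd, sub_self]
  refine key f g h hf hg hh fun φ hφ => ?_
  rw [jacobiDefect_cyclic]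
  refine key g h φ hg hh (h𝒜 φ hφ) fun χ hχ => ?_
  rw [jacobiDefect_cyclic]
  refine key h φ χ hh (h𝒜 φ hφ) (h𝒜 χ hχ) fun ψ hψ => ?_
  exact h0 _ hψ _ hφ _ hχ x

include hΨ h𝒜 hspan in
theorem schouten_eq_zero_of_span (h0 : ∀ f ∈ 𝒜, ∀ g ∈ 𝒜, ∀ x, X.schouten Λ f g x = 0)
    {f g : N → ℝ} (hf : ContMDiff J 𝓘(ℝ, ℝ) ∞ f) (hg : ContMDiff J 𝓘(ℝ, ℝ) ∞ g) (x : N) :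
    X.schouten Λ f g x = 0 := by
  have key : ∀ u v : N → ℝ, ContMDiff J 𝓘(ℝ, ℝ) ∞ u → ContMDiff J 𝓘(ℝ, ℝ) ∞ v →
      (∀ f ∈ 𝒜, X.schouten Λ f v x = 0) → X.schouten Λ u v x = 0 := by
    intro u v hu hv h1
    obtain ⟨φ, hφ, hd⟩ := hspan x (mvfderiv J u x)
    have hs := h𝒜 φ hφ
    have e : u = fun y => φ y + (fun z => u z - φ z) y := by
      funext y; simp
    rw [e, schouten_add Λ X hs (hu.sub hs) hv, h1 φ hφ,
      schouten_eq_zero_of_mvfderiv Λ X hΨ (hu.sub hs) hv, add_zero]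
    rw [mvfderiv_fun_sub (contMDiff_real_mdiff hu x) (contMDiff_real_mdiff hs x), hd, sub_self]
  refine key f g hf hg fun φ hφ => ?_
  rw [schouten_skew Λ X (h𝒜 φ hφ) hg, neg_eq_zero]
  refine key g φ hg (h𝒜 φ hφ) fun χ hχ => ?_
  exact h0 _ hχ _ hφ x

end

end JacobiCalculus

/-! ### The Jacobi identities from the algebroid axioms -/

section FromAlgebroid

variable {E : Type*} [NormedAddCommGroup E] [NormedSpace ℝ E] [FiniteDimensional ℝ E]
  {M : Type*} [TopologicalSpace M] [T2Space M] [ChartedSpace E M] [IsManifold 𝓘(ℝ, E) ∞ M]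
  {F : Type*} [NormedAddCommGroup F] [NormedSpace ℝ F] [FiniteDimensional ℝ F]
  {V : M → Type*} [TopologicalSpace (TotalSpace F V)]
  [∀ x, AddCommGroup (V x)] [∀ x, Module ℝ (V x)] [∀ x, TopologicalSpace (V x)]
  [∀ x, IsTopologicalAddGroup (V x)] [∀ x, ContinuousSMul ℝ (V x)]
  [FiberBundle F V] [VectorBundle ℝ F V] [ContMDiffVectorBundle ∞ F V 𝓘(ℝ, E)]

/-- Positive rank enters the whole argument through this vector: with `exists_dual_apply_ne_zero` it
supplies linear functions that can be cancelled. -/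
theorem exists_fiber_ne_zero (hrank : 0 < Module.finrank ℝ F) (x : M) : ∃ w : V x, w ≠ 0 := by
  have : Nontrivial F := Module.finrank_pos_iff.1 hrank
  obtain ⟨z, hz⟩ := exists_ne (0 : F)
  have hb := FiberBundle.mem_baseSet_trivializationAt' (F := F) (E := V) x
  refine ⟨(trivializationAt F V x).symmL ℝ x z, fun h => hz ?_⟩
  have := (trivializationAt F V x).continuousLinearMapAt_symmL (R := ℝ) hb z
  rw [h, map_zero] at this
  exact this.symm

theorem exists_dual_apply_ne_zero {x : M} {w : V x} (hw : w ≠ 0) :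
    ∃ a : DualSection 𝓘(ℝ, E) F V, (a x w : ℝ) ≠ 0 := by
  by_contra! h
  refine hw (eq_of_forall_dual_apply_eq (E := E) (F := F) fun a => ?_)
  rw [map_zero]
  exact h a

/-- The smooth function `ρ(a)(f)`. -/
def LieAlgebroid.rhoMap (L : LieAlgebroid 𝓘(ℝ, E) (F →L[ℝ] ℝ) (DualFiber V))
    (a : DualSection 𝓘(ℝ, E) F V) (f : C^∞⟮𝓘(ℝ, E), M; ℝ⟯) : C^∞⟮𝓘(ℝ, E), M; ℝ⟯ :=
  ⟨L.rho a f, L.contMDiff_rho a f.contMDiff⟩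

theorem LieAlgebroid.leibniz_section (L : LieAlgebroid 𝓘(ℝ, E) (F →L[ℝ] ℝ) (DualFiber V))
    (a b : DualSection 𝓘(ℝ, E) F V) (f : C^∞⟮𝓘(ℝ, E), M; ℝ⟯) :
    L.bracket a (smulSection f b) = smulSection f (L.bracket a b) + smulSection (L.rhoMap a f) b := by
  ext1 x
  exact L.leibniz a f b x

/-- The anchor is a homomorphism of Lie algebras. -/
theorem LieAlgebroid.rho_bracket (hrank : 0 < Module.finrank ℝ F)
    (L : LieAlgebroid 𝓘(ℝ, E) (F →L[ℝ] ℝ) (DualFiber V))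
    (a b : DualSection 𝓘(ℝ, E) F V) (f : C^∞⟮𝓘(ℝ, E), M; ℝ⟯) (x : M) :
    L.rho (L.bracket a b) f x = L.rho a (L.rho b f) x - L.rho b (L.rho a f) x := by
  obtain ⟨w, hw⟩ := exists_fiber_ne_zero (F := F) (V := V) hrank x
  obtain ⟨c, hc⟩ := exists_dual_apply_ne_zero (E := E) (F := F) hw
  -- Subtracting `f` times the Jacobi identity of a, b, c from that of a, b, fc leaves (ρ⟦a,b⟧ -
  -- [ρ(a), ρ(b)])(f) · c; the factor c(w) is nonzero by choice.
  have h1 := L.jacobi a b (smulSection f c)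
  have h2 := L.jacobi a b c
  rw [L.bracket_skew (L.bracket b _) a, L.bracket_skew (smulSection f c) a,
    L.bracket_skew (-L.bracket a _) b] at h1
  rw [L.bracket_skew (L.bracket b _) a, L.bracket_skew c a,
    L.bracket_skew (-L.bracket a _) b] at h2
  have hn : ∀ u v : DualSection 𝓘(ℝ, E) F V, L.bracket u (-v) = -L.bracket u v := fun u v =>
    map_neg (AddMonoidHom.mk' (L.bracket u) (L.bracket_add u)) v
  rw [hn, neg_neg] at h1 h2
  simp only [L.leibniz_section, L.bracket_add] at h1
  have e1 := congrArg (fun s : DualSection 𝓘(ℝ, E) F V => (s x w : ℝ)) h1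
  have e2 := congrArg (fun s : DualSection 𝓘(ℝ, E) F V => (s x w : ℝ)) h2
  set p : ℝ := L.bracket (L.bracket a b) c x w with hp
  set q : ℝ := L.bracket a (L.bracket b c) x w with hq
  set r : ℝ := L.bracket b (L.bracket a c) x w with hr
  set s : ℝ := L.bracket b c x w with hs
  set t : ℝ := L.bracket a c x w with ht
  change (f x * p + L.rho (L.bracket a b) f x * c x w)
    + -((f x * q + L.rho a f x * s) + (L.rho b f x * t + L.rho a (L.rho b f) x * c x w))
    + ((f x * r + L.rho b f x * t) + (L.rho a f x * s + L.rho b (L.rho a f) x * c x w)) = (0 : ℝ) at e1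
  change p + -q + r = (0 : ℝ) at e2
  refine mul_right_cancel₀ hc ?_
  linear_combination e1 - f x * e2

variable (L : LieAlgebroid 𝓘(ℝ, E) (F →L[ℝ] ℝ) (DualFiber V))
    (P : SkewBilinear 𝓘(ℝ, E) (F →L[ℝ] ℝ) (DualFiber V)) (X : Cₛ^∞⟮𝓘(ℝ, E); F, V⟯)

/-- The pairing of sections, as a smooth function. -/
def pairingMap (a : DualSection 𝓘(ℝ, E) F V) : C^∞⟮𝓘(ℝ, E), M; ℝ⟯ :=
  ⟨pairing X a, contMDiff_pairing X a⟩

/-- The basic part of the bracket of two affine functions. -/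
def basicPart (p q : DualSection 𝓘(ℝ, E) F V × C^∞⟮𝓘(ℝ, E), M; ℝ⟯) : C^∞⟮𝓘(ℝ, E), M; ℝ⟯ :=
  q.2 * pairingMap X p.1 - p.2 * pairingMap X q.1 - P.toFun p.1 q.1
    + (L.rhoMap p.1 q.2 - L.rhoMap q.1 p.2)

theorem pairBracket_affFun {B : BivectorField (𝓘(ℝ, E).prod 𝓘(ℝ, F)) (TotalSpace F V)}
    (hB : ∀ a f b g v, B.onFun (affFun a f) (affFun b g) v = affForm L P X (a, f) (b, g) v)
    (p q : DualSection 𝓘(ℝ, E) F V × C^∞⟮𝓘(ℝ, E), M; ℝ⟯) :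
    pairBracket B (negLift X) (affFun p.1 p.2) (affFun q.1 q.2) =
      affFun (L.bracket p.1 q.1) (basicPart L P X p q) := by
  funext v
  simp only [pairBracket, hB, negLift_act_affFun]
  change _ = linFun (L.bracket p.1 q.1) v + (q.2 v.proj * pairing X p.1 v.proj
    - p.2 v.proj * pairing X q.1 v.proj - P.toFun p.1 q.1 v.proj
    + (L.rho p.1 q.2 v.proj - L.rho q.1 p.2 v.proj))
  simp only [affForm, affFun]
  ring

theorem rho_basicPart (c : DualSection 𝓘(ℝ, E) F V)
    (p q : DualSection 𝓘(ℝ, E) F V × C^∞⟮𝓘(ℝ, E), M; ℝ⟯) (x : M) :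
    L.rho c (basicPart L P X p q) x =
      (q.2 x * L.rho c (pairing X p.1) x + pairing X p.1 x * L.rho c q.2 x)
      - (p.2 x * L.rho c (pairing X q.1) x + pairing X q.1 x * L.rho c p.2 x)
      - L.rho c (P.toFun p.1 q.1) x + (L.rho c (L.rho p.1 q.2) x - L.rho c (L.rho q.1 p.2) x) := by
  have hadd : ∀ f g : C^∞⟮𝓘(ℝ, E), M; ℝ⟯,
      L.rho c (f + g : C^∞⟮𝓘(ℝ, E), M; ℝ⟯) x = L.rho c f x + L.rho c g x :=
    fun f g => L.rho_add_fun c f.contMDiff g.contMDiff x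
  have hneg : ∀ f : C^∞⟮𝓘(ℝ, E), M; ℝ⟯,
      L.rho c (-f : C^∞⟮𝓘(ℝ, E), M; ℝ⟯) x = -L.rho c f x := fun f => L.rho_neg_fun c f x
  have hmul : ∀ f g : C^∞⟮𝓘(ℝ, E), M; ℝ⟯,
      L.rho c (f * g : C^∞⟮𝓘(ℝ, E), M; ℝ⟯) x = f x * L.rho c g x + g x * L.rho c f x :=
    fun f g => L.rho_mul_fun c f.contMDiff g.contMDiff x
  simp only [basicPart, sub_eq_add_neg, hadd, hneg, hmul]
  rfl

/-- Each base function multiplies the cocycle identity of the other two sections, and the part free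
of base functions is the twist condition. The iterated anchors cancel because the anchor is a
morphism. -/
theorem basicPart_jacobi (hrank : 0 < Module.finrank ℝ F)
    (hcocycle : ∀ a b x, L.d₁ (pairing X) a b x = 0)
    (htwist : ∀ a b c x, L.d₂ (fun s t => P.toFun s t) a b c x
      = -wedge₁₂ (pairing X) (fun s t => P.toFun s t) a b c x)
    (p q r : DualSection 𝓘(ℝ, E) F V × C^∞⟮𝓘(ℝ, E), M; ℝ⟯) (x : M) :
    basicPart L P X (L.bracket p.1 q.1, basicPart L P X p q) r x
      + basicPart L P X (L.bracket q.1 r.1, basicPart L P X q r) p x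
      + basicPart L P X (L.bracket r.1 p.1, basicPart L P X r p) q x = 0 := by
  have e : ∀ p q r : DualSection 𝓘(ℝ, E) F V × C^∞⟮𝓘(ℝ, E), M; ℝ⟯,
      basicPart L P X (L.bracket p.1 q.1, basicPart L P X p q) r x =
      r.2 x * pairing X (L.bracket p.1 q.1) x - (q.2 x * pairing X p.1 x
    - p.2 x * pairing X q.1 x - P.toFun p.1 q.1 x
    + (L.rho p.1 q.2 x - L.rho q.1 p.2 x)) * pairing X r.1 x - P.toFun (L.bracket p.1 q.1) r.1 x
      + (L.rho (L.bracket p.1 q.1) r.2 x - L.rho r.1 (basicPart L P X p q) x) := fun p q r => rfl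
  have s1 : P.toFun p.1 r.1 = -P.toFun r.1 p.1 := P.skew _ _
  have s2 : L.bracket p.1 r.1 = -L.bracket r.1 p.1 := L.bracket_skew _ _
  have s3 : P.toFun (-L.bracket r.1 p.1) q.1 = -P.toFun (L.bracket r.1 p.1) q.1 := by
    rw [P.skew, P.skew (L.bracket r.1 p.1)]
    have := map_neg (AddMonoidHom.mk' (P.toFun q.1) (P.map_add q.1)) (L.bracket r.1 p.1)
    exact congrArg Neg.neg this
  have h1 := htwist p.1 q.1 r.1 x
  simp only [LieAlgebroid.d₂, wedge₁₂, s1, s2, s3] at h1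
  have s4 : L.rho q.1 (-P.toFun r.1 p.1 : C^∞⟮𝓘(ℝ, E), M; ℝ⟯) x =
    -L.rho q.1 (P.toFun r.1 p.1) x := L.rho_neg_fun _ _ _
  have s5 : ∀ f : C^∞⟮𝓘(ℝ, E), M; ℝ⟯, (-f) x = -f x := fun _ => rfl
  rw [s4] at h1
  simp only [s5] at h1
  have c1 := hcocycle p.1 q.1 x
  have c2 := hcocycle q.1 r.1 x
  have c3 := hcocycle r.1 p.1 x
  simp only [LieAlgebroid.d₁] at c1 c2 c3
  rw [e, e, e, rho_basicPart, rho_basicPart, rho_basicPart, L.rho_bracket hrank,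
    L.rho_bracket hrank, L.rho_bracket hrank]
  linear_combination -(r.2 x) * c1 - p.2 x * c2 - q.2 x * c3 + h1

/-- The set of affine functions. -/
def affineSet : Set (TotalSpace F V → ℝ) :=
  Set.range fun p : DualSection 𝓘(ℝ, E) F V × C^∞⟮𝓘(ℝ, E), M; ℝ⟯ => affFun p.1 p.2

theorem pairBracket_jacobi_affine (hrank : 0 < Module.finrank ℝ F)
    {B : BivectorField (𝓘(ℝ, E).prod 𝓘(ℝ, F)) (TotalSpace F V)}
    (hB : ∀ a f b g v, B.onFun (affFun a f) (affFun b g) v = affForm L P X (a, f) (b, g) v)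
    (hcocycle : ∀ a b x, L.d₁ (pairing X) a b x = 0)
    (htwist : ∀ a b c x, L.d₂ (fun s t => P.toFun s t) a b c x
      = -wedge₁₂ (pairing X) (fun s t => P.toFun s t) a b c x)
    (p q r : DualSection 𝓘(ℝ, E) F V × C^∞⟮𝓘(ℝ, E), M; ℝ⟯) (v : TotalSpace F V) :
    pairBracket B (negLift X) (pairBracket B (negLift X) (affFun p.1 p.2) (affFun q.1 q.2))
        (affFun r.1 r.2) v
      + pairBracket B (negLift X) (pairBracket B (negLift X) (affFun q.1 q.2) (affFun r.1 r.2))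
        (affFun p.1 p.2) v
      + pairBracket B (negLift X) (pairBracket B (negLift X) (affFun r.1 r.2) (affFun p.1 p.2))
        (affFun q.1 q.2) v = 0 := by
  have h1 : linFun (L.bracket (L.bracket p.1 q.1) r.1) v
      + linFun (L.bracket (L.bracket q.1 r.1) p.1) v
      + linFun (L.bracket (L.bracket r.1 p.1) q.1) v = 0 :=
    congrArg (fun s : DualSection 𝓘(ℝ, E) F V => linFun s v) (L.jacobi p.1 q.1 r.1)
  have h2 := basicPart_jacobi L P X hrank hcocycle htwist p q r v.proj
  have e : ∀ p q r : DualSection 𝓘(ℝ, E) F V × C^∞⟮𝓘(ℝ, E), M; ℝ⟯,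
      pairBracket B (negLift X) (pairBracket B (negLift X) (affFun p.1 p.2) (affFun q.1 q.2))
        (affFun r.1 r.2) v = linFun (L.bracket (L.bracket p.1 q.1) r.1) v
        + basicPart L P X (L.bracket p.1 q.1, basicPart L P X p q) r v.proj := fun p q r => by
    rw [pairBracket_affFun L P X hB,
      pairBracket_affFun L P X hB (L.bracket p.1 q.1, basicPart L P X p q) r]
    rfl
  rw [e, e, e]
  linarith

theorem affFun_zero_one : affFun (0 : DualSection 𝓘(ℝ, E) F V) (1 : C^∞⟮𝓘(ℝ, E), M; ℝ⟯) =
    fun _ => 1 := funext fun _ => zero_add _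

/-- The Jacobi identities for the bivector field of a twisted Jacobi algebroid. -/
theorem isJacobi_of_twisted (hrank : 0 < Module.finrank ℝ F)
    {B : BivectorField (𝓘(ℝ, E).prod 𝓘(ℝ, F)) (TotalSpace F V)}
    (hB : ∀ a f b g v, B.onFun (affFun a f) (affFun b g) v = affForm L P X (a, f) (b, g) v)
    (hcocycle : ∀ a b x, L.d₁ (pairing X) a b x = 0)
    (htwist : ∀ a b c x, L.d₂ (fun s t => P.toFun s t) a b c x
      = -wedge₁₂ (pairing X) (fun s t => P.toFun s t) a b c x) :
    (∀ f g h : TotalSpace F V → ℝ, ContMDiff (𝓘(ℝ, E).prod 𝓘(ℝ, F)) 𝓘(ℝ, ℝ) ∞ f →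
      ContMDiff (𝓘(ℝ, E).prod 𝓘(ℝ, F)) 𝓘(ℝ, ℝ) ∞ g →
      ContMDiff (𝓘(ℝ, E).prod 𝓘(ℝ, F)) 𝓘(ℝ, ℝ) ∞ h → ∀ v,
        B.schoutenSelf f g h v = -2 * VectorField.wedge (negLift X) B f g h v) ∧
    (∀ f g : TotalSpace F V → ℝ, ContMDiff (𝓘(ℝ, E).prod 𝓘(ℝ, F)) 𝓘(ℝ, ℝ) ∞ f →
      ContMDiff (𝓘(ℝ, E).prod 𝓘(ℝ, F)) 𝓘(ℝ, ℝ) ∞ g → ∀ v,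
        VectorField.schouten (negLift X) B f g v = 0) := by
  have hΨ : ∀ v₀ : TotalSpace F V, ∃ Ψ : TotalSpace F V → E × F,
      ContMDiff (𝓘(ℝ, E).prod 𝓘(ℝ, F)) 𝓘(ℝ, E × F) ∞ Ψ ∧
      Ψ =ᶠ[𝓝 v₀] extChartAt (𝓘(ℝ, E).prod 𝓘(ℝ, F)) v₀ := fun v₀ => by
    obtain ⟨Ψ, h1, h2, -⟩ := exists_affine_chart (E := E) v₀
    exact ⟨Ψ, h1, h2⟩
  have h𝒜 : ∀ f ∈ affineSet (E := E) (F := F) (V := V),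
      ContMDiff (𝓘(ℝ, E).prod 𝓘(ℝ, F)) 𝓘(ℝ, ℝ) ∞ f := by
    rintro _ ⟨p, rfl⟩
    exact contMDiff_affFun _ _
  have hspan : ∀ (v : TotalSpace F V) (α : Cotangent (𝓘(ℝ, E).prod 𝓘(ℝ, F)) v),
      ∃ f ∈ affineSet (E := E) (F := F) (V := V), mvfderiv (𝓘(ℝ, E).prod 𝓘(ℝ, F)) f v = α := by
    intro v α
    obtain ⟨p, hp⟩ := dAff_surjective (E := E) v α
    exact ⟨_, ⟨p, rfl⟩, hp⟩
  have hJ := pairBracket_jacobi_affine L P X hrank hB hcocycle htwist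
  have hS0 : ∀ f ∈ affineSet (E := E) (F := F) (V := V),
      ∀ g ∈ affineSet (E := E) (F := F) (V := V), ∀ v, (negLift X).schouten B f g v = 0 := by
    rintro _ ⟨p, rfl⟩ _ ⟨q, rfl⟩ v
    have h1 := hJ p q (0, 1) v
    simp only [affFun_zero_one] at h1
    rw [schouten_eq_jacobiator_one B (negLift X) (contMDiff_affFun _ _) (contMDiff_affFun _ _), h1,
      neg_zero]
  have hT0 : ∀ f ∈ affineSet (E := E) (F := F) (V := V),
      ∀ g ∈ affineSet (E := E) (F := F) (V := V), ∀ h ∈ affineSet (E := E) (F := F) (V := V),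
      ∀ v, jacobiDefect B (negLift X) f g h v = 0 := by
    rintro _ ⟨p, rfl⟩ _ ⟨q, rfl⟩ _ ⟨r, rfl⟩ v
    have h1 := hJ p q r v
    rw [pairBracket_jacobiator B (negLift X) (contMDiff_affFun _ _) (contMDiff_affFun _ _)
      (contMDiff_affFun _ _), hS0 _ ⟨p, rfl⟩ _ ⟨q, rfl⟩, hS0 _ ⟨q, rfl⟩ _ ⟨r, rfl⟩,
      hS0 _ ⟨r, rfl⟩ _ ⟨p, rfl⟩] at h1
    simpa using h1
  refine ⟨fun f g h hf hg hh v => ?_, fun f g hf hg v =>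
    schouten_eq_zero_of_span B (negLift X) hΨ h𝒜 hspan hS0 hf hg v⟩
  have := jacobiDefect_eq_zero_of_span B (negLift X) hΨ h𝒜 hspan hT0 hf hg hh v
  simp only [jacobiDefect] at this
  simp only [BivectorField.schoutenSelf]
  linarith

end FromAlgebroid

/-! ### A factorization through a finite-dimensional dual -/

section FiniteDimensionalDuality

/-- A functional killing `ker ev` lies in the range of the dual map of `ev`, and reflexivity of `W`
turns its preimage into a vector. -/
theorem exists_vector_of_functional {S W : Type*} [AddCommGroup S] [Module ℝ S] [AddCommGroup W]
    [Module ℝ W] [FiniteDimensional ℝ W] (ev : S →ₗ[ℝ] Module.Dual ℝ W) (τ : S →ₗ[ℝ] ℝ)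
    (h : ∀ s, ev s = 0 → τ s = 0) : ∃ w : W, ∀ s, τ s = ev s w := by
  have h1 : τ ∈ LinearMap.range ev.dualMap := by
    rw [LinearMap.range_dualMap_eq_dualAnnihilator_ker, Submodule.mem_dualAnnihilator]
    exact fun s hs => h s hs
  obtain ⟨μ, rfl⟩ := h1
  refine ⟨(Module.evalEquiv ℝ W).symm μ, fun s => ?_⟩
  rw [LinearMap.dualMap_apply, ← Module.Dual.eval_apply]
  exact (congrArg (fun l : Module.Dual ℝ (Module.Dual ℝ W) => l (ev s))
    ((Module.evalEquiv ℝ W).apply_symm_apply μ)).symm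

end FiniteDimensionalDuality

/-! ### Basic functions, and pointwise data recovered from functionals -/

section Basic

variable {E : Type*} [NormedAddCommGroup E] [NormedSpace ℝ E] [FiniteDimensional ℝ E]
  {M : Type*} [TopologicalSpace M] [T2Space M] [ChartedSpace E M] [IsManifold 𝓘(ℝ, E) ∞ M]
  {F : Type*} [NormedAddCommGroup F] [NormedSpace ℝ F] [FiniteDimensional ℝ F]
  {V : M → Type*} [TopologicalSpace (TotalSpace F V)]
  [∀ x, AddCommGroup (V x)] [∀ x, Module ℝ (V x)] [∀ x, TopologicalSpace (V x)]
  [∀ x, IsTopologicalAddGroup (V x)] [∀ x, ContinuousSMul ℝ (V x)]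
  [FiberBundle F V] [VectorBundle ℝ F V] [ContMDiffVectorBundle ∞ F V 𝓘(ℝ, E)]

theorem IsAffineFun.sub {f g : TotalSpace F V → ℝ} (hf : IsAffineFun 𝓘(ℝ, E) f)
    (hg : IsAffineFun 𝓘(ℝ, E) g) : IsAffineFun 𝓘(ℝ, E) fun v => f v - g v := by
  refine ⟨hf.1.sub hg.1, fun x => ?_⟩
  obtain ⟨φ, c, h⟩ := hf.2 x
  obtain ⟨ψ, d, h'⟩ := hg.2 x
  refine ⟨φ - ψ, c - d, fun w => ?_⟩
  change f ⟨x, w⟩ - g ⟨x, w⟩ = _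
  rw [h, h', LinearMap.sub_apply]
  ring

theorem IsAffineFun.base_mul {f : TotalSpace F V → ℝ} (h : C^∞⟮𝓘(ℝ, E), M; ℝ⟯)
    (hf : IsAffineFun 𝓘(ℝ, E) f) : IsAffineFun 𝓘(ℝ, E) fun v => h v.proj * f v := by
  refine ⟨(contMDiff_comp_proj h).mul hf.1, fun x => ?_⟩
  obtain ⟨φ, c, h'⟩ := hf.2 x
  refine ⟨h x • φ, h x * c, fun w => ?_⟩
  change h x * f ⟨x, w⟩ = _
  rw [h', LinearMap.smul_apply, smul_eq_mul]
  ring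

theorem isAffineFun_linFun (a : DualSection 𝓘(ℝ, E) F V) : IsAffineFun 𝓘(ℝ, E) (linFun a) :=
  ⟨contMDiff_linFun a, fun x => ⟨(a x : V x →L[ℝ] ℝ).toLinearMap, 0, fun _ => (add_zero _).symm⟩⟩

theorem isAffineFun_comp_proj (f : C^∞⟮𝓘(ℝ, E), M; ℝ⟯) :
    IsAffineFun 𝓘(ℝ, E) fun v : TotalSpace F V => f v.proj :=
  ⟨contMDiff_comp_proj f, fun x => ⟨0, f x, fun _ => (zero_add _).symm⟩⟩

theorem isAffineFun_one : IsAffineFun 𝓘(ℝ, E) fun _ : TotalSpace F V => (1 : ℝ) :=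
  isAffineFun_comp_proj (1 : C^∞⟮𝓘(ℝ, E), M; ℝ⟯)

/-- A function on the total space that is constant on fibres. -/
def IsBasicFun (h : TotalSpace F V → ℝ) : Prop := ∀ v, h v = h ⟨v.proj, 0⟩

/-- With φ the linear part of `h`, the function ι_a h has quadratic coefficient a(w)φ(w) along the
line through `w`. Affinity kills it, and `a` can be chosen with a(w) ≠ 0. -/
theorem isBasicFun_of_affine {h : TotalSpace F V → ℝ} (hh : IsAffineFun 𝓘(ℝ, E) h)
    (hm : ∀ a : DualSection 𝓘(ℝ, E) F V, IsAffineFun 𝓘(ℝ, E) fun v => linFun a v * h v) :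
    IsBasicFun h := by
  rintro ⟨x, w⟩
  obtain ⟨φ, c, h1⟩ := hh.2 x
  by_cases hw : w = 0
  · rw [hw]
  obtain ⟨a, ha⟩ := exists_dual_apply_ne_zero (E := E) (F := F) hw
  obtain ⟨ψ, d, h2⟩ := (hm a).2 x
  have e : ∀ t : ℝ, t * (a x w : ℝ) * (t * φ w + c) = t * ψ w + d := fun t => by
    have : linFun a (⟨x, t • w⟩ : TotalSpace F V) * h ⟨x, t • w⟩ = ψ (t • w) + d := h2 (t • w)
    rw [h1, map_smul, map_smul, smul_eq_mul, smul_eq_mul] at this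
    rw [← this]
    congr 1
    change t * _ = (a x (t • w) : ℝ)
    rw [map_smul]
    rfl
  -- The parameter values 1, -1 and 0 isolate the quadratic coefficient.
  have e1 := e 1
  have e2 := e (-1)
  have e0 := e 0
  have h3 : (a x w : ℝ) * φ w = 0 := by linarith
  have h4 : φ w = 0 := (mul_eq_zero.1 h3).resolve_left ha
  rw [h1, h1, h4, map_zero]

/-- ι_a h is zero on the zero section, so it is zero on the whole fibre once it is constant there; a
nonzero value of `a` is then cancelled. -/
theorem eq_zero_of_isBasicFun (hrank : 0 < Module.finrank ℝ F) {h : TotalSpace F V → ℝ}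
    (hh : IsBasicFun h)
    (hm : ∀ a : DualSection 𝓘(ℝ, E) F V, IsBasicFun fun v => linFun a v * h v)
    (v : TotalSpace F V) : h v = 0 := by
  obtain ⟨w, hw⟩ := exists_fiber_ne_zero (F := F) (V := V) hrank v.proj
  obtain ⟨a, ha⟩ := exists_dual_apply_ne_zero (E := E) (F := F) hw
  have h1 := hm a ⟨v.proj, w⟩
  have h2 : linFun a (⟨v.proj, 0⟩ : TotalSpace F V) = 0 := map_zero (a v.proj)
  simp only [h2, zero_mul] at h1
  have h3 := (mul_eq_zero.1 h1).resolve_left ha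
  rw [hh v, ← h3]
  exact (hh ⟨v.proj, w⟩).symm

theorem affFun_injective {a b : DualSection 𝓘(ℝ, E) F V} {f g : C^∞⟮𝓘(ℝ, E), M; ℝ⟯}
    (h : affFun a f = affFun b g) : a = b ∧ f = g := by
  have h1 : f = g := by
    ext x
    have := congrFun h ⟨x, 0⟩
    simp only [affFun, linFun] at this
    rw [map_zero, map_zero] at this
    simpa using this
  refine ⟨linFun_injective (funext fun v => ?_), h1⟩
  have := congrFun h v
  simp only [affFun, h1] at this
  linarith

theorem finiteDimensional_fiber (F : Type*) [NormedAddCommGroup F] [NormedSpace ℝ F]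
    [FiniteDimensional ℝ F] {V : M → Type*} [TopologicalSpace (TotalSpace F V)]
    [∀ x, AddCommGroup (V x)] [∀ x, Module ℝ (V x)] [∀ x, TopologicalSpace (V x)]
    [FiberBundle F V] [VectorBundle ℝ F V] (x : M) : FiniteDimensional ℝ (V x) :=
  ((trivializationAt F V x).continuousLinearEquivAt ℝ x
    (FiberBundle.mem_baseSet_trivializationAt' x)).symm.toLinearEquiv.finiteDimensional

/-- A linear functional on sections of the dual which only depends on the value at `x` is the
evaluation at a vector. -/
theorem exists_fiber_vector (x : M) (τ : DualSection 𝓘(ℝ, E) F V →ₗ[ℝ] ℝ)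
    (h : ∀ a, a x = 0 → τ a = 0) : ∃ w : V x, ∀ a, τ a = a x w := by
  have := finiteDimensional_fiber F (V := V) x
  let ev : DualSection 𝓘(ℝ, E) F V →ₗ[ℝ] Module.Dual ℝ (V x) :=
    { toFun := fun a => (a x : V x →L[ℝ] ℝ).toLinearMap
      map_add' := fun _ _ => rfl
      map_smul' := fun _ _ => rfl }
  obtain ⟨w, hw⟩ := exists_vector_of_functional ev τ fun a ha => h a (by
    ext w
    exact LinearMap.congr_fun ha w)
  exact ⟨w, hw⟩

theorem mvfderiv_smooth_surjective (x : M) (α : Cotangent 𝓘(ℝ, E) x) :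
    ∃ f : C^∞⟮𝓘(ℝ, E), M; ℝ⟯, mvfderiv 𝓘(ℝ, E) f x = α := by
  obtain ⟨Ψ, hΨ, hΨe⟩ := exists_chart_extension (E := E) x
  let β : E →L[ℝ] ℝ := α
  refine ⟨⟨fun y => β (Ψ y), (ContinuousLinearMap.contMDiff β).comp hΨ⟩, ?_⟩
  have h1 := mvfderiv_clm_comp (J := 𝓘(ℝ, E)) β
    ((hΨ x).mdifferentiableAt (by simp))
  rw [mvfderiv_congr hΨe] at h1
  refine h1.trans ?_
  ext w
  exact congrArg β (mvfderiv_extChartAt_self_apply x w)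

theorem tangent_eq_of_forall_mvfderiv {x : M} {u u' : TangentSpace 𝓘(ℝ, E) x}
    (h : ∀ f : C^∞⟮𝓘(ℝ, E), M; ℝ⟯, mvfderiv 𝓘(ℝ, E) f x u = mvfderiv 𝓘(ℝ, E) f x u') : u = u' := by
  have key : ∀ u u' : E, (∀ g : E →L[ℝ] ℝ, g u = g u') → u = u' := fun _ _ h =>
    (SeparatingDual.eq_iff_forall_dual_eq (R := ℝ)).2 h
  refine key u u' fun g => ?_
  obtain ⟨f, hf⟩ := mvfderiv_smooth_surjective (E := E) x g
  have := h f
  rw [hf] at this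
  exact this

/-- Evaluation of sections of the dual at a point. -/
def evalSection (x : M) : DualSection 𝓘(ℝ, E) F V →ₗ[ℝ] DualFiber V x where
  toFun a := a x
  map_add' _ _ := rfl
  map_smul' _ _ := rfl

/-- The differential at `x`, as a linear map on smooth functions. -/
def diffAt (x : M) : C^∞⟮𝓘(ℝ, E), M; ℝ⟯ →ₗ[ℝ] Module.Dual ℝ (TangentSpace 𝓘(ℝ, E) x) where
  toFun f := (mvfderiv 𝓘(ℝ, E) f x).toLinearMap
  map_add' f g := by
    have := mvfderiv_fun_add (contMDiff_real_mdiff f.contMDiff x) (contMDiff_real_mdiff g.contMDiff x)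
    exact congrArg ContinuousLinearMap.toLinearMap this
  map_smul' r f := by
    have := mvfderiv_fun_mul (mdifferentiableAt_const (c := r))
      (contMDiff_real_mdiff f.contMDiff x)
    rw [mvfderiv_const, smul_zero, add_zero] at this
    exact congrArg ContinuousLinearMap.toLinearMap this

/-- A bilinear pairing of sections of the dual and smooth functions which at `x` only depends on
the value of the section and the differential of the function is given by a linear map. -/
theorem exists_anchor_at (x : M)
    (R : DualSection 𝓘(ℝ, E) F V →ₗ[ℝ] C^∞⟮𝓘(ℝ, E), M; ℝ⟯ →ₗ[ℝ] ℝ)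
    (h1 : ∀ a f, a x = 0 → R a f = 0)
    (h2 : ∀ a (f : C^∞⟮𝓘(ℝ, E), M; ℝ⟯), mvfderiv 𝓘(ℝ, E) f x = 0 → R a f = 0) :
    ∃ ρ : DualFiber V x →L[ℝ] TangentSpace 𝓘(ℝ, E) x, ∀ a (f : C^∞⟮𝓘(ℝ, E), M; ℝ⟯),
      R a f = mvfderiv 𝓘(ℝ, E) f x (ρ (a x)) := by
  have : FiniteDimensional ℝ (TangentSpace 𝓘(ℝ, E) x) := inferInstanceAs (FiniteDimensional ℝ E)
  have h3 := fun a => exists_vector_of_functional (diffAt x) (R a) fun f hf => h2 a f (by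
    ext w
    exact LinearMap.congr_fun hf w)
  choose u hu using h3
  have hu' : ∀ a (f : C^∞⟮𝓘(ℝ, E), M; ℝ⟯), mvfderiv 𝓘(ℝ, E) f x (u a) = R a f :=
    fun a f => (hu a f).symm
  -- Dual vectors at `x` are extended linearly to global sections; by `h1` the extension chosen does
  -- not matter.
  obtain ⟨σ, hσ⟩ := (evalSection (E := E) (F := F) (V := V) x).exists_rightInverse_of_surjective
    (LinearMap.range_eq_top.2 fun c => exists_dualSection_apply_eq x c)
  have hσ' : ∀ c, σ c x = c := fun c => LinearMap.congr_fun hσ c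
  let ul : DualSection 𝓘(ℝ, E) F V →ₗ[ℝ] TangentSpace 𝓘(ℝ, E) x :=
    { toFun := u
      map_add' := fun a b => tangent_eq_of_forall_mvfderiv fun f => by
        rw [map_add, hu', hu', hu', map_add, LinearMap.add_apply]
      map_smul' := fun r a => tangent_eq_of_forall_mvfderiv fun f => by
        rw [map_smul, hu', hu', map_smul]
        rfl }
  let e := trivializationAt (F →L[ℝ] ℝ) (DualFiber V) x
  have he : x ∈ e.baseSet := FiberBundle.mem_baseSet_trivializationAt' x
  let lin : (F →L[ℝ] ℝ) →ₗ[ℝ] E := (ul.comp σ).comp (e.symmL ℝ x).toLinearMap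
  refine ⟨(lin.toContinuousLinearMap : (F →L[ℝ] ℝ) →L[ℝ] E).comp (e.continuousLinearMapAt ℝ x),
    fun a f => ?_⟩
  have e1 : lin (e.continuousLinearMapAt ℝ x (a x)) = u (σ (a x)) :=
    congrArg (fun c => u (σ c)) (e.symmL_continuousLinearMapAt (R := ℝ) he (a x))
  have e2 : R (σ (a x)) f = R a f := by
    have := h1 (σ (a x) - a) f (by
      rw [ContMDiffSection.coe_sub, Pi.sub_apply, hσ', sub_self])
    rw [map_sub, LinearMap.sub_apply] at this
    linarith
  rw [← e2, ← hu']
  exact congrArg _ e1.symm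

/-- A family of linear maps from the dual fibres to tangent spaces is smooth if it maps sections
and functions to smooth functions. -/
theorem contMDiff_anchor {ρ : ∀ x : M, DualFiber V x →L[ℝ] TangentSpace 𝓘(ℝ, E) x}
    (h : ∀ (a : DualSection 𝓘(ℝ, E) F V) (f : M → ℝ), ContMDiff 𝓘(ℝ, E) 𝓘(ℝ, ℝ) ∞ f →
      ContMDiff 𝓘(ℝ, E) 𝓘(ℝ, ℝ) ∞ fun x => mvfderiv 𝓘(ℝ, E) f x (ρ x (a x))) :
    ContMDiff 𝓘(ℝ, E) (𝓘(ℝ, E).prod 𝓘(ℝ, (F →L[ℝ] ℝ) →L[ℝ] E)) ∞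
      fun x => TotalSpace.mk' ((F →L[ℝ] ℝ) →L[ℝ] E)
        (E := fun x : M => DualFiber V x →L[ℝ] TangentSpace 𝓘(ℝ, E) x) x (ρ x) := by
  intro x₀
  refine contMDiffAt_hom_of_apply fun c => ?_
  have hb := (trivializationAt F V x₀).open_baseSet.mem_nhds
      (FiberBundle.mem_baseSet_trivializationAt' x₀)
  have hb' := (trivializationAt (F →L[ℝ] ℝ) (DualFiber V) x₀).open_baseSet.mem_nhds
      (FiberBundle.mem_baseSet_trivializationAt' x₀)
  obtain ⟨χ, hχ, h1⟩ := exists_cutoff (E := E) x₀ hb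
  have hs := contMDiff_vectorField_of_act (J := 𝓘(ℝ, E)) (h (dualFrame x₀ χ hχ c))
    exists_chart_extension
  refine (hs x₀).congr_of_eventuallyEq ?_
  filter_upwards [hb, hb', h1] with x hx hx' hx1
  -- Near `x₀` the frame section is constantly `c` in the dual trivialization, so its image under
  -- `ρ` is a column of `ρ`.
  have h2 : (trivializationAt (F →L[ℝ] ℝ) (DualFiber V) x₀ ⟨x, dualFrame x₀ χ hχ c x⟩).2 = c := by
    rw [hom_trivializationAt_apply]
    ext z
    simp only [ContinuousLinearMap.inCoordinates, ContinuousLinearMap.comp_apply]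
    refine (congrArg (fun l : ℝ →L[ℝ] ℝ => l _)
      (Bundle.Trivial.continuousLinearMapAt_trivialization ℝ M ℝ x)).trans ?_
    change dualFrame x₀ χ hχ c x _ = c z
    rw [dualFrame_apply, Trivialization.continuousLinearMapAt_symmL _ hx,
      show χ x = 1 from hx1, one_mul]
  have h3 := (trivializationAt (F →L[ℝ] ℝ) (DualFiber V) x₀).symm_apply_apply_mk hx'
    (dualFrame x₀ χ hχ c x)
  rw [h2] at h3
  rw [h3]

end Basic

/-! ### Consequences of strong affinity -/

section Inverse

variable {E : Type*} [NormedAddCommGroup E] [NormedSpace ℝ E] [FiniteDimensional ℝ E]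
  {M : Type*} [TopologicalSpace M] [T2Space M] [ChartedSpace E M] [IsManifold 𝓘(ℝ, E) ∞ M]
  {F : Type*} [NormedAddCommGroup F] [NormedSpace ℝ F] [FiniteDimensional ℝ F]
  {V : M → Type*} [TopologicalSpace (TotalSpace F V)]
  [∀ x, AddCommGroup (V x)] [∀ x, Module ℝ (V x)] [∀ x, TopologicalSpace (V x)]
  [∀ x, IsTopologicalAddGroup (V x)] [∀ x, ContinuousSMul ℝ (V x)]
  [FiberBundle F V] [VectorBundle ℝ F V] [ContMDiffVectorBundle ∞ F V 𝓘(ℝ, E)]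

/-- The pullback of a function on the base to the total space. -/
def basicFun (f : C^∞⟮𝓘(ℝ, E), M; ℝ⟯) : TotalSpace F V → ℝ := fun v => f v.proj

theorem contMDiff_basicFun (f : C^∞⟮𝓘(ℝ, E), M; ℝ⟯) :
    ContMDiff (𝓘(ℝ, E).prod 𝓘(ℝ, F)) 𝓘(ℝ, ℝ) ∞ (basicFun (F := F) (V := V) f) :=
  contMDiff_comp_proj f

theorem isAffineFun_basicFun (f : C^∞⟮𝓘(ℝ, E), M; ℝ⟯) :
    IsAffineFun 𝓘(ℝ, E) (basicFun (F := F) (V := V) f) :=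
  isAffineFun_comp_proj f

theorem linFun_smulSection (f : C^∞⟮𝓘(ℝ, E), M; ℝ⟯) (a : DualSection 𝓘(ℝ, E) F V) :
    linFun (smulSection f a) = fun v => basicFun f v * linFun a v := rfl

theorem mvfderiv_basicFun_eq_zero {f : C^∞⟮𝓘(ℝ, E), M; ℝ⟯} {v : TotalSpace F V}
    (h : mvfderiv 𝓘(ℝ, E) f v.proj = 0) :
    mvfderiv (𝓘(ℝ, E).prod 𝓘(ℝ, F)) (basicFun f) v = 0 := by
  ext u
  have h1 := mvfderiv_comp_apply_of_eq (I := 𝓘(ℝ, E)) (I' := 𝓘(ℝ, E).prod 𝓘(ℝ, F)) v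
    (contMDiff_real_mdiff f.contMDiff v.proj)
    ((contMDiff_proj V (IB := 𝓘(ℝ, E)) (F := F) (n := ∞) v).mdifferentiableAt (by simp)) rfl u
  rw [h] at h1
  exact h1

/-- The restriction of a smooth function to the zero section. -/
def zeroRestrict {h : TotalSpace F V → ℝ}
    (hh : ContMDiff (𝓘(ℝ, E).prod 𝓘(ℝ, F)) 𝓘(ℝ, ℝ) ∞ h) : C^∞⟮𝓘(ℝ, E), M; ℝ⟯ :=
  ⟨fun x => h ⟨x, 0⟩, hh.comp (contMDiff_zeroSection ℝ V)⟩

theorem affFun_eq_add (a : DualSection 𝓘(ℝ, E) F V) (f : C^∞⟮𝓘(ℝ, E), M; ℝ⟯) :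
    affFun a f = fun v => linFun a v + basicFun f v := rfl

theorem BivectorField.onFun_affFun
    (B : BivectorField (𝓘(ℝ, E).prod 𝓘(ℝ, F)) (TotalSpace F V)) (a b : DualSection 𝓘(ℝ, E) F V)
    (f g : C^∞⟮𝓘(ℝ, E), M; ℝ⟯) (v : TotalSpace F V) :
    B.onFun (affFun a f) (affFun b g) v = B.onFun (linFun a) (linFun b) v
      + (B.onFun (linFun a) (basicFun g) v - B.onFun (linFun b) (basicFun f) v)
      + B.onFun (basicFun f) (basicFun g) v := by
  rw [affFun_eq_add b, B.onFun_add _ (contMDiff_linFun b) (contMDiff_basicFun g), affFun_eq_add,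
    B.add_onFun _ (contMDiff_linFun a) (contMDiff_basicFun f),
    B.add_onFun _ (contMDiff_linFun a) (contMDiff_basicFun f), B.onFun_skew (basicFun f) (linFun b)]
  ring

namespace StronglyAffineJacobi

variable (S : StronglyAffineJacobi 𝓘(ℝ, E) F V)

/-- E is the hamiltonian vector field of the constant 1, which is affine. -/
theorem isAffineFun_act {φ : TotalSpace F V → ℝ} (hφ : IsAffineFun 𝓘(ℝ, E) φ) :
    IsAffineFun 𝓘(ℝ, E) (S.E.act φ) := by
  have h := S.hamiltonian_affine _ φ isAffineFun_one hφ
  have e : S.hamiltonianAct (fun _ => 1) φ = S.E.act φ := funext fun v => by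
    simp only [JacobiStructure.hamiltonianAct, S.Λ.const_onFun, one_mul, zero_add]
  rwa [e] at h

/-- The function is X_φ(ψ) - {φ, ψ}. This is where the two halves of strong affinity work together.
-/
theorem isAffineFun_mul_act {φ ψ : TotalSpace F V → ℝ} (hφ : IsAffineFun 𝓘(ℝ, E) φ)
    (hψ : IsAffineFun 𝓘(ℝ, E) ψ) : IsAffineFun 𝓘(ℝ, E) fun v => ψ v * S.E.act φ v := by
  have h := (S.hamiltonian_affine φ ψ hφ hψ).sub (S.affine φ ψ hφ hψ)
  have e : (fun v => S.hamiltonianAct φ ψ v - S.bracket φ ψ v) = fun v => ψ v * S.E.act φ v :=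
    funext fun v => by
      simp only [JacobiStructure.hamiltonianAct, JacobiStructure.bracket]
      ring
  rwa [e] at h

theorem isBasicFun_act {φ : TotalSpace F V → ℝ} (hφ : IsAffineFun 𝓘(ℝ, E) φ) :
    IsBasicFun (S.E.act φ) :=
  isBasicFun_of_affine (S.isAffineFun_act hφ) fun a =>
    S.isAffineFun_mul_act hφ (isAffineFun_linFun a)

/-- The derivation rule gives ι_a E(f∘π) = E(ι_{fa}) - (f∘π) E(ι_a), and the right side is constant
on fibres. -/
theorem act_basicFun (hrank : 0 < Module.finrank ℝ F) (f : C^∞⟮𝓘(ℝ, E), M; ℝ⟯)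
    (v : TotalSpace F V) : S.E.act (basicFun f) v = 0 := by
  refine eq_zero_of_isBasicFun (E := E) hrank (S.isBasicFun_act (isAffineFun_basicFun f)) (fun a => ?_) v
  have e : ∀ v, linFun a v * S.E.act (basicFun f) v =
      S.E.act (linFun (smulSection f a)) v - f v.proj * S.E.act (linFun a) v := fun v => by
    rw [linFun_smulSection, S.E.act_mul (contMDiff_basicFun f) (contMDiff_linFun a)]
    simp only [basicFun]
    ring
  intro v
  simp only [e]
  rw [S.isBasicFun_act (isAffineFun_linFun _) v, S.isBasicFun_act (isAffineFun_linFun a) v]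

theorem isAffineFun_onFun {φ ψ : TotalSpace F V → ℝ} (hφ : IsAffineFun 𝓘(ℝ, E) φ)
    (hψ : IsAffineFun 𝓘(ℝ, E) ψ) : IsAffineFun 𝓘(ℝ, E) (S.Λ.onFun φ ψ) := by
  have h := (S.hamiltonian_affine φ ψ hφ hψ).sub (S.isAffineFun_mul_act hψ hφ)
  have e : (fun v => S.hamiltonianAct φ ψ v - φ v * S.E.act ψ v) = S.Λ.onFun φ ψ :=
    funext fun v => by
      simp only [JacobiStructure.hamiltonianAct]
      ring
  rwa [e] at h

/-- Shows that multiplication by ι_a does not raise the fibre degree here, which is what forces the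
second factor to be basic or zero. -/
theorem linFun_mul_onFun (φ : TotalSpace F V → ℝ) (a : DualSection 𝓘(ℝ, E) F V)
    (f : C^∞⟮𝓘(ℝ, E), M; ℝ⟯) (v : TotalSpace F V) :
    linFun a v * S.Λ.onFun φ (basicFun f) v =
      S.Λ.onFun φ (linFun (smulSection f a)) v - f v.proj * S.Λ.onFun φ (linFun a) v := by
  rw [linFun_smulSection, S.Λ.onFun_mul φ (contMDiff_basicFun f) (contMDiff_linFun a)]
  simp only [basicFun]
  ring

theorem isBasicFun_onFun_basicFun {φ : TotalSpace F V → ℝ} (hφ : IsAffineFun 𝓘(ℝ, E) φ)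
    (f : C^∞⟮𝓘(ℝ, E), M; ℝ⟯) : IsBasicFun (S.Λ.onFun φ (basicFun f)) :=
  isBasicFun_of_affine (S.isAffineFun_onFun hφ (isAffineFun_basicFun f)) fun a => by
    simp only [linFun_mul_onFun]
    exact (S.isAffineFun_onFun hφ (isAffineFun_linFun _)).sub
      ((S.isAffineFun_onFun hφ (isAffineFun_linFun a)).base_mul f)

/-- Multiplication by ι_a leads to values of Λ on a linear and a basic function, already known to be
constant on fibres. -/
theorem onFun_basicFun (hrank : 0 < Module.finrank ℝ F) (g f : C^∞⟮𝓘(ℝ, E), M; ℝ⟯)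
    (v : TotalSpace F V) : S.Λ.onFun (basicFun g) (basicFun f) v = 0 := by
  refine eq_zero_of_isBasicFun (E := E) hrank (S.isBasicFun_onFun_basicFun (isAffineFun_basicFun g) f)
    (fun a v => ?_) v
  simp only [linFun_mul_onFun, S.Λ.onFun_skew (basicFun g) (linFun _)]
  rw [S.isBasicFun_onFun_basicFun (isAffineFun_linFun _) g v,
    S.isBasicFun_onFun_basicFun (isAffineFun_linFun a) g v]

theorem exists_bracket_linFun (a b : DualSection 𝓘(ℝ, E) F V) :
    ∃ p : DualSection 𝓘(ℝ, E) F V × C^∞⟮𝓘(ℝ, E), M; ℝ⟯,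
      affFun p.1 p.2 = S.bracket (linFun a) (linFun b) := by
  obtain ⟨c, f, h⟩ :=
    exists_affFun_eq (S.affine _ _ (isAffineFun_linFun a) (isAffineFun_linFun b))
  exact ⟨(c, f), h⟩

/-- The linear part of the bracket of two linear functions. -/
def linPart (a b : DualSection 𝓘(ℝ, E) F V) : DualSection 𝓘(ℝ, E) F V :=
  (S.exists_bracket_linFun a b).choose.1

/-- The basic part of the bracket of two linear functions. -/
def constPart (a b : DualSection 𝓘(ℝ, E) F V) : C^∞⟮𝓘(ℝ, E), M; ℝ⟯ :=
  (S.exists_bracket_linFun a b).choose.2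

theorem affFun_linPart (a b : DualSection 𝓘(ℝ, E) F V) :
    affFun (S.linPart a b) (S.constPart a b) = S.bracket (linFun a) (linFun b) :=
  (S.exists_bracket_linFun a b).choose_spec

/-- The basic function `-E(ι_a)`. -/
def actPart (a : DualSection 𝓘(ℝ, E) F V) : C^∞⟮𝓘(ℝ, E), M; ℝ⟯ :=
  -zeroRestrict (S.E.contMDiff_act (contMDiff_linFun a))

/-- The basic function `Λ(ι_a, f)`. -/
def anchorPart (a : DualSection 𝓘(ℝ, E) F V) (f : C^∞⟮𝓘(ℝ, E), M; ℝ⟯) :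
    C^∞⟮𝓘(ℝ, E), M; ℝ⟯ :=
  zeroRestrict (S.Λ.contMDiff_onFun (contMDiff_linFun a) (contMDiff_basicFun f))

theorem act_linFun (a : DualSection 𝓘(ℝ, E) F V) (v : TotalSpace F V) :
    S.E.act (linFun a) v = -S.actPart a v.proj := by
  rw [S.isBasicFun_act (isAffineFun_linFun a) v]
  exact (neg_neg _).symm

theorem onFun_linFun_basicFun (a : DualSection 𝓘(ℝ, E) F V) (f : C^∞⟮𝓘(ℝ, E), M; ℝ⟯)
    (v : TotalSpace F V) : S.Λ.onFun (linFun a) (basicFun f) v = S.anchorPart a f v.proj :=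
  S.isBasicFun_onFun_basicFun (isAffineFun_linFun a) f v

theorem onFun_linFun (a b : DualSection 𝓘(ℝ, E) F V) (v : TotalSpace F V) :
    S.Λ.onFun (linFun a) (linFun b) v = linFun (S.linPart a b) v + S.constPart a b v.proj
      + (linFun a v * S.actPart b v.proj - linFun b v * S.actPart a v.proj) := by
  have h := congrFun (S.affFun_linPart a b) v
  simp only [affFun, JacobiStructure.bracket, act_linFun] at h
  linarith

theorem onFun_affFun (hrank : 0 < Module.finrank ℝ F) (a b : DualSection 𝓘(ℝ, E) F V)
    (f g : C^∞⟮𝓘(ℝ, E), M; ℝ⟯) (v : TotalSpace F V) :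
    S.Λ.onFun (affFun a f) (affFun b g) v = linFun (S.linPart a b) v + S.constPart a b v.proj
      + (linFun a v * S.actPart b v.proj - linFun b v * S.actPart a v.proj)
      + (S.anchorPart a g v.proj - S.anchorPart b f v.proj) := by
  rw [S.Λ.onFun_affFun, S.onFun_basicFun hrank, onFun_linFun_basicFun, onFun_linFun_basicFun,
    onFun_linFun, add_zero]

theorem act_affFun (hrank : 0 < Module.finrank ℝ F) (a : DualSection 𝓘(ℝ, E) F V)
    (f : C^∞⟮𝓘(ℝ, E), M; ℝ⟯) (v : TotalSpace F V) :
    S.E.act (affFun a f) v = -S.actPart a v.proj := by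
  rw [affFun_eq_add, S.E.act_add (contMDiff_linFun a) (contMDiff_basicFun f),
    S.act_basicFun hrank, act_linFun, add_zero]

/-- The basic part of the bracket of two affine functions. -/
def bracketPart (p q : DualSection 𝓘(ℝ, E) F V × C^∞⟮𝓘(ℝ, E), M; ℝ⟯) : C^∞⟮𝓘(ℝ, E), M; ℝ⟯ :=
  S.constPart p.1 q.1 + S.anchorPart p.1 q.2 - S.anchorPart q.1 p.2
    + q.2 * S.actPart p.1 - p.2 * S.actPart q.1

theorem bracket_affFun (hrank : 0 < Module.finrank ℝ F)
    (p q : DualSection 𝓘(ℝ, E) F V × C^∞⟮𝓘(ℝ, E), M; ℝ⟯) :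
    S.bracket (affFun p.1 p.2) (affFun q.1 q.2) =
      affFun (S.linPart p.1 q.1) (S.bracketPart p q) := by
  funext v
  simp only [JacobiStructure.bracket, S.onFun_affFun hrank, S.act_affFun hrank]
  change _ = linFun (S.linPart p.1 q.1) v + (S.constPart p.1 q.1 v.proj
    + S.anchorPart p.1 q.2 v.proj - S.anchorPart q.1 p.2 v.proj
    + q.2 v.proj * S.actPart p.1 v.proj - p.2 v.proj * S.actPart q.1 v.proj)
  simp only [affFun]
  ring

/-- The Jacobi identity for three affine functions, split by uniqueness of the affine decomposition.
The first component is the Jacobi identity of the algebroid; the second contains the cocycle and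
twist conditions. -/
theorem linPart_jacobi_and (hrank : 0 < Module.finrank ℝ F)
    (p q r : DualSection 𝓘(ℝ, E) F V × C^∞⟮𝓘(ℝ, E), M; ℝ⟯) :
    S.linPart (S.linPart p.1 q.1) r.1 + S.linPart (S.linPart q.1 r.1) p.1
        + S.linPart (S.linPart r.1 p.1) q.1 = 0 ∧
      S.bracketPart (S.linPart p.1 q.1, S.bracketPart p q) r
        + S.bracketPart (S.linPart q.1 r.1, S.bracketPart q r) p
        + S.bracketPart (S.linPart r.1 p.1, S.bracketPart r p) q = 0 := by
  have e : ∀ p q r : DualSection 𝓘(ℝ, E) F V × C^∞⟮𝓘(ℝ, E), M; ℝ⟯,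
      S.bracket (S.bracket (affFun p.1 p.2) (affFun q.1 q.2)) (affFun r.1 r.2) =
      affFun (S.linPart (S.linPart p.1 q.1) r.1)
        (S.bracketPart (S.linPart p.1 q.1, S.bracketPart p q) r) := fun p q r => by
    rw [S.bracket_affFun hrank]
    exact S.bracket_affFun hrank (S.linPart p.1 q.1, S.bracketPart p q) r
  refine affFun_injective (funext fun v => ?_)
  have h := S.toJacobiStructure.bracket_jacobi (contMDiff_affFun p.1 p.2)
    (contMDiff_affFun q.1 q.2) (contMDiff_affFun r.1 r.2) v
  rw [e, e, e] at h
  rw [affFun_add, affFun_add]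
  exact h.trans (add_zero _).symm

end StronglyAffineJacobi

end Inverse

/-! ### The Jacobi algebroid of a strongly-affine Jacobi structure -/

section Reconstruction

variable {E : Type*} [NormedAddCommGroup E] [NormedSpace ℝ E] [FiniteDimensional ℝ E]
  {M : Type*} [TopologicalSpace M] [T2Space M] [ChartedSpace E M] [IsManifold 𝓘(ℝ, E) ∞ M]
  {F : Type*} [NormedAddCommGroup F] [NormedSpace ℝ F] [FiniteDimensional ℝ F]
  {V : M → Type*} [TopologicalSpace (TotalSpace F V)]
  [∀ x, AddCommGroup (V x)] [∀ x, Module ℝ (V x)] [∀ x, TopologicalSpace (V x)]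
  [∀ x, IsTopologicalAddGroup (V x)] [∀ x, ContinuousSMul ℝ (V x)]
  [FiberBundle F V] [VectorBundle ℝ F V] [ContMDiffVectorBundle ∞ F V 𝓘(ℝ, E)]

namespace StronglyAffineJacobi

variable (S : StronglyAffineJacobi 𝓘(ℝ, E) F V)

theorem affFun_linPart_apply (a b : DualSection 𝓘(ℝ, E) F V) (v : TotalSpace F V) :
    affFun (S.linPart a b) (S.constPart a b) v = S.Λ.onFun (linFun a) (linFun b) v
      - linFun a v * S.actPart b v.proj + linFun b v * S.actPart a v.proj := by
  rw [onFun_linFun, affFun]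
  ring

theorem actPart_apply (a : DualSection 𝓘(ℝ, E) F V) (x : M) :
    S.actPart a x = -S.E.act (linFun a) ⟨x, 0⟩ := by
  rw [act_linFun, neg_neg]

theorem anchorPart_apply (a : DualSection 𝓘(ℝ, E) F V) (f : C^∞⟮𝓘(ℝ, E), M; ℝ⟯) (x : M) :
    S.anchorPart a f x = S.Λ.onFun (linFun a) (basicFun f) ⟨x, 0⟩ := by
  rw [onFun_linFun_basicFun]

theorem linFun_add (a b : DualSection 𝓘(ℝ, E) F V) :
    linFun (a + b) = fun v => linFun a v + linFun b v := rfl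

theorem actPart_add (a b : DualSection 𝓘(ℝ, E) F V) :
    S.actPart (a + b) = S.actPart a + S.actPart b := by
  ext x
  change _ = S.actPart a x + S.actPart b x
  simp only [actPart_apply, linFun_add]
  rw [S.E.act_add (contMDiff_linFun a) (contMDiff_linFun b)]
  ring

theorem actPart_smulSection (hrank : 0 < Module.finrank ℝ F) (f : C^∞⟮𝓘(ℝ, E), M; ℝ⟯)
    (a : DualSection 𝓘(ℝ, E) F V) : S.actPart (smulSection f a) = f * S.actPart a := by
  ext x
  change _ = f x * S.actPart a x
  simp only [actPart_apply, linFun_smulSection]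
  rw [S.E.act_mul (contMDiff_basicFun f) (contMDiff_linFun a), S.act_basicFun hrank]
  simp only [basicFun]
  ring

/-- Only the sum of the linear and basic parts has a formula, so both are treated at once and
separated by `affFun_injective`. Skew-symmetry and the Leibniz rule use the same device. -/
theorem linPart_add_and (a b c : DualSection 𝓘(ℝ, E) F V) :
    S.linPart a (b + c) = S.linPart a b + S.linPart a c ∧
      S.constPart a (b + c) = S.constPart a b + S.constPart a c := by
  refine affFun_injective (funext fun v => ?_)
  rw [affFun_add]
  simp only [affFun_linPart_apply, linFun_add, actPart_add]
  rw [S.Λ.onFun_add _ (contMDiff_linFun b) (contMDiff_linFun c)]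
  change _ - _ * (S.actPart b v.proj + S.actPart c v.proj) + _ = _
  ring

theorem linPart_skew_and (a b : DualSection 𝓘(ℝ, E) F V) :
    S.linPart a b = -S.linPart b a ∧ S.constPart a b = -S.constPart b a := by
  refine affFun_injective (funext fun v => ?_)
  have h : affFun (-S.linPart b a) (-S.constPart b a) v =
      -affFun (S.linPart b a) (S.constPart b a) v := by
    change -linFun (S.linPart b a) v + -S.constPart b a v.proj = -(_ + _)
    ring
  rw [h, affFun_linPart_apply, affFun_linPart_apply, S.Λ.onFun_skew]
  ring

/-- Multiplying ι_b by f∘π adds the single new term ι_b Λ(dι_a, d(f∘π)). It is linear on fibres, so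
it becomes the anchor term and leaves the basic part function-linear. -/
theorem linPart_smulSection_and (hrank : 0 < Module.finrank ℝ F) (a : DualSection 𝓘(ℝ, E) F V)
    (f : C^∞⟮𝓘(ℝ, E), M; ℝ⟯) (b : DualSection 𝓘(ℝ, E) F V) :
    S.linPart a (smulSection f b) =
        smulSection f (S.linPart a b) + smulSection (S.anchorPart a f) b ∧
      S.constPart a (smulSection f b) = f * S.constPart a b := by
  refine affFun_injective (funext fun v => ?_)
  have h : affFun (smulSection f (S.linPart a b) + smulSection (S.anchorPart a f) b)
      (f * S.constPart a b) v = f v.proj * affFun (S.linPart a b) (S.constPart a b) v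
        + S.anchorPart a f v.proj * linFun b v := by
    change f v.proj * linFun (S.linPart a b) v + S.anchorPart a f v.proj * linFun b v
      + f v.proj * S.constPart a b v.proj = f v.proj * (_ + _) + _
    ring
  rw [h, affFun_linPart_apply, affFun_linPart_apply, S.actPart_smulSection hrank,
    linFun_smulSection, S.Λ.onFun_mul _ (contMDiff_basicFun f) (contMDiff_linFun b),
    onFun_linFun_basicFun]
  change _ - _ * (f v.proj * S.actPart b v.proj) + f v.proj * linFun b v * _ = _
  simp only [basicFun]
  ring

theorem basicFun_add (f g : C^∞⟮𝓘(ℝ, E), M; ℝ⟯) :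
    basicFun (F := F) (V := V) (f + g) = fun v => basicFun f v + basicFun g v := rfl

theorem basicFun_const (r : ℝ) :
    basicFun (F := F) (V := V) (ContMDiffMap.const r : C^∞⟮𝓘(ℝ, E), M; ℝ⟯) = fun _ => r := rfl

theorem anchorPart_const (a : DualSection 𝓘(ℝ, E) F V) (r : ℝ) :
    S.anchorPart a (ContMDiffMap.const r) = 0 := by
  ext x
  rw [anchorPart_apply, basicFun_const, S.Λ.onFun_const]
  rfl

theorem smulSection_const (r : ℝ) (a : DualSection 𝓘(ℝ, E) F V) :
    smulSection (ContMDiffMap.const r) a = r • a := rfl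

theorem linPart_smul (hrank : 0 < Module.finrank ℝ F) (r : ℝ) (a b : DualSection 𝓘(ℝ, E) F V) :
    S.linPart a (r • b) = r • S.linPart a b := by
  have h := (S.linPart_smulSection_and hrank a (ContMDiffMap.const r) b).1
  rw [anchorPart_const, smulSection_const, smulSection_const] at h
  rw [h]
  ext x w
  change (r * S.linPart a b x w + 0 * b x w : ℝ) = r * S.linPart a b x w
  ring

/-- By `exists_linearization` dι_a is at `v` the differential of a basic function, and Λ vanishes on
two basic functions. -/
theorem onFun_linFun_eq_zero (hrank : 0 < Module.finrank ℝ F) {a : DualSection 𝓘(ℝ, E) F V}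
    {v : TotalSpace F V} (h : a v.proj = 0) (f : C^∞⟮𝓘(ℝ, E), M; ℝ⟯) :
    S.Λ.onFun (linFun a) (basicFun f) v = 0 := by
  obtain ⟨G, hG, -⟩ := exists_linearization h
  have h1 := S.onFun_basicFun hrank G f v
  simp only [BivectorField.onFun] at h1 ⊢
  rw [hG]
  exact h1

theorem act_linFun_eq_zero (hrank : 0 < Module.finrank ℝ F) {a : DualSection 𝓘(ℝ, E) F V}
    {v : TotalSpace F V} (h : a v.proj = 0) : S.E.act (linFun a) v = 0 := by
  obtain ⟨G, hG, -⟩ := exists_linearization h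
  have h1 := S.act_basicFun hrank G v
  simp only [VectorField.act] at h1 ⊢
  rw [hG]
  exact h1

theorem exists_section (hrank : 0 < Module.finrank ℝ F) :
    ∃ X : Cₛ^∞⟮𝓘(ℝ, E); F, V⟯, ∀ a x, S.actPart a x = pairing X a x := by
  have h : ∀ x : M, ∃ w : V x, ∀ a : DualSection 𝓘(ℝ, E) F V, S.actPart a x = a x w := fun x => by
    refine exists_fiber_vector x
      { toFun := fun a => S.actPart a x
        map_add' := fun a b => by rw [actPart_add]; rfl
        map_smul' := fun r a => by
          rw [← smulSection_const, S.actPart_smulSection hrank]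
          rfl } fun a ha => ?_
    change S.actPart a x = 0
    rw [actPart_apply, S.act_linFun_eq_zero hrank (v := ⟨x, 0⟩) ha, neg_zero]
  choose X hX using h
  refine ⟨⟨X, contMDiff_section_of_pairing fun a => ?_⟩, fun a x => hX x a⟩
  simp only [← hX]
  exact (S.actPart a).contMDiff

theorem exists_anchor (hrank : 0 < Module.finrank ℝ F) :
    ∃ ρ : Cₛ^∞⟮𝓘(ℝ, E); (F →L[ℝ] ℝ) →L[ℝ] E,
        fun x : M => DualFiber V x →L[ℝ] TangentSpace 𝓘(ℝ, E) x⟯,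
      ∀ a (f : C^∞⟮𝓘(ℝ, E), M; ℝ⟯) x,
        S.anchorPart a f x = mvfderiv 𝓘(ℝ, E) f x (ρ x (a x)) := by
  have h : ∀ x : M, ∃ ρ : DualFiber V x →L[ℝ] TangentSpace 𝓘(ℝ, E) x,
      ∀ (a : DualSection 𝓘(ℝ, E) F V) (f : C^∞⟮𝓘(ℝ, E), M; ℝ⟯),
        S.anchorPart a f x = mvfderiv 𝓘(ℝ, E) f x (ρ (a x)) := fun x => by
    refine exists_anchor_at x (LinearMap.mk₂ ℝ (fun a f => S.anchorPart a f x) ?_ ?_ ?_ ?_) ?_ ?_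
    · intro a b f
      simp only [anchorPart_apply, linFun_add]
      exact S.Λ.add_onFun _ (contMDiff_linFun a) (contMDiff_linFun b) _
    · intro r a f
      simp only [anchorPart_apply]
      rw [← smulSection_const, linFun_smulSection, basicFun_const,
        S.Λ.mul_onFun _ contMDiff_const (contMDiff_linFun a), S.Λ.const_onFun, mul_zero, add_zero]
      rfl
    · intro a f g
      simp only [anchorPart_apply, basicFun_add]
      exact S.Λ.onFun_add _ (contMDiff_basicFun f) (contMDiff_basicFun g) _
    · intro r a f
      simp only [anchorPart_apply]
      have e : basicFun (F := F) (V := V) (r • f) = fun v => (fun _ => r) v * basicFun f v := rfl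
      rw [e, S.Λ.onFun_mul _ contMDiff_const (contMDiff_basicFun f), S.Λ.onFun_const, mul_zero,
        add_zero]
      rfl
    · intro a f ha
      change S.anchorPart a f x = 0
      rw [anchorPart_apply, S.onFun_linFun_eq_zero hrank (v := ⟨x, 0⟩) ha]
    · intro a f hf
      change S.anchorPart a f x = 0
      rw [anchorPart_apply, BivectorField.onFun,
        mvfderiv_basicFun_eq_zero (v := (⟨x, 0⟩ : TotalSpace F V)) hf, map_zero]
  choose ρ hρ using h
  refine ⟨⟨ρ, contMDiff_anchor fun a f hf => ?_⟩, fun a f x => hρ x a f⟩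
  have e : (fun x => mvfderiv 𝓘(ℝ, E) f x (ρ x (a x))) = S.anchorPart a ⟨f, hf⟩ :=
    funext fun x => (hρ x a ⟨f, hf⟩).symm
  rw [e]
  exact (S.anchorPart a ⟨f, hf⟩).contMDiff

/-- The Lie algebroid of a strongly-affine Jacobi structure. -/
def lieAlgebroid (hrank : 0 < Module.finrank ℝ F) :
    LieAlgebroid 𝓘(ℝ, E) (F →L[ℝ] ℝ) (DualFiber V) where
  bracket := S.linPart
  anchor := (S.exists_anchor hrank).choose
  bracket_add a b c := (S.linPart_add_and a b c).1
  bracket_smul r a b := S.linPart_smul hrank r a b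
  bracket_skew a b := (S.linPart_skew_and a b).1
  jacobi a b c := (S.linPart_jacobi_and hrank (a, 0) (b, 0) (c, 0)).1
  leibniz a f b x := by
    rw [(S.linPart_smulSection_and hrank a f b).1, ← (S.exists_anchor hrank).choose_spec a f x]
    rfl

theorem lieAlgebroid_rho (hrank : 0 < Module.finrank ℝ F) (a : DualSection 𝓘(ℝ, E) F V)
    (f : C^∞⟮𝓘(ℝ, E), M; ℝ⟯) (x : M) : (S.lieAlgebroid hrank).rho a f x = S.anchorPart a f x :=
  ((S.exists_anchor hrank).choose_spec a f x).symm

/-- The skew bilinear map of a strongly-affine Jacobi structure. -/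
def skewBilinear (hrank : 0 < Module.finrank ℝ F) :
    SkewBilinear 𝓘(ℝ, E) (F →L[ℝ] ℝ) (DualFiber V) where
  -- The sign matches the term -P₀(a, b) in the bracket of affine functions.
  toFun a b := -S.constPart a b
  skew a b := by rw [(S.linPart_skew_and a b).2]
  map_add a b c := by rw [(S.linPart_add_and a b c).2, neg_add]
  map_smul a f b := by rw [(S.linPart_smulSection_and hrank a f b).2, mul_neg]

/-- The section of a strongly-affine Jacobi structure. -/
def vectorPart (hrank : 0 < Module.finrank ℝ F) : Cₛ^∞⟮𝓘(ℝ, E); F, V⟯ :=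
  (S.exists_section hrank).choose

theorem pairing_vectorPart (hrank : 0 < Module.finrank ℝ F) (a : DualSection 𝓘(ℝ, E) F V) :
    pairing (S.vectorPart hrank) a = S.actPart a :=
  funext fun x => ((S.exists_section hrank).choose_spec a x).symm

theorem linPart_zero (a : DualSection 𝓘(ℝ, E) F V) : S.linPart a 0 = 0 ∧ S.constPart a 0 = 0 := by
  have h := S.linPart_add_and a 0 0
  rw [add_zero] at h
  exact ⟨left_eq_add.1 h.1, left_eq_add.1 h.2⟩

theorem bracketPart_apply (p q : DualSection 𝓘(ℝ, E) F V × C^∞⟮𝓘(ℝ, E), M; ℝ⟯) (x : M) :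
    S.bracketPart p q x = S.constPart p.1 q.1 x + S.anchorPart p.1 q.2 x - S.anchorPart q.1 p.2 x
    + q.2 x * S.actPart p.1 x - p.2 x * S.actPart q.1 x := rfl

theorem zero_linPart (a : DualSection 𝓘(ℝ, E) F V) : S.linPart 0 a = 0 ∧ S.constPart 0 a = 0 := by
  rw [(S.linPart_skew_and 0 a).1, (S.linPart_skew_and 0 a).2, (S.linPart_zero a).1,
    (S.linPart_zero a).2, neg_zero, neg_zero]
  exact ⟨rfl, rfl⟩

theorem actPart_zero : S.actPart 0 = 0 := by
  have h := S.actPart_add 0 0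
  rw [add_zero] at h
  exact left_eq_add.1 h

theorem anchorPart_zero_left (f : C^∞⟮𝓘(ℝ, E), M; ℝ⟯) : S.anchorPart 0 f = 0 := by
  ext x
  rw [anchorPart_apply, show linFun (0 : DualSection 𝓘(ℝ, E) F V) = fun _ => 0 from rfl,
    S.Λ.const_onFun]
  rfl

theorem anchorPart_one (a : DualSection 𝓘(ℝ, E) F V) : S.anchorPart a 1 = 0 :=
  S.anchorPart_const a 1

theorem anchorPart_zero (a : DualSection 𝓘(ℝ, E) F V) : S.anchorPart a 0 = 0 :=
  S.anchorPart_const a 0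

theorem anchorPart_neg (a : DualSection 𝓘(ℝ, E) F V) (f : C^∞⟮𝓘(ℝ, E), M; ℝ⟯) (x : M) :
    S.anchorPart a (-f) x = -S.anchorPart a f x := by
  have e : basicFun (F := F) (V := V) (-f) = fun v => (fun _ => (-1 : ℝ)) v * basicFun f v :=
    funext fun v => (neg_one_mul _).symm
  rw [anchorPart_apply, anchorPart_apply, e, S.Λ.onFun_mul _ contMDiff_const (contMDiff_basicFun f),
    S.Λ.onFun_const]
  ring

/-- The basic component of the Jacobi identity for ι_a, ι_b and the constant 1. -/
theorem actPart_cocycle (hrank : 0 < Module.finrank ℝ F) (a b : DualSection 𝓘(ℝ, E) F V) (x : M) :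
    S.anchorPart a (S.actPart b) x - S.anchorPart b (S.actPart a) x
      - S.actPart (S.linPart a b) x = 0 := by
  have h := congrArg (fun f : C^∞⟮𝓘(ℝ, E), M; ℝ⟯ => f x)
    (S.linPart_jacobi_and hrank (a, 0) (b, 0) (0, 1)).2
  have h1 : S.bracketPart (b, 0) (0, 1) = S.actPart b := by
    simp only [bracketPart, (S.linPart_zero b).2, anchorPart_one, anchorPart_zero, zero_mul]
    simp
  have h2 : S.bracketPart (0, 1) (a, 0) = -S.actPart a := by
    simp only [bracketPart, (S.zero_linPart a).2, anchorPart_one, anchorPart_zero, zero_mul]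
    simp
  rw [h1, h2] at h
  change S.bracketPart _ _ x + S.bracketPart _ _ x + S.bracketPart _ _ x = 0 at h
  simp only [bracketPart_apply, (S.linPart_zero _).2, (S.linPart_zero _).1, (S.zero_linPart _).2,
    (S.zero_linPart _).1, anchorPart_one, anchorPart_zero, anchorPart_zero_left, actPart_zero,
    anchorPart_neg] at h
  simp only [ContMDiffMap.coe_zero, ContMDiffMap.coe_one, ContMDiffMap.coe_neg, Pi.neg_apply,
    Pi.zero_apply, Pi.one_apply] at h
  linarith

/-- The basic component of the Jacobi identity for ι_a, ι_b, ι_c; with the sign of P₀ it becomes the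
twist condition. -/
theorem constPart_twist (hrank : 0 < Module.finrank ℝ F) (a b c : DualSection 𝓘(ℝ, E) F V)
    (x : M) :
    S.constPart (S.linPart a b) c x + S.constPart (S.linPart b c) a x
      + S.constPart (S.linPart c a) b x = S.anchorPart c (S.constPart a b) x
      + S.anchorPart a (S.constPart b c) x + S.anchorPart b (S.constPart c a) x
      + S.constPart a b x * S.actPart c x + S.constPart b c x * S.actPart a x
      + S.constPart c a x * S.actPart b x := by
  have h := congrArg (fun f : C^∞⟮𝓘(ℝ, E), M; ℝ⟯ => f x)
    (S.linPart_jacobi_and hrank (a, 0) (b, 0) (c, 0)).2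
  have h1 : ∀ a b, S.bracketPart (a, 0) (b, 0) = S.constPart a b := fun a b => by
    simp only [bracketPart, anchorPart_zero, zero_mul]
    simp
  rw [h1, h1, h1] at h
  change S.bracketPart _ _ x + S.bracketPart _ _ x + S.bracketPart _ _ x = 0 at h
  simp only [bracketPart_apply, anchorPart_zero, ContMDiffMap.coe_zero, Pi.zero_apply] at h
  linarith

/-- The Jacobi algebroid of a strongly-affine Jacobi structure. -/
def twistedJacobiAlgebroid (hrank : 0 < Module.finrank ℝ F) :
    TwistedJacobiAlgebroid 𝓘(ℝ, E) F V where
  toLieAlgebroid := S.lieAlgebroid hrank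
  X₀ := S.vectorPart hrank
  cocycle a b x := by
    simp only [LieAlgebroid.d₁, pairing_vectorPart, lieAlgebroid_rho]
    exact S.actPart_cocycle hrank a b x
  P₀ := S.skewBilinear hrank
  twist a b c x := by
    have h := S.constPart_twist hrank a b c x
    have h1 : S.constPart a c = -S.constPart c a := (S.linPart_skew_and a c).2
    have h2 : S.constPart (S.linPart a c) b = -S.constPart (S.linPart c a) b := by
      rw [(S.linPart_skew_and a c).1, (S.linPart_skew_and _ b).2, (S.linPart_skew_and _ b).2]
      exact congrArg Neg.neg (map_neg (AddMonoidHom.mk' (S.constPart b)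
        fun u w => (S.linPart_add_and b u w).2) (S.linPart c a))
    simp only [LieAlgebroid.d₂, wedge₁₂, pairing_vectorPart, lieAlgebroid_rho, skewBilinear]
    change _ - -S.constPart (S.linPart a b) c x + -S.constPart (S.linPart a c) b x
      - -S.constPart (S.linPart b c) a x = -(_ * -S.constPart b c x - _ * -S.constPart a c x
      + _ * -S.constPart a b x)
    rw [h1, h2]
    simp only [anchorPart_neg, ContMDiffMap.coe_neg, Pi.neg_apply, neg_neg]
    linarith

end StronglyAffineJacobi

end Reconstruction

/-! ### The two constructions are mutually inverse -/

section Correspondence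

variable {E : Type*} [NormedAddCommGroup E] [NormedSpace ℝ E] [FiniteDimensional ℝ E]
  {M : Type*} [TopologicalSpace M] [T2Space M] [ChartedSpace E M] [IsManifold 𝓘(ℝ, E) ∞ M]
  {F : Type*} [NormedAddCommGroup F] [NormedSpace ℝ F] [FiniteDimensional ℝ F]
  {V : M → Type*} [TopologicalSpace (TotalSpace F V)]
  [∀ x, AddCommGroup (V x)] [∀ x, Module ℝ (V x)] [∀ x, TopologicalSpace (V x)]
  [∀ x, IsTopologicalAddGroup (V x)] [∀ x, ContinuousSMul ℝ (V x)]
  [FiberBundle F V] [VectorBundle ℝ F V] [ContMDiffVectorBundle ∞ F V 𝓘(ℝ, E)]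

theorem mvfderiv_affFun_eq_dAff (v : TotalSpace F V)
    (p : DualSection 𝓘(ℝ, E) F V × C^∞⟮𝓘(ℝ, E), M; ℝ⟯) :
    mvfderiv (𝓘(ℝ, E).prod 𝓘(ℝ, F)) (affFun p.1 p.2) v = dAff v p := rfl

theorem BivectorField.ext_of_onFun_affFun
    {B C : BivectorField (𝓘(ℝ, E).prod 𝓘(ℝ, F)) (TotalSpace F V)}
    (h : ∀ (a b : DualSection 𝓘(ℝ, E) F V) (f g : C^∞⟮𝓘(ℝ, E), M; ℝ⟯) v,
      B.onFun (affFun a f) (affFun b g) v = C.onFun (affFun a f) (affFun b g) v) : B = C :=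
  BivectorField.ext_of_affine fun p q v => h p.1 q.1 p.2 q.2 v

theorem tangent_eq_of_affFun {v : TotalSpace F V}
    {u u' : TangentSpace (𝓘(ℝ, E).prod 𝓘(ℝ, F)) v}
    (h : ∀ (a : DualSection 𝓘(ℝ, E) F V) (f : C^∞⟮𝓘(ℝ, E), M; ℝ⟯),
      mvfderiv (𝓘(ℝ, E).prod 𝓘(ℝ, F)) (affFun a f) v u =
        mvfderiv (𝓘(ℝ, E).prod 𝓘(ℝ, F)) (affFun a f) v u') : u = u' := by
  have key : ∀ u u' : E × F, (∀ g : E × F →L[ℝ] ℝ, g u = g u') → u = u' := fun _ _ h =>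
    (SeparatingDual.eq_iff_forall_dual_eq (R := ℝ)).2 h
  refine key u u' fun g => ?_
  obtain ⟨p, hp⟩ := dAff_surjective (E := E) v g
  have h1 := h p.1 p.2
  rw [mvfderiv_affFun_eq_dAff v p, hp] at h1
  exact h1

namespace TwistedJacobiAlgebroid

variable (D : TwistedJacobiAlgebroid 𝓘(ℝ, E) F V)

/-- The bivector field of a twisted Jacobi algebroid. -/
def bivector : BivectorField (𝓘(ℝ, E).prod 𝓘(ℝ, F)) (TotalSpace F V) :=
  (exists_affForm_bivector D.toLieAlgebroid D.P₀ D.X₀).choose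

theorem bivector_onFun (a f b g v) : D.bivector.onFun (affFun a f) (affFun b g) v =
    affForm D.toLieAlgebroid D.P₀ D.X₀ (a, f) (b, g) v :=
  (exists_affForm_bivector D.toLieAlgebroid D.P₀ D.X₀).choose_spec a f b g v

/-- The Jacobi structure of a twisted Jacobi algebroid. -/
def jacobiStructure (hrank : 0 < Module.finrank ℝ F) :
    JacobiStructure (𝓘(ℝ, E).prod 𝓘(ℝ, F)) (TotalSpace F V) where
  Λ := D.bivector
  E := negLift D.X₀
  schouten_self f g h hf hg hh v := (isJacobi_of_twisted D.toLieAlgebroid D.P₀ D.X₀ hrank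
    D.bivector_onFun D.cocycle D.twist).1 f g h hf hg hh v
  schouten_mixed f g hf hg v := (isJacobi_of_twisted D.toLieAlgebroid D.P₀ D.X₀ hrank
    D.bivector_onFun D.cocycle D.twist).2 f g hf hg v

theorem jacobiStructure_bracket (hrank : 0 < Module.finrank ℝ F)
    (p q : DualSection 𝓘(ℝ, E) F V × C^∞⟮𝓘(ℝ, E), M; ℝ⟯) :
    (D.jacobiStructure hrank).bracket (affFun p.1 p.2) (affFun q.1 q.2) =
      affFun (D.bracket p.1 q.1) (basicPart D.toLieAlgebroid D.P₀ D.X₀ p q) :=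
  pairBracket_affFun D.toLieAlgebroid D.P₀ D.X₀ D.bivector_onFun p q

/-- The strongly-affine Jacobi structure of a twisted Jacobi algebroid. -/
def stronglyAffineJacobi (hrank : 0 < Module.finrank ℝ F) :
    StronglyAffineJacobi 𝓘(ℝ, E) F V where
  toJacobiStructure := D.jacobiStructure hrank
  affine φ ψ hφ hψ := by
    obtain ⟨a, f, rfl⟩ := exists_affFun_eq hφ
    obtain ⟨b, g, rfl⟩ := exists_affFun_eq hψ
    rw [D.jacobiStructure_bracket hrank (a, f) (b, g)]
    exact isAffineFun_affFun _ _
  hamiltonian_affine φ ψ hφ hψ := by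
    obtain ⟨a, f, rfl⟩ := exists_affFun_eq hφ
    obtain ⟨b, g, rfl⟩ := exists_affFun_eq hψ
    -- X_φ(ψ) = {φ, ψ} + ψE(φ), and E(φ) is pulled back from the base, so the product with ψ stays
    -- affine.
    have e : (D.jacobiStructure hrank).hamiltonianAct (affFun a f) (affFun b g) = fun v =>
        affFun (D.bracket a b) (basicPart D.toLieAlgebroid D.P₀ D.X₀ (a, f) (b, g)) v
          - pairingMap D.X₀ a v.proj * affFun b g v := by
      rw [← D.jacobiStructure_bracket hrank (a, f) (b, g)]
      funext v
      have h : VectorField.act (D.jacobiStructure hrank).E (affFun a f) v =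
        -pairingMap D.X₀ a v.proj := negLift_act_affFun D.X₀ a f v
      simp only [JacobiStructure.hamiltonianAct, JacobiStructure.bracket, h]
      ring
    rw [e]
    exact (isAffineFun_affFun _ _).sub ((isAffineFun_affFun b g).base_mul _)

/-- E determines X₀, and the linear component of the bracket determines the algebroid bracket. The
basic component for ι_a and ι_b + g∘π gives P₀ at g = 0 and then, for general g, the anchor. -/
theorem stronglyAffineJacobi_injective (hrank : 0 < Module.finrank ℝ F) :
    Function.Injective fun D : TwistedJacobiAlgebroid 𝓘(ℝ, E) F V =>
      D.stronglyAffineJacobi hrank := by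
  intro D D' h
  have hb : ∀ p q : DualSection 𝓘(ℝ, E) F V × C^∞⟮𝓘(ℝ, E), M; ℝ⟯,
      D.bracket p.1 q.1 = D'.bracket p.1 q.1 ∧ basicPart D.toLieAlgebroid D.P₀ D.X₀ p q =
        basicPart D'.toLieAlgebroid D'.P₀ D'.X₀ p q := fun p q => by
    refine affFun_injective ?_
    rw [← D.jacobiStructure_bracket hrank, ← D'.jacobiStructure_bracket hrank]
    exact congrArg (fun S : StronglyAffineJacobi 𝓘(ℝ, E) F V =>
      S.bracket (affFun p.1 p.2) (affFun q.1 q.2)) h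
  have hX : ∀ (a : DualSection 𝓘(ℝ, E) F V) x, pairing D.X₀ a x = pairing D'.X₀ a x := fun a x => by
    have h1 := congrArg (fun S : StronglyAffineJacobi 𝓘(ℝ, E) F V =>
      VectorField.act S.E (affFun a 0) ⟨x, 0⟩) h
    have h2 := negLift_act_affFun D.X₀ a 0 ⟨x, 0⟩
    have h3 := negLift_act_affFun D'.X₀ a 0 ⟨x, 0⟩
    exact neg_injective (h2.symm.trans (Eq.trans h1 h3))
  have hbas : ∀ (D : TwistedJacobiAlgebroid 𝓘(ℝ, E) F V) (a b : DualSection 𝓘(ℝ, E) F V)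
      (g : C^∞⟮𝓘(ℝ, E), M; ℝ⟯) (x : M),
      basicPart D.toLieAlgebroid D.P₀ D.X₀ (a, 0) (b, g) x = g x * pairing D.X₀ a x
        - D.P₀.toFun a b x + D.rho a g x := fun D a b g x => by
    have h0 := D.rho_const b 0 x
    change g x * pairing D.X₀ a x - 0 * pairing D.X₀ b x - D.P₀.toFun a b x
      + (D.rho a g x - D.rho b (fun _ => 0) x) = _
    rw [h0]
    ring
  have hbas' : ∀ (a b : DualSection 𝓘(ℝ, E) F V) (g : C^∞⟮𝓘(ℝ, E), M; ℝ⟯) (x : M),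
      - D.P₀.toFun a b x + D.rho a g x = - D'.P₀.toFun a b x + D'.rho a g x := fun a b g x => by
    have h1 := congrArg (fun f : C^∞⟮𝓘(ℝ, E), M; ℝ⟯ => f x) (hb (a, 0) (b, g)).2
    simp only [hbas, hX] at h1
    linarith
  have hP : ∀ a b x, D.P₀.toFun a b x = D'.P₀.toFun a b x := fun a b x => by
    have h1 := hbas' a b 0 x
    have h2 : D.rho a (0 : C^∞⟮𝓘(ℝ, E), M; ℝ⟯) x = 0 := D.rho_const a 0 x
    have h3 : D'.rho a (0 : C^∞⟮𝓘(ℝ, E), M; ℝ⟯) x = 0 := D'.rho_const a 0 x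
    linarith
  refine TwistedJacobiAlgebroid.ext ?_ ?_ ?_ ?_
  · exact funext fun a => funext fun b => (hb (a, 0) (b, 0)).1
  · ext x c
    obtain ⟨a, rfl⟩ := exists_dualSection_apply_eq (E := E) (F := F) (V := V) x c
    refine tangent_eq_of_forall_mvfderiv fun f => ?_
    have h1 := hbas' a a f x
    rw [hP, add_right_inj] at h1
    exact h1
  · refine ContMDiffSection.ext fun x => ?_
    exact eq_of_forall_dual_apply_eq (E := E) (F := F) fun a => hX a x
  · ext a b x
    exact hP a b x

end TwistedJacobiAlgebroid

theorem StronglyAffineJacobi.stronglyAffineJacobi_twistedJacobiAlgebroid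
    (hrank : 0 < Module.finrank ℝ F) (S : StronglyAffineJacobi 𝓘(ℝ, E) F V) :
    (S.twistedJacobiAlgebroid hrank).stronglyAffineJacobi hrank = S := by
  have hX := S.pairing_vectorPart hrank
  refine StronglyAffineJacobi.ext (BivectorField.ext_of_onFun_affFun fun a b f g v => ?_) ?_
  · refine ((S.twistedJacobiAlgebroid hrank).bivector_onFun a f b g v).trans ?_
    rw [S.onFun_affFun hrank]
    change linFun (S.linPart a b) v - -S.constPart a b v.proj
      + (linFun a v * pairing (S.vectorPart hrank) b v.proj
        - linFun b v * pairing (S.vectorPart hrank) a v.proj)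
      + ((S.lieAlgebroid hrank).rho a g v.proj - (S.lieAlgebroid hrank).rho b f v.proj) = _
    rw [hX, hX, lieAlgebroid_rho, lieAlgebroid_rho, sub_neg_eq_add]
  · ext v
    refine tangent_eq_of_affFun fun a f => ?_
    refine (negLift_act_affFun (S.vectorPart hrank) a f v).trans ?_
    rw [hX]
    exact (S.act_affFun hrank a f v).symm

/-- The correspondence of twisted Jacobi algebroids and strongly-affine Jacobi structures. -/
def twistedEquivStronglyAffine (hrank : 0 < Module.finrank ℝ F) :
    TwistedJacobiAlgebroid 𝓘(ℝ, E) F V ≃ StronglyAffineJacobi 𝓘(ℝ, E) F V where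
  toFun D := D.stronglyAffineJacobi hrank
  invFun S := S.twistedJacobiAlgebroid hrank
  -- A right inverse of an injective map is also a left inverse.
  left_inv _ := TwistedJacobiAlgebroid.stronglyAffineJacobi_injective hrank
    (StronglyAffineJacobi.stronglyAffineJacobi_twistedJacobiAlgebroid hrank _)
  right_inv := StronglyAffineJacobi.stronglyAffineJacobi_twistedJacobiAlgebroid hrank

end Correspondence

/-! ### Linear Poisson structures, vertical lifts and the formula for Λ_A -/

section LinearPoisson

variable {E : Type*} [NormedAddCommGroup E] [NormedSpace ℝ E] [FiniteDimensional ℝ E]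
  {M : Type*} [TopologicalSpace M] [T2Space M] [ChartedSpace E M] [IsManifold 𝓘(ℝ, E) ∞ M]
  {F : Type*} [NormedAddCommGroup F] [NormedSpace ℝ F] [FiniteDimensional ℝ F]
  {V : M → Type*} [TopologicalSpace (TotalSpace F V)]
  [∀ x, AddCommGroup (V x)] [∀ x, Module ℝ (V x)] [∀ x, TopologicalSpace (V x)]
  [∀ x, IsTopologicalAddGroup (V x)] [∀ x, ContinuousSMul ℝ (V x)]
  [FiberBundle F V] [VectorBundle ℝ F V] [ContMDiffVectorBundle ∞ F V 𝓘(ℝ, E)]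

theorem affFun_zero (a : DualSection 𝓘(ℝ, E) F V) : affFun a 0 = linFun a :=
  funext fun _ => add_zero _

theorem affFun_zero_left (f : C^∞⟮𝓘(ℝ, E), M; ℝ⟯) :
    affFun (0 : DualSection 𝓘(ℝ, E) F V) f = basicFun f :=
  funext fun _ => zero_add _

theorem pairing_zero (a : DualSection 𝓘(ℝ, E) F V) : pairing 0 a = fun _ => 0 :=
  funext fun x => map_zero (a x)

theorem act_negLift_zero (f : TotalSpace F V → ℝ) (v : TotalSpace F V) :
    (negLift (0 : Cₛ^∞⟮𝓘(ℝ, E); F, V⟯)).act f v = 0 := by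
  have h : negLift (0 : Cₛ^∞⟮𝓘(ℝ, E); F, V⟯) v = 0 := tangent_eq_of_affFun fun a g => by
    refine (negLift_act_affFun 0 a g v).trans ?_
    rw [pairing_zero, neg_zero, map_zero]
  rw [VectorField.act, h, map_zero]

/-- The zero bilinear map. -/
def SkewBilinear.zero : SkewBilinear 𝓘(ℝ, E) (F →L[ℝ] ℝ) (DualFiber V) where
  toFun _ _ := 0
  skew _ _ := neg_zero.symm
  map_add _ _ _ := (add_zero 0).symm
  map_smul _ _ _ := (mul_zero _).symm

/-- The opposite of a skew bilinear map. -/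
def SkewBilinear.neg (P : SkewBilinear 𝓘(ℝ, E) (F →L[ℝ] ℝ) (DualFiber V)) :
    SkewBilinear 𝓘(ℝ, E) (F →L[ℝ] ℝ) (DualFiber V) where
  toFun a b := -P.toFun a b
  skew a b := by rw [P.skew]
  map_add a b c := by rw [P.map_add, neg_add]
  map_smul a f b := by rw [P.map_smul, mul_neg]

/-- The Lie algebroid with zero bracket and zero anchor. -/
def LieAlgebroid.trivial : LieAlgebroid 𝓘(ℝ, E) (F →L[ℝ] ℝ) (DualFiber V) where
  bracket _ _ := 0
  anchor := 0
  bracket_add _ _ _ := (add_zero 0).symm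
  bracket_smul r _ _ := ContMDiffSection.ext fun x => by
    change (0 : DualFiber V x) = r • (0 : DualFiber V x)
    rw [smul_zero]
  bracket_skew _ _ := neg_zero.symm
  jacobi _ _ _ := by rw [add_zero, add_zero]
  leibniz a f b x := by
    change (0 : DualFiber V x) = f x • (0 : DualFiber V x) + (mvfderiv 𝓘(ℝ, E) f x 0 : ℝ) • b x
    rw [map_zero, smul_zero, zero_smul, add_zero]

/-- Off the zero section some ι_a is nonzero and can be cancelled; on the zero section the value
follows by continuity along a line in the fibre. -/
theorem eq_zero_of_linFun_mul (hrank : 0 < Module.finrank ℝ F) {h : TotalSpace F V → ℝ}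
    (hh : Continuous h) (hm : ∀ (a : DualSection 𝓘(ℝ, E) F V) v, linFun a v * h v = 0)
    (v : TotalSpace F V) : h v = 0 := by
  have h1 : ∀ (x : M) (w : V x), w ≠ 0 → h ⟨x, w⟩ = 0 := fun x w hw => by
    obtain ⟨a, ha⟩ := exists_dual_apply_ne_zero (E := E) (F := F) hw
    exact (mul_eq_zero.1 (hm a ⟨x, w⟩)).resolve_left ha
  obtain ⟨x, u⟩ := v
  by_cases hu : u = 0
  · obtain ⟨w, hw⟩ := exists_fiber_ne_zero (F := F) (V := V) hrank x
    have hc := hh.comp (contMDiff_fiberLine (E := E) (⟨x, 0⟩ : TotalSpace F V) w).continuous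
    have he := hc.ext_on (dense_compl_singleton (0 : ℝ)) continuous_const fun t ht => by
      refine h1 x _ ?_
      rw [zero_add]
      exact smul_ne_zero ht hw
    have h0 := congrFun he 0
    rw [hu]
    simpa using h0
  · exact h1 x u hu

/-- `IsInducedPoisson` prescribes values on linear functions only. Comparing its value on ι_a and
ι_{fb} with the Leibniz rule gives the claim multiplied by ι_b, which `eq_zero_of_linFun_mul`
removes. -/
theorem LieAlgebroid.IsInducedPoisson.onFun_linFun_basicFun (hrank : 0 < Module.finrank ℝ F)
    {L : LieAlgebroid 𝓘(ℝ, E) (F →L[ℝ] ℝ) (DualFiber V)}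
    {B : BivectorField (𝓘(ℝ, E).prod 𝓘(ℝ, F)) (TotalSpace F V)} (hB : L.IsInducedPoisson B)
    (a : DualSection 𝓘(ℝ, E) F V) (f : C^∞⟮𝓘(ℝ, E), M; ℝ⟯) (v : TotalSpace F V) :
    B.onFun (linFun a) (basicFun f) v = L.rho a f v.proj := by
  refine sub_eq_zero.1 (eq_zero_of_linFun_mul (E := E) hrank
    (h := fun v => B.onFun (linFun a) (basicFun f) v - L.rho a f v.proj)
    ((B.contMDiff_onFun (contMDiff_linFun a) (contMDiff_basicFun f)).sub
      (contMDiff_basicFun (L.rhoMap a f))).continuous (fun b v => ?_) v)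
  have h1 := hB.2.2 a (smulSection f b) v
  rw [linFun_smulSection, B.onFun_mul _ (contMDiff_basicFun f) (contMDiff_linFun b),
    hB.2.2, L.leibniz_section] at h1
  change f v.proj * _ + _ = f v.proj * linFun (L.bracket a b) v + L.rho a f v.proj * linFun b v
    at h1
  linarith

theorem LieAlgebroid.IsInducedPoisson.onFun_basicFun (hrank : 0 < Module.finrank ℝ F)
    {L : LieAlgebroid 𝓘(ℝ, E) (F →L[ℝ] ℝ) (DualFiber V)}
    {B : BivectorField (𝓘(ℝ, E).prod 𝓘(ℝ, F)) (TotalSpace F V)} (hB : L.IsInducedPoisson B)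
    (f g : C^∞⟮𝓘(ℝ, E), M; ℝ⟯) (v : TotalSpace F V) :
    B.onFun (basicFun f) (basicFun g) v = 0 := by
  refine eq_zero_of_linFun_mul (E := E) hrank
    (B.contMDiff_onFun (contMDiff_basicFun f) (contMDiff_basicFun g)).continuous (fun a v => ?_) v
  have h1 := hB.onFun_linFun_basicFun hrank (smulSection f a) g v
  rw [linFun_smulSection, B.mul_onFun _ (contMDiff_basicFun f) (contMDiff_linFun a),
    hB.onFun_linFun_basicFun hrank, L.rho_smulSection] at h1
  exact left_eq_add.1 h1.symm

theorem LieAlgebroid.IsInducedPoisson.onFun_affFun (hrank : 0 < Module.finrank ℝ F)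
    {L : LieAlgebroid 𝓘(ℝ, E) (F →L[ℝ] ℝ) (DualFiber V)}
    {B : BivectorField (𝓘(ℝ, E).prod 𝓘(ℝ, F)) (TotalSpace F V)} (hB : L.IsInducedPoisson B)
    (a b : DualSection 𝓘(ℝ, E) F V) (f g : C^∞⟮𝓘(ℝ, E), M; ℝ⟯) (v : TotalSpace F V) :
    B.onFun (affFun a f) (affFun b g) v =
      linFun (L.bracket a b) v + (L.rho a g v.proj - L.rho b f v.proj) := by
  rw [B.onFun_affFun, hB.2.2, hB.onFun_linFun_basicFun hrank, hB.onFun_linFun_basicFun hrank,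
    hB.onFun_basicFun hrank, add_zero]

theorem SkewBilinear.IsVerticalLift.onFun_affFun
    {P : SkewBilinear 𝓘(ℝ, E) (F →L[ℝ] ℝ) (DualFiber V)}
    {B : BivectorField (𝓘(ℝ, E).prod 𝓘(ℝ, F)) (TotalSpace F V)} (hB : P.IsVerticalLift B)
    (a b : DualSection 𝓘(ℝ, E) F V) (f g : C^∞⟮𝓘(ℝ, E), M; ℝ⟯) (v : TotalSpace F V) :
    B.onFun (affFun a f) (affFun b g) v = P.toFun a b v.proj := by
  have h : ∀ (f : C^∞⟮𝓘(ℝ, E), M; ℝ⟯) (h : TotalSpace F V → ℝ),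
      ContMDiff (𝓘(ℝ, E).prod 𝓘(ℝ, F)) 𝓘(ℝ, ℝ) ∞ h → B.onFun (basicFun f) h v = 0 :=
    fun f h hh => hB.2 f h hh v
  rw [B.onFun_affFun, hB.1, B.onFun_skew (linFun a), B.onFun_skew (linFun b),
    h g _ (contMDiff_linFun a), h f _ (contMDiff_linFun b), h f _ (contMDiff_basicFun g)]
  ring

theorem LieAlgebroid.existsUnique_isInducedPoisson (hrank : 0 < Module.finrank ℝ F)
    (L : LieAlgebroid 𝓘(ℝ, E) (F →L[ℝ] ℝ) (DualFiber V)) : ∃! B, L.IsInducedPoisson B := by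
  obtain ⟨B, hB⟩ := exists_affForm_bivector L SkewBilinear.zero 0
  have h0 : ∀ a x, L.rho a (fun _ => (0 : ℝ)) x = 0 := fun a x => L.rho_const a 0 x
  have h1 : ∀ (a b : DualSection 𝓘(ℝ, E) F V) (v : TotalSpace F V),
      B.onFun (linFun a) (linFun b) v = linFun (L.bracket a b) v := fun a b v => by
    have h := hB a 0 b 0 v
    rw [affFun_zero, affFun_zero] at h
    rw [h, affForm]
    change _ - 0 + (_ * pairing 0 b v.proj - _ * pairing 0 a v.proj)
      + (L.rho a (fun _ => (0 : ℝ)) v.proj - L.rho b (fun _ => (0 : ℝ)) v.proj) = _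
    rw [pairing_zero, pairing_zero, h0, h0]
    ring
  -- For zero `P` and `X` the cocycle and twist conditions are trivial, the vector field is zero,
  -- and the Jacobi condition on [Λ, Λ] is the Poisson condition.
  have h2 := isJacobi_of_twisted L SkewBilinear.zero 0 hrank hB
    (fun a b x => by
      simp only [LieAlgebroid.d₁, pairing_zero, h0, sub_zero])
    (fun a b c x => by
      have e : ∀ a b : DualSection 𝓘(ℝ, E) F V, ((SkewBilinear.zero (V := V)).toFun a b : M → ℝ) =
        fun _ => 0 := fun _ _ => rfl
      simp only [LieAlgebroid.d₂, wedge₁₂, e, h0]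
      ring)
  refine ⟨B, ⟨fun f g h hf hg hh v => ?_, fun f g hf hg => ?_, h1⟩, fun C hC => ?_⟩
  · rw [h2.1 f g h hf hg hh v, VectorField.wedge, act_negLift_zero, act_negLift_zero,
      act_negLift_zero]
    ring
  · obtain ⟨a, rfl⟩ := exists_linFun_eq hf
    obtain ⟨b, rfl⟩ := exists_linFun_eq hg
    rw [show B.onFun (linFun a) (linFun b) = linFun (L.bracket a b) from funext (h1 a b)]
    exact isLinearFun_linFun _
  · refine BivectorField.ext_of_onFun_affFun fun a b f g v => ?_
    rw [hC.onFun_affFun hrank, hB, affForm]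
    change _ = _ - 0 + (_ * pairing 0 b v.proj - _ * pairing 0 a v.proj) + _
    rw [pairing_zero, pairing_zero]
    ring

theorem SkewBilinear.existsUnique_isVerticalLift
    (P : SkewBilinear 𝓘(ℝ, E) (F →L[ℝ] ℝ) (DualFiber V)) : ∃! B, P.IsVerticalLift B := by
  -- The opposite of `P` compensates the minus sign in `affForm`.
  obtain ⟨B, hB⟩ := exists_affForm_bivector LieAlgebroid.trivial P.neg 0
  have h : ∀ (a b : DualSection 𝓘(ℝ, E) F V) (f g : C^∞⟮𝓘(ℝ, E), M; ℝ⟯) (v : TotalSpace F V),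
      B.onFun (affFun a f) (affFun b g) v = P.toFun a b v.proj := fun a b f g v => by
    rw [hB, affForm]
    have h1 : ∀ (a : DualSection 𝓘(ℝ, E) F V) (f : C^∞⟮𝓘(ℝ, E), M; ℝ⟯),
        LieAlgebroid.trivial.rho a f v.proj = 0 := fun a f =>
      map_zero (mvfderiv 𝓘(ℝ, E) f v.proj)
    have h2 : linFun (LieAlgebroid.trivial.bracket a b) v = 0 := rfl
    have h3 : P.neg.toFun a b v.proj = -P.toFun a b v.proj := rfl
    rw [h1, h1, h2, h3, pairing_zero, pairing_zero]
    ring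
  refine ⟨B, ⟨fun a b v => ?_, fun f g hg v => ?_⟩, fun C hC => ?_⟩
  · rw [← affFun_zero a, ← affFun_zero b, h]
  -- The arbitrary function `g` is replaced by an affine one with the same differential at `v`; the
  -- linear part of f∘π is zero, where `P` vanishes.
  · obtain ⟨q, hq⟩ := dAff_surjective (E := E) v (mvfderiv (𝓘(ℝ, E).prod 𝓘(ℝ, F)) g v)
    have h1 := h 0 q.1 f q.2 v
    rw [BivectorField.onFun, mvfderiv_affFun_eq_dAff, hq, affFun_zero_left] at h1
    refine h1.trans ?_
    rw [P.skew]
    change -P.toFun q.1 0 v.proj = 0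
    rw [P.apply_eq_zero rfl, neg_zero]
  · exact BivectorField.ext_of_onFun_affFun fun a b f g v => by rw [hC.onFun_affFun, h]

/-- It suffices to insert differentials of affine functions. On ι_a + f∘π the Liouville field gives
ι_a and the lift of X₀ gives ⟨a, X₀⟩, which accounts for the wedge term of `affForm`. -/
theorem TwistedJacobiAlgebroid.bivector_form (hrank : 0 < Module.finrank ℝ F)
    (D : TwistedJacobiAlgebroid 𝓘(ℝ, E) F V)
    {Λbar Pv : BivectorField (𝓘(ℝ, E).prod 𝓘(ℝ, F)) (TotalSpace F V)}
    (hΛ : D.toLieAlgebroid.IsInducedPoisson Λbar) (hP : D.P₀.IsVerticalLift Pv)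
    (v : TotalSpace F V) (α β : Cotangent (𝓘(ℝ, E).prod 𝓘(ℝ, F)) v) :
    D.bivector.form v α β = Λbar.form v α β - Pv.form v α β
      + (α (liouville 𝓘(ℝ, E) v) * β (sectionLift D.X₀ v)
        - β (liouville 𝓘(ℝ, E) v) * α (sectionLift D.X₀ v)) := by
  obtain ⟨⟨a, f⟩, rfl⟩ := dAff_surjective (E := E) v α
  obtain ⟨⟨b, g⟩, rfl⟩ := dAff_surjective (E := E) v β
  have h1 := D.bivector_onFun a f b g v
  have h2 := hΛ.onFun_affFun hrank a b f g v
  have h3 := hP.onFun_affFun a b f g v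
  have hl : ∀ (a : DualSection 𝓘(ℝ, E) F V) (f : C^∞⟮𝓘(ℝ, E), M; ℝ⟯),
      dAff v (a, f) (liouville 𝓘(ℝ, E) v) = linFun a v := fun a f =>
    mvfderiv_affFun_verticalLift a f v v.snd
  have hs : ∀ (a : DualSection 𝓘(ℝ, E) F V) (f : C^∞⟮𝓘(ℝ, E), M; ℝ⟯),
      dAff v (a, f) (sectionLift D.X₀ v) = pairing D.X₀ a v.proj := fun a f =>
    mvfderiv_affFun_verticalLift a f v (D.X₀ v.proj)
  rw [hl, hl, hs, hs]
  refine h1.trans ?_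
  change _ = Λbar.onFun (affFun a f) (affFun b g) v - Pv.onFun (affFun a f) (affFun b g) v + _
  rw [h2, h3, affForm]
  ring

end LinearPoisson

end JacobiBundle

end

theorem mainTheorem9
    {E : Type*} [NormedAddCommGroup E] [NormedSpace ℝ E] [FiniteDimensional ℝ E]
    {M : Type*} [TopologicalSpace M] [T2Space M] [ChartedSpace E M]
    [IsManifold 𝓘(ℝ, E) ∞ M]
    {F : Type*} [NormedAddCommGroup F] [NormedSpace ℝ F] [FiniteDimensional ℝ F]
    {V : M → Type*} [TopologicalSpace (TotalSpace F V)]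
    [∀ x, AddCommGroup (V x)] [∀ x, Module ℝ (V x)] [∀ x, TopologicalSpace (V x)]
    [∀ x, IsTopologicalAddGroup (V x)] [∀ x, ContinuousSMul ℝ (V x)]
    [FiberBundle F V] [VectorBundle ℝ F V] [ContMDiffVectorBundle ∞ F V 𝓘(ℝ, E)]
    (hrank : 0 < Module.finrank ℝ F) :
    -- the linear Poisson structure of a Lie algebroid on the dual, and the vertical lift of a
    -- skew bilinear map, exist and are unique
    (∀ L : JacobiBundle.LieAlgebroid 𝓘(ℝ, E) (F →L[ℝ] ℝ) (JacobiBundle.DualFiber V),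
      ∃! B, L.IsInducedPoisson B) ∧
    (∀ P : JacobiBundle.SkewBilinear 𝓘(ℝ, E) (F →L[ℝ] ℝ) (JacobiBundle.DualFiber V),
      ∃! B, P.IsVerticalLift B) ∧
    -- the one-to-one correspondence
    ∃ Φ : JacobiBundle.TwistedJacobiAlgebroid 𝓘(ℝ, E) F V ≃
        JacobiBundle.StronglyAffineJacobi 𝓘(ℝ, E) F V,
      ∀ D : JacobiBundle.TwistedJacobiAlgebroid 𝓘(ℝ, E) F V,
        -- `Λ_A = Λbar - P₀^v + Δ_A ∧ X₀^v`
        (∀ Λbar Pv, D.toLieAlgebroid.IsInducedPoisson Λbar → D.P₀.IsVerticalLift Pv →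
          ∀ (v : TotalSpace F V) (α β : JacobiBundle.Cotangent (𝓘(ℝ, E).prod 𝓘(ℝ, F)) v),
            (Φ D).Λ.form v α β = Λbar.form v α β - Pv.form v α β
              + (α (JacobiBundle.liouville 𝓘(ℝ, E) v) * β (JacobiBundle.sectionLift D.X₀ v)
                - β (JacobiBundle.liouville 𝓘(ℝ, E) v)
                  * α (JacobiBundle.sectionLift D.X₀ v))) ∧
        -- `E_A = -X₀^v`
        (∀ v : TotalSpace F V, (Φ D).E v = -JacobiBundle.sectionLift D.X₀ v) ∧
        -- the Jacobi bracket of the affine functions `ι_a + f ∘ π` and `ι_b + g ∘ π`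
        ∀ (a b : JacobiBundle.DualSection 𝓘(ℝ, E) F V) (f g : C^∞⟮𝓘(ℝ, E), M; ℝ⟯)
          (v : TotalSpace F V),
          (Φ D).bracket (fun u => JacobiBundle.linFun a u + f u.proj)
              (fun u => JacobiBundle.linFun b u + g u.proj) v
            = JacobiBundle.linFun (D.bracket a b) v
              + (-D.P₀.toFun a b v.proj
                - f v.proj * JacobiBundle.pairing D.X₀ b v.proj
                + g v.proj * JacobiBundle.pairing D.X₀ a v.proj
                - D.rho b f v.proj + D.rho a g v.proj) := by
  refine ⟨JacobiBundle.LieAlgebroid.existsUnique_isInducedPoisson hrank,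
    JacobiBundle.SkewBilinear.existsUnique_isVerticalLift,
    JacobiBundle.twistedEquivStronglyAffine hrank, fun D =>
    ⟨fun Λbar Pv hΛ hP v α β => D.bivector_form hrank hΛ hP v α β, fun v => rfl,
      fun a b f g v => ?_⟩⟩
  refine (congrFun (D.jacobiStructure_bracket hrank (a, f) (b, g)) v).trans ?_
  change JacobiBundle.linFun (D.bracket a b) v
    + (g v.proj * JacobiBundle.pairing D.X₀ a v.proj - f v.proj * JacobiBundle.pairing D.X₀ b v.proj
      - D.P₀.toFun a b v.proj + (D.rho a g v.proj - D.rho b f v.proj)) = _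
  ring
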